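/- For an integer $L>1$ let $\Lambda_L^{\mathrm{free}}$ be the graph with vertex set $\{0,\dots,L-1\}^2$ whose edges are the pairs $\{(a,b),(c,d)\}$ with $\{|a-c|,|b-d|\}=\{0,1\}$, and for even $L>1$ let $\Lambda_L^{\mathrm{per}}$ be the graph on the same vertex set in which two vertices are adjacent if they are equal in one coordinate and differ by exactly one modulo $L$ in the other (a simple graph: each edge has multiplicity one, also for $L=2$). A square domain with free, respectively periodic, boundary conditions is a graph $\Lambda=\Lambda_L^{\mathrm{free}}$ ($L>1$), respectively $\Lambda=\Lambda_L^{\mathrm{per}}$ ($L>1$ even). Write $j\sim\ell$ for adjacency in $\Lambda$, $\mathrm{dist}$ for the graph distance, $\langle f,g\rangle=\sum_{j\in\Lambda}f_jg_j$, and $(\Delta_\Lambda f)(j)=\sum_{\ell\sim j}(f_\ell-f_j)$. Let $\Delta_\Lambda^{-1}$ be the Moore–Penrose pseudoinverse of $\Delta_\Lambda$, that is, the unique linear operator with $\Delta_\Lambda\Delta_\Lambda^{-1}f=\Delta_\Lambda^{-1}\Delta_\Lambda f=f$ for all $f:\Lambda\to\mathbb{R}$ with $\sum_{j}f_j=0$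 and $\Delta_\Lambda^{-1}f=0$ for constant $f$. For $\beta>0$ and $v\in\Lambda$, the integer-valued discrete Gaussian free field on $\Lambda$ at inverse temperature $\beta$, normalized to equal $0$ at $v$, is the probability measure on $m:\Lambda\to\mathbb{Z}$ $$d\mu^{\mathrm{IV}}_{\beta,\Lambda,v}(m)=\frac{1}{Z^{\mathrm{IV}}_{\beta,\Lambda,v}}\exp\Big[-\frac{\beta}{2}\sum_{j\sim\ell}(m_j-m_\ell)^2\Big]\,d\delta_0(m_v)\prod_{j\in\Lambda\setminus\{v\}}d_{\mathrm{count}(\mathbb{Z})}(m_j),$$ where each edge is counted once in the sum over $j\sim\ell$, $\delta_0$ is the Dirac measure at $0$ and $d_{\mathrm{count}(\mathbb{Z})}$ is the counting measure on $\mathbb{Z}$. Write $\mathbb{E}^{\mathrm{IV}}_{\beta,\Lambda,v}$ for the corresponding expectation. **Theorem.** There is an absolute constant $c>0$ such that for every $\varepsilon>0$ there exists $\beta_0>0$ for which the following holds for every square domain $\Lambda$ with free or periodic boundary conditions, every $0<\beta<\beta_0$ and every $v\in\Lambda$. 1. For every $f:\Lambda\to\mathbb{R}$ with $\sum_{j\in\Lambda}f_j=0$,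 $$\mathbb{E}^{\mathrm{IV}}_{\beta,\Lambda,v}\big[e^{\langle m,f\rangle}\big]\ge\exp\Big[\frac{1}{2(1+\varepsilon)\beta}\langle f,-\Delta_\Lambda^{-1}f\rangle\Big].$$ 2. For every $f:\Lambda\to\mathbb{R}$ with $\sum_{j\in\Lambda}f_j=0$, $$\mathbb{E}^{\mathrm{IV}}_{\beta,\Lambda,v}\big[\langle m,f\rangle^2\big]\ge\frac{1}{(1+\varepsilon)\beta}\langle f,-\Delta_\Lambda^{-1}f\rangle.$$ 3. For all $j,k\in\Lambda$, $$\mathbb{E}^{\mathrm{IV}}_{\beta,\Lambda,v}\big[(m_j-m_k)^2\big]\ge\frac{c}{\beta}\log(\mathrm{dist}(j,k)+1).$$ -/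

import Mathlib

/-! ### Square domains -/

/-- The two boundary conditions. -/
inductive BoundaryCondition
  | free
  | periodic

/-- The square domain of side `L`, with vertex set `{0, …, L-1}²`. For free boundary conditions it
is the `L × L` grid; for periodic boundary conditions two vertices are adjacent if they are equal in
one coordinate and differ by exactly one modulo `L` in the other. -/
def squareDomain (L : ℕ) : BoundaryCondition → SimpleGraph (Fin L × Fin L)
  | .free => SimpleGraph.boxProd (SimpleGraph.pathGraph L) (SimpleGraph.pathGraph L)
  | .periodic => SimpleGraph.boxProd (SimpleGraph.cycleGraph L) (SimpleGraph.cycleGraph L)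

theorem squareDomain_free_adj (L : ℕ) (x y : Fin L × Fin L) :
    (squareDomain L .free).Adj x y ↔
      ((x.1.val + 1 = y.1.val ∨ y.1.val + 1 = x.1.val) ∧ x.2 = y.2) ∨
        ((x.2.val + 1 = y.2.val ∨ y.2.val + 1 = x.2.val) ∧ x.1 = y.1) := by
  simp only [squareDomain, SimpleGraph.boxProd_adj, SimpleGraph.pathGraph_adj]

theorem squareDomain_periodic_adj (L : ℕ) (x y : Fin L × Fin L) :
    (squareDomain L .periodic).Adj x y ↔
      (((x.1 - y.1).val = 1 ∨ (y.1 - x.1).val = 1) ∧ x.2 = y.2) ∨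
        (((x.2 - y.2).val = 1 ∨ (y.2 - x.2).val = 1) ∧ x.1 = y.1) := by
  simp only [squareDomain, SimpleGraph.boxProd_adj, SimpleGraph.cycleGraph_adj']

theorem squareDomain_connected {L : ℕ} (hL : 1 < L) (bc : BoundaryCondition) :
    (squareDomain L bc).Connected := by
  obtain ⟨n, rfl⟩ : ∃ n, L = n + 1 := ⟨L - 1, by omega⟩
  cases bc
  · exact (SimpleGraph.pathGraph_connected n).boxProd (SimpleGraph.pathGraph_connected n)
  · exact SimpleGraph.cycleGraph_connected.boxProd SimpleGraph.cycleGraph_connected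

/-! ### The Laplacian and its pseudoinverse -/

open Classical in
/-- The finite difference Laplacian `(Δ f)(j) = ∑_{ℓ ∼ j} (f ℓ - f j)`. -/
noncomputable def graphLaplacian {V : Type*} [Fintype V] (G : SimpleGraph V) :
    (V → ℝ) →ₗ[ℝ] (V → ℝ) where
  toFun f j := ∑ l : V with G.Adj j l, (f l - f j)
  map_add' f g := by
    funext j
    simp only [Pi.add_apply, ← Finset.sum_add_distrib]
    exact Finset.sum_congr rfl fun _ _ => by ring
  map_smul' a f := by
    funext j
    simp only [Pi.smul_apply, smul_eq_mul, RingHom.id_apply, Finset.mul_sum]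
    exact Finset.sum_congr rfl fun _ _ => by ring

/-- The characterization of the Moore–Penrose pseudoinverse of the Laplacian of a finite connected
graph. -/
structure IsLaplacianPseudoinverse {V : Type*} [Fintype V] (G : SimpleGraph V)
    (T : (V → ℝ) →ₗ[ℝ] (V → ℝ)) : Prop where
  laplacian_apply : ∀ f : V → ℝ, ∑ j, f j = 0 → graphLaplacian G (T f) = f
  apply_laplacian : ∀ f : V → ℝ, ∑ j, f j = 0 → T (graphLaplacian G f) = f
  apply_const : ∀ a : ℝ, T (fun _ => a) = 0

open Classical in
theorem graphLaplacian_eq_neg_lapMatrix {V : Type*} [Fintype V] (G : SimpleGraph V) (f : V → ℝ) :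
    graphLaplacian G f = -((G.lapMatrix ℝ).mulVec f) := by
  funext j
  have h : G.neighborFinset j = ({l : V | G.Adj j l} : Finset V) := by
    ext l; simp
  simp only [graphLaplacian, LinearMap.coe_mk, AddHom.coe_mk, Pi.neg_apply,
    SimpleGraph.lapMatrix_mulVec_apply, Finset.sum_sub_distrib, Finset.sum_const, nsmul_eq_mul]
  rw [h, ← h, SimpleGraph.card_neighborFinset_eq_degree]
  ring

theorem graphLaplacian_const {V : Type*} [Fintype V] (G : SimpleGraph V) (a : ℝ) :
    graphLaplacian G (fun _ => a) = 0 := by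
  funext j
  simp [graphLaplacian]

theorem sum_graphLaplacian {V : Type*} [Fintype V] (G : SimpleGraph V) (f : V → ℝ) :
    ∑ j, graphLaplacian G f j = 0 := by
  classical
  have h : ∑ j, graphLaplacian G f j = -∑ j, graphLaplacian G f j := by
    simp only [graphLaplacian, LinearMap.coe_mk, AddHom.coe_mk, Finset.sum_filter]
    conv_rhs => rw [Finset.sum_comm]
    simp only [← Finset.sum_neg_distrib]
    refine Finset.sum_congr rfl fun j _ => Finset.sum_congr rfl fun l _ => ?_
    by_cases hjl : G.Adj j l
    · simp [hjl, hjl.symm]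
    · simp [hjl, G.adj_comm l j]
  linarith

theorem graphLaplacian_eq_zero {V : Type*} [Fintype V] {G : SimpleGraph V} (hG : G.Connected)
    {f : V → ℝ} (hf : graphLaplacian G f = 0) (i j : V) : f i = f j := by
  classical
  rw [graphLaplacian_eq_neg_lapMatrix, neg_eq_zero] at hf
  exact (G.lapMatrix_mulVec_eq_zero_iff_forall_reachable).1 (by convert hf) i j (hG i j)

theorem existsUnique_isLaplacianPseudoinverse {V : Type*} [Fintype V] (G : SimpleGraph V)
    (hG : G.Connected) : ∃! T : (V → ℝ) →ₗ[ℝ] (V → ℝ), IsLaplacianPseudoinverse G T := by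
  classical
  have := hG.nonempty
  have hn : (Fintype.card V : ℝ) ≠ 0 := by exact_mod_cast Fintype.card_ne_zero
  let M : (V → ℝ) →ₗ[ℝ] (V → ℝ) :=
    { toFun := fun f _ => (∑ j, f j) / Fintype.card V
      map_add' := fun f g => by
        funext; simp [Finset.sum_add_distrib, add_div]
      map_smul' := fun a f => by
        funext; simp [← Finset.mul_sum, mul_div_assoc] }
  have hM : ∀ f i, M f i = (∑ j, f j) / Fintype.card V := fun _ _ => rfl
  have hM0 : ∀ f : V → ℝ, ∑ j, f j = 0 → M f = 0 := fun f hf => by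
    funext i; simp [hM, hf]
  have hLM : ∀ f, graphLaplacian G (M f) = 0 := fun f => graphLaplacian_const G _
  have hMsum : ∀ f, ∑ i, M f i = ∑ j, f j := fun f => by
    simp only [hM, Finset.sum_const, Finset.card_univ, nsmul_eq_mul]
    field_simp
  let A := graphLaplacian G - M
  have hsumA : ∀ f, ∑ i, A f i = -∑ j, f j := fun f => by
    simp only [A, LinearMap.sub_apply, Pi.sub_apply, Finset.sum_sub_distrib, sum_graphLaplacian,
      hMsum, zero_sub]
  have hAinj : Function.Injective A := by
    rw [← LinearMap.ker_eq_bot, LinearMap.ker_eq_bot']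
    intro f hf
    have h0 : ∑ j, f j = 0 := by
      have := hsumA f
      rw [hf] at this
      simpa using this
    have hL : graphLaplacian G f = 0 := by
      have : graphLaplacian G f - M f = 0 := hf
      rwa [hM0 f h0, sub_zero] at this
    funext i
    have : ∑ j, f j = Fintype.card V * f i := by
      rw [Finset.sum_congr rfl fun j _ => graphLaplacian_eq_zero hG hL j i]
      simp
    rw [h0] at this
    simpa [hn] using this.symm
  let e := LinearEquiv.ofInjectiveEndo A hAinj
  have he : ∀ f, A (e.symm f) = f := fun f => e.apply_symm_apply f
  have he' : ∀ f, e.symm (A f) = f := fun f => e.symm_apply_apply f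
  refine ⟨e.symm.toLinearMap + M, ⟨fun f hf => ?_, fun f hf => ?_, fun a => ?_⟩, ?_⟩
  · have h0 : ∑ j, e.symm f j = 0 := by
      have := hsumA (e.symm f)
      rw [he, hf] at this
      linarith
    have : graphLaplacian G (e.symm f) - M (e.symm f) = f := he f
    rw [hM0 _ h0, sub_zero] at this
    simp [hM0 f hf, this]
  · have h1 : A f = graphLaplacian G f := by simp [A, hM0 f hf]
    have h2 := hM0 _ (sum_graphLaplacian G f)
    rw [LinearMap.add_apply, h2, add_zero, ← h1]
    exact he' f
  · have hMa : M (fun _ => a) = fun _ => a := by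
      funext i; simp [hM, hn]
    have h1 : A (-fun _ => a) = fun _ => a := by
      rw [map_neg]
      simp [A, graphLaplacian_const, hMa]
    have h2 : e.symm (fun _ => a) = -fun _ => a := by
      conv_lhs => rw [← h1]
      exact he' _
    rw [LinearMap.add_apply, hMa]
    exact (congrArg (· + fun _ => a) h2).trans (neg_add_cancel _)
  · have key : ∀ T : (V → ℝ) →ₗ[ℝ] (V → ℝ), IsLaplacianPseudoinverse G T →
        ∀ f, T f = e.symm (f - M f) := by
      intro T hT f
      have hz : ∑ j, (f - M f) j = 0 := by
        simp [Finset.sum_sub_distrib, hMsum]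
      have hw : ∑ j, e.symm (f - M f) j = 0 := by
        have := hsumA (e.symm (f - M f))
        rw [he, hz] at this
        linarith
      have h1 : graphLaplacian G (e.symm (f - M f)) = f - M f := by
        have : graphLaplacian G (e.symm (f - M f)) - M (e.symm (f - M f)) = f - M f := he _
        rwa [hM0 _ hw, sub_zero] at this
      have h2 := hT.apply_laplacian _ hw
      rw [h1, map_sub, show T (M f) = 0 from hT.apply_const _, sub_zero] at h2
      exact h2
    intro T hT
    refine LinearMap.ext fun f => ?_
    have hM2 : ∀ f, M (M f) = M f := fun f => by
      funext i; rw [hM, hMsum, hM]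
    have h3 : e.symm (M f) = -M f := by
      have : A (-M f) = M f := by rw [map_neg]; simp [A, hLM, hM2]
      conv_lhs => rw [← this]
      exact he' _
    rw [key T hT, map_sub, h3, LinearMap.add_apply, sub_neg_eq_add]
    rfl

/-- The Moore–Penrose pseudoinverse `Δ⁻¹` of the Laplacian of a finite connected graph. -/
noncomputable def laplacianPseudoinverse {V : Type*} [Fintype V] (G : SimpleGraph V)
    (hG : G.Connected) : (V → ℝ) →ₗ[ℝ] (V → ℝ) :=
  (existsUnique_isLaplacianPseudoinverse G hG).choose

theorem laplacianPseudoinverse_spec {V : Type*} [Fintype V] (G : SimpleGraph V)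
    (hG : G.Connected) : IsLaplacianPseudoinverse G (laplacianPseudoinverse G hG) :=
  (existsUnique_isLaplacianPseudoinverse G hG).choose_spec.1

/-! ### The integer-valued discrete Gaussian free field -/

/-- The pairing `⟨f, g⟩ = ∑_j f_j g_j`. -/
def pairing {V : Type*} [Fintype V] (f g : V → ℝ) : ℝ := ∑ j, f j * g j

open Classical in
/-- The Dirichlet energy `∑_{j ∼ ℓ} (m_j - m_ℓ)²`, each edge being counted exactly once. -/
noncomputable def dirichletEnergy {V : Type*} [Fintype V] (G : SimpleGraph V) (m : V → ℤ) : ℝ :=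
  ∑ e ∈ G.edgeFinset,
    Sym2.lift ⟨fun j l => ((m j : ℝ) - (m l : ℝ)) ^ 2, fun _ _ => by ring⟩ e

open Classical in
/-- The unnormalized measure
`exp (-(β/2) ∑_{j ∼ ℓ} (m_j - m_ℓ)²) dδ₀(m_v) ∏_{j ≠ v} d_{count(ℤ)}(m_j)`. -/
noncomputable def unnormalizedIVGFF {V : Type*} [Fintype V] (G : SimpleGraph V) (β : ℝ) (v : V) :
    MeasureTheory.Measure (V → ℤ) :=
  (MeasureTheory.Measure.pi fun j : V =>
      if j = v then MeasureTheory.Measure.dirac (0 : ℤ) else MeasureTheory.Measure.count).withDensity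
    fun m => ENNReal.ofReal (Real.exp (-(β / 2) * dirichletEnergy G m))

/-- The integer-valued discrete Gaussian free field on `G` at inverse temperature `β`, normalized to
equal `0` at `v`. -/
noncomputable def ivGFF {V : Type*} [Fintype V] (G : SimpleGraph V) (β : ℝ) (v : V) :
    MeasureTheory.Measure (V → ℤ) :=
  (unnormalizedIVGFF G β v Set.univ)⁻¹ • unnormalizedIVGFF G β v

/-! Poisson summation turns the field into a lattice Coulomb gas: integer charges `q` of total
charge zero with weight exp(-αG(q)), where G(q) = ⟨q, -Δ⁻¹q⟩ and α = 2π²/β. Up to a constant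
independent of `f`, the Laplace transform at `f` is exp(G(f)/(2β)) times the sum of these weights
against cos(2π⟨q, σ⟩), with σ = β⁻¹(-Δ⁻¹f) (`exists_tsum_fieldWeight`). The theorem thus reduces to
showing that the average of the cosine is at least exp(-δ · (Dirichlet energy of σ)) with δ/β small
(`coulomb_ge`). For small β the charges are strongly bound into neutral multipoles, which feel only
the gradient of σ and merely renormalize the Gaussian variance. This is the Fröhlich–Spencer
argument.

A part κ⟨q, q⟩ of the energy is spent as self-energy of the charges, so that every site carries a
factor 1 + ∑ 2exp(-κn²)cos(n·). In the group algebra of charge configurations a product of factors 1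
+ K cos ρ is a convex combination of products of the same shape over clusters
(`cosFactor_mul_cosFactor`, `prod_cosFactor_mem_convexHull`). This is iterated over the scales
128^k, merging clusters that are close (`IsState.merge`). Merging costs a bounded factor per
covering centre. Clusters that are really merged multiply their weights; a cluster with several
centres loses at least half of them; an isolated charged cluster receives a bump, that is a cutoff
function at the current scale which sees its charge, and earns exp(-γ). An isolated neutral cluster
earns nothing, and is frozen when the scale index reaches about 3/2 of its birth index, while its
weight is still small. Beyond the diameter only frozen neutral clusters are left, apart from one
possible charged factor that neutrality eliminates.

For such a network the cutoffs have disjoint gradients and bounded Dirichlet energy, so ∑⟨q, a_e⟩² ≤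
M·G(q), and αG(q) - κ⟨q, q⟩ - γ∑⟨q, a_e⟩² is nonnegative (`IsNetwork.exists_cutoffs`). Each cutoff
sees the charge of its own cluster only, so the subtracted squares just shrink the activities to z_i
= K_i exp(-γ g_i), and the remaining form is the covariance of a Gaussian vector y. The charge sum
becomes the Gaussian mean of ∏(1 + z_i cos(y_i + θ_i)) with θ_i = 2π⟨ρ_i, σ⟩. Symmetrizing in θ and
using the arithmetic-geometric inequality, the shift costs at most exp(-4∑|z_i|θ_i²)
(`gaussianCosSum_ge`). Neutrality bounds θ_i² by the local Dirichlet energy of σ, and the decay of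
z_i in the birth scale makes the sum at most a constant times exp(-100s) times the Dirichlet energy,
with s of order 1/β (`IsNetwork.chargeSum_ge`).

The second moment follows by scaling f → tf with t → 0. The logarithm comes from the resistance
between two points, bounded below by cutoffs on disjoint annuli (`log_dist_le_greenEnergy`). -/

/-! ### Cut-connected finite sets -/

/-- A finite set is cut-connected for a relation if every proper nonempty part is related to its
complement. -/
def CutConnected {ι : Type*} [DecidableEq ι] (r : ι → ι → Prop) (J : Finset ι) : Prop :=
  ∀ B ⊆ J, B.Nonempty → B ≠ J → ∃ i ∈ B, ∃ j ∈ J \ B, r i j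

theorem CutConnected.singleton {ι : Type*} [DecidableEq ι] (r : ι → ι → Prop) (i : ι) :
    CutConnected r {i} := by
  intro B hB hne hB'
  rcases Finset.subset_singleton_iff.1 hB with h | h
  · simp [h] at hne
  · exact absurd h hB'

theorem CutConnected.mono {ι : Type*} [DecidableEq ι] {r r' : ι → ι → Prop} {J : Finset ι}
    (h : CutConnected r J) (hr : ∀ i j, r i j → r' i j) : CutConnected r' J := by
  intro B hB hne hB'
  obtain ⟨i, hi, j, hj, hij⟩ := h B hB hne hB'
  exact ⟨i, hi, j, hj, hr _ _ hij⟩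

theorem CutConnected.insert {ι : Type*} [DecidableEq ι] {r : ι → ι → Prop} (hr : ∀ ⦃x y⦄, r x y → r y x)
    {J : Finset ι} (h : CutConnected r J) {i j : ι} (hi : i ∈ J) (hij : r i j) :
    CutConnected r (insert j J) := by
  intro B hB hne hB'
  by_cases h1 : (B ∩ J).Nonempty
  · by_cases h2 : B ∩ J = J
    · have hJB : J ⊆ B := by rw [← h2]; exact Finset.inter_subset_left
      have hjB : j ∉ B := fun hj => hB' (Finset.Subset.antisymm hB (Finset.insert_subset hj hJB))
      exact ⟨i, hJB hi, j, by simp [hjB], hij⟩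
    · obtain ⟨a, ha, c, hc, hac⟩ := h (B ∩ J) Finset.inter_subset_right h1 h2
      simp only [Finset.mem_inter, Finset.mem_sdiff, not_and] at ha hc
      exact ⟨a, ha.1, c, by simp [hc.1]; exact fun hcB => hc.2 hcB hc.1, hac⟩
  · rw [Finset.not_nonempty_iff_eq_empty] at h1
    have hBj : ∀ x ∈ B, x = j := by
      intro x hx
      rcases Finset.mem_insert.1 (hB hx) with h | h
      · exact h
      · exact absurd (Finset.mem_inter.2 ⟨hx, h⟩) (by simp [h1])
    obtain ⟨x, hx⟩ := hne
    have hxj := hBj x hx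
    subst hxj
    have hiB : i ∉ B := fun hiB => absurd (Finset.mem_inter.2 ⟨hiB, hi⟩) (by simp [h1])
    exact ⟨x, hx, i, by simp [hi, hiB], hr hij⟩

/-- The union of a cut-connected family of cut-connected nonempty sets is cut-connected. -/
theorem CutConnected.biUnion {ι κ : Type*} [DecidableEq ι] [DecidableEq κ] {r : ι → ι → Prop}
    {s : κ → κ → Prop} {J : Finset ι} (hJ : CutConnected r J) {f : ι → Finset κ}
    (hf : ∀ i ∈ J, CutConnected s (f i))
    (hrs : ∀ i ∈ J, ∀ j ∈ J, r i j → ∃ x ∈ f i, ∃ y ∈ f j, s x y) :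
    CutConnected s (J.biUnion f) := by
  intro B hB hBne hB'
  by_cases h1 : ∃ i ∈ J, (B ∩ f i).Nonempty ∧ B ∩ f i ≠ f i
  · obtain ⟨i, hi, h2, h3⟩ := h1
    obtain ⟨x, hx, y, hy, hxy⟩ := hf i hi (B ∩ f i) Finset.inter_subset_right h2 h3
    simp only [Finset.mem_inter, Finset.mem_sdiff, not_and] at hx hy
    refine ⟨x, hx.1, y, ?_, hxy⟩
    simp only [Finset.mem_sdiff, Finset.mem_biUnion]
    exact ⟨⟨i, hi, hy.1⟩, fun hyB => hy.2 hyB hy.1⟩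
  · push Not at h1
    let J' := J.filter fun i => (B ∩ f i).Nonempty
    have hJ'B : ∀ i ∈ J', f i ⊆ B := by
      intro i hi
      have hi' := Finset.mem_filter.1 hi
      rw [← h1 i hi'.1 hi'.2]
      exact Finset.inter_subset_left
    have hJ'ne : J'.Nonempty := by
      obtain ⟨x, hx⟩ := hBne
      obtain ⟨i, hi, hxi⟩ := Finset.mem_biUnion.1 (hB hx)
      exact ⟨i, Finset.mem_filter.2 ⟨hi, x, Finset.mem_inter.2 ⟨hx, hxi⟩⟩⟩
    have hJ'J : J' ≠ J := by
      intro h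
      apply hB'
      refine Finset.Subset.antisymm hB (Finset.biUnion_subset.2 fun i hi => hJ'B i (h ▸ hi))
    obtain ⟨i, hi, j, hj, hij⟩ := hJ J' (Finset.filter_subset _ _) hJ'ne hJ'J
    rw [Finset.mem_sdiff] at hj
    obtain ⟨x, hx, y, hy, hxy⟩ := hrs i (Finset.mem_filter.1 hi).1 j hj.1 hij
    refine ⟨x, hJ'B i hi hx, y, ?_, hxy⟩
    simp only [Finset.mem_sdiff, Finset.mem_biUnion]
    exact ⟨⟨j, hj.1, hy⟩, fun hyB => hj.2 (Finset.mem_filter.2 ⟨hj.1, y, Finset.mem_inter.2 ⟨hyB, hy⟩⟩)⟩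

/-- A cut-connected set with at least two elements has a dominating subset of at most half its
size. -/
theorem CutConnected.exists_dominating {ι : Type*} [DecidableEq ι] {r : ι → ι → Prop}
    (hr : ∀ ⦃x y⦄, r x y → r y x) {J : Finset ι} (h : CutConnected r J) (hJ : 2 ≤ J.card) :
    ∃ D ⊆ J, 2 * D.card ≤ J.card ∧ ∀ x ∈ J, x ∈ D ∨ ∃ y ∈ D, r x y := by
  classical
  have hnbr : ∀ x ∈ J, ∃ y ∈ J, y ≠ x ∧ r x y := by
    intro x hx
    obtain ⟨i, hi, j, hj, hij⟩ := h {x} (by simpa using hx) (by simp)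
      (fun hxJ => by rw [← hxJ] at hJ; simp at hJ)
    simp only [Finset.mem_singleton, Finset.mem_sdiff] at hi hj
    exact ⟨j, hj.1, hj.2, hi ▸ hij⟩
  let dom : Finset ι → Prop := fun D => ∀ x ∈ J, x ∈ D ∨ ∃ y ∈ D, r x y
  -- A dominating set `D` of least size has a dominating complement: if some `x ∈ D` had all its
  -- neighbours in `D`, then `D.erase x` would still dominate. Hence `D` is no larger than `J \ D`.
  obtain ⟨D, hD, hmin⟩ := Finset.exists_min_image (J.powerset.filter dom) Finset.card
    ⟨J, by simp [dom]; exact fun x hx => Or.inl hx⟩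
  simp only [Finset.mem_filter, Finset.mem_powerset] at hD hmin
  have hcomp : dom (J \ D) := by
    intro x hx
    by_cases hxD : x ∈ D
    · right
      by_contra hcon
      push Not at hcon
      have hnb : ∀ y ∈ J, r x y → y ∈ D := fun y hy hxy => by
        by_contra hyD
        exact hcon y (Finset.mem_sdiff.2 ⟨hy, hyD⟩) hxy
      have hdom : dom (D.erase x) := by
        intro z hz
        by_cases hzx : z = x
        · subst hzx
          obtain ⟨y, hy, hyz, hry⟩ := hnbr z hz
          exact Or.inr ⟨y, Finset.mem_erase.2 ⟨hyz, hnb y hy hry⟩, hry⟩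
        · rcases hD.2 z hz with h1 | ⟨y, hy, hzy⟩
          · exact Or.inl (Finset.mem_erase.2 ⟨hzx, h1⟩)
          · by_cases hyx : y = x
            · subst hyx
              exact Or.inl (Finset.mem_erase.2 ⟨hzx, hnb z hz (hr hzy)⟩)
            · exact Or.inr ⟨y, Finset.mem_erase.2 ⟨hyx, hy⟩, hzy⟩
      have := hmin (D.erase x) ⟨(Finset.erase_subset _ _).trans hD.1, hdom⟩
      have h2 := Finset.card_erase_lt_of_mem hxD
      omega
    · exact Or.inl (Finset.mem_sdiff.2 ⟨hx, hxD⟩)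
  have hc := Finset.card_sdiff_add_card_eq_card hD.1
  exact ⟨D, hD.1, by have := hmin (J \ D) ⟨Finset.sdiff_subset, hcomp⟩; omega, hD.2⟩

/-! ### Products of cosine factors -/

/-- The trigonometric polynomial `1 + K cos ρ`. -/
noncomputable def cosFactor {Γ : Type*} [AddCommGroup Γ] (K : ℝ) (ρ : Γ) : AddMonoidAlgebra ℝ Γ :=
  1 + AddMonoidAlgebra.single ρ (K / 2) + AddMonoidAlgebra.single (-ρ) (K / 2)

/-- Since cos ρ cos ρ' is the mean of cos(ρ + ρ') and cos(ρ - ρ'), the product can be arranged as an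
average of four factors of the same shape: keep one factor, keep the other, or merge them with
either sign. The price is the constants 4 and 2 in the activities. -/
theorem cosFactor_mul_cosFactor {Γ : Type*} [AddCommGroup Γ] (K K' : ℝ) (ρ ρ' : Γ) :
    cosFactor K ρ * cosFactor K' ρ' = (1 / 4 : ℝ) • cosFactor (4 * K) ρ +
      (1 / 4 : ℝ) • cosFactor (4 * K') ρ' + (1 / 4 : ℝ) • cosFactor (2 * K * K') (ρ + ρ') +
      (1 / 4 : ℝ) • cosFactor (2 * K * K') (ρ - ρ') := by
  have h1 : (1 : AddMonoidAlgebra ℝ Γ) = AddMonoidAlgebra.single 0 1 := rfl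
  have key : ∀ (g : Γ) (a : ℝ), AddMonoidAlgebra.single g a =
      a • (AddMonoidAlgebra.single g 1 : AddMonoidAlgebra ℝ Γ) := fun g a => by simp
  simp only [cosFactor, h1, mul_add, add_mul, AddMonoidAlgebra.single_mul_single, zero_add, add_zero,
    smul_add, AddMonoidAlgebra.smul_single]
  rw [show ρ - ρ' = ρ + -ρ' by abel, show -(ρ + ρ') = -ρ + -ρ' by abel,
    show -(ρ + -ρ') = -ρ + ρ' by abel]
  simp only [key _ (_ * _), key _ (_ • _)]
  simp only [smul_eq_mul]
  module

/-- A family of clusters formed from a finite family of charge densities: each cluster is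
cut-connected, distinct clusters are not related, the density of a cluster is a signed sum. -/
structure IsClustering {ι Γ : Type*} [DecidableEq ι] [AddCommGroup Γ] (A : Finset ι)
    (r : ι → ι → Prop) [DecidableRel r] (ρ : ι → Γ) (K : ι → ℝ) (T : Finset ι) (I : ι → Finset ι)
    (ρ' : ι → Γ) (K' : ι → ℝ) : Prop where
  mem : ∀ t ∈ T, t ∈ I t
  subset : ∀ t ∈ T, I t ⊆ A
  conn : ∀ t ∈ T, CutConnected r (I t)
  sign : ∀ t ∈ T, ∃ ε : ι → ℤ, (∀ i, ε i = 1 ∨ ε i = -1) ∧ ρ' t = ∑ i ∈ I t, ε i • ρ i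
  bound : ∀ t ∈ T, |K' t| ≤ ∏ i ∈ I t, (|K i| * 4 ^ (1 + (A.filter (r i)).card))
  sep : ∀ t ∈ T, ∀ t' ∈ T, t ≠ t' → ∀ i ∈ I t, ∀ j ∈ I t', i ≠ j ∧ ¬ r i j

/-- The products of cosine factors of clusterings. -/
def clusterProducts {ι Γ : Type*} [DecidableEq ι] [AddCommGroup Γ] (A : Finset ι)
    (r : ι → ι → Prop) [DecidableRel r] (ρ : ι → Γ) (K : ι → ℝ) : Set (AddMonoidAlgebra ℝ Γ) :=
  {F | ∃ T I ρ' K', IsClustering A r ρ K T I ρ' K' ∧ F = ∏ t ∈ T, cosFactor (K' t) (ρ' t)}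

/-- A cluster is indexed by one of its own elements, so a set unrelated to and disjoint from the
earlier clusters automatically has a fresh index. -/
theorem IsClustering.insert {ι Γ : Type*} [DecidableEq ι] [AddCommGroup Γ] {A : Finset ι}
    {r : ι → ι → Prop} [DecidableRel r] (hr : ∀ ⦃x y⦄, r x y → r y x) {ρ : ι → Γ} {K : ι → ℝ} {T : Finset ι}
    {I : ι → Finset ι} {ρ' : ι → Γ} {K' : ι → ℝ} (h : IsClustering A r ρ K T I ρ' K')
    {J : Finset ι} {c : ι} (hc : c ∈ J) (hJA : J ⊆ A) (hconn : CutConnected r J) {ρc : Γ} {Kc : ℝ}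
    {ε : ι → ℤ} (hε : ∀ i, ε i = 1 ∨ ε i = -1) (hρc : ρc = ∑ i ∈ J, ε i • ρ i)
    (hKc : |Kc| ≤ ∏ i ∈ J, (|K i| * 4 ^ (1 + (A.filter (r i)).card)))
    (hsep : ∀ t ∈ T, ∀ i ∈ I t, ∀ j ∈ J, i ≠ j ∧ ¬ r i j) :
    c ∉ T ∧ IsClustering A r ρ K (insert c T) (Function.update I c J) (Function.update ρ' c ρc)
      (Function.update K' c Kc) := by
  have hcT : c ∉ T := fun hcT => (hsep c hcT c (h.mem c hcT) c hc).1 rfl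
  have hne : ∀ t ∈ T, t ≠ c := fun t ht hh => hcT (hh ▸ ht)
  refine ⟨hcT, ⟨?_, ?_, ?_, ?_, ?_, ?_⟩⟩
  · intro t ht
    rcases Finset.mem_insert.1 ht with rfl | ht
    · simpa using hc
    · simpa [hne t ht] using h.mem t ht
  · intro t ht
    rcases Finset.mem_insert.1 ht with rfl | ht
    · simpa using hJA
    · simpa [hne t ht] using h.subset t ht
  · intro t ht
    rcases Finset.mem_insert.1 ht with rfl | ht
    · simpa using hconn
    · simpa [hne t ht] using h.conn t ht
  · intro t ht
    rcases Finset.mem_insert.1 ht with rfl | ht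
    · exact ⟨ε, hε, by simpa using hρc⟩
    · simpa [hne t ht] using h.sign t ht
  · intro t ht
    rcases Finset.mem_insert.1 ht with rfl | ht
    · simpa using hKc
    · simpa [hne t ht] using h.bound t ht
  · intro t ht t' ht' htt'
    rcases Finset.mem_insert.1 ht with h1 | h1
    · rcases Finset.mem_insert.1 ht' with h2 | h2
      · exact absurd (h1.trans h2.symm) htt'
      · intro i hi i' hi'
        rw [h1, Function.update_self] at hi
        rw [Function.update_of_ne (hne t' h2)] at hi'
        have := hsep t' h2 i' hi' i hi
        exact ⟨this.1.symm, fun hh => this.2 (hr hh)⟩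
    · rcases Finset.mem_insert.1 ht' with h2 | h2
      · intro i hi i' hi'
        rw [h2, Function.update_self] at hi'
        rw [Function.update_of_ne (hne t h1)] at hi
        exact hsep t h1 i hi i' hi'
      · simpa only [Function.update_of_ne (hne t h1), Function.update_of_ne (hne t' h2)] using
          h.sep t h1 t' h2 htt'

/-- Clusters are grown one at a time. `T` holds the finished clusters, `J` is the growing one, `R`
the factors not yet treated, and `D` the elements near `J` whose factors were given up at the price
of a 4. As long as some `j ∈ R` is related to `J`, the product identity is applied to the two
factors; otherwise `J` is finished. Every element of `D` is related to one of `J`, so `D.card` is at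
most the sum of the degrees in `J`, which yields the bound required of a clustering. -/
theorem cosFactor_mul_prod_mem_convexHull {ι Γ : Type*} [DecidableEq ι] [AddCommGroup Γ]
    {A : Finset ι} {r : ι → ι → Prop} [DecidableRel r] (hr : ∀ ⦃x y⦄, r x y → r y x) {ρ : ι → Γ} {K : ι → ℝ}
    (n : ℕ) : ∀ R : Finset ι, R.card = n → R ⊆ A →
    ∀ (T : Finset ι) (I : ι → Finset ι) (ρ' : ι → Γ) (K' : ι → ℝ),
    IsClustering A r ρ K T I ρ' K' → (∀ t ∈ T, ∀ i ∈ I t, ∀ j ∈ R, i ≠ j ∧ ¬ r i j) →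
    ∀ (J D : Finset ι) (c : ι) (ρc : Γ) (Kc : ℝ) (ε : ι → ℤ), c ∈ J → J ⊆ A → CutConnected r J →
    (∀ i, ε i = 1 ∨ ε i = -1) → ρc = ∑ i ∈ J, ε i • ρ i → Disjoint J R → D ⊆ A → Disjoint D R →
    (∀ j ∈ D, ∃ i ∈ J, r i j) → |Kc| ≤ (∏ i ∈ J, |K i|) * 4 ^ (J.card + D.card) →
    (∀ t ∈ T, ∀ i ∈ I t, ∀ j ∈ J, i ≠ j ∧ ¬ r i j) →
    cosFactor Kc ρc * ((∏ t ∈ T, cosFactor (K' t) (ρ' t)) * ∏ i ∈ R, cosFactor (K i) (ρ i)) ∈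
      convexHull ℝ (clusterProducts A r ρ K) := by
  induction n with
  | zero | succ n ih => ?_
  all_goals
    intro R hRn hRA T I ρ' K' hcl hTR J D c ρc Kc ε hcJ hJA hJc hε hρc hJR hDA hDR hDJ hKc hTJ
    have hfin : |Kc| ≤ ∏ i ∈ J, (|K i| * 4 ^ (1 + (A.filter (r i)).card)) := by
      refine hKc.trans ?_
      rw [Finset.prod_mul_distrib, Finset.prod_pow_eq_pow_sum]
      refine mul_le_mul_of_nonneg_left (pow_le_pow_right₀ (by norm_num) ?_)
        (Finset.prod_nonneg fun _ _ => abs_nonneg _)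
      rw [Finset.sum_add_distrib, Finset.sum_const, smul_eq_mul, mul_one]
      refine Nat.add_le_add_left ?_ _
      refine (Finset.card_le_card (t := J.biUnion fun i => A.filter (r i)) ?_).trans
        Finset.card_biUnion_le
      intro j hj
      obtain ⟨i, hi, hij⟩ := hDJ j hj
      exact Finset.mem_biUnion.2 ⟨i, hi, Finset.mem_filter.2 ⟨hDA hj, hij⟩⟩
    obtain ⟨hcT, hcl'⟩ := hcl.insert hr hcJ hJA hJc hε hρc hfin hTJ
    have hprod : cosFactor Kc ρc * ∏ t ∈ T, cosFactor (K' t) (ρ' t) =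
        ∏ t ∈ insert c T, cosFactor (Function.update K' c Kc t) (Function.update ρ' c ρc t) := by
      rw [Finset.prod_insert hcT]
      simp only [Function.update_self]
      congr 1
      refine Finset.prod_congr rfl fun t ht => ?_
      have : t ≠ c := fun hh => hcT (hh ▸ ht)
      simp [this]
  · have hR0 : R = ∅ := Finset.card_eq_zero.1 hRn
    subst hR0
    rw [Finset.prod_empty, mul_one, hprod]
    exact subset_convexHull ℝ _ ⟨_, _, _, _, hcl', rfl⟩
  · by_cases hex : ∃ i ∈ J, ∃ j ∈ R, r i j
    · obtain ⟨i, hi, j, hj, hij⟩ := hex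
      have hjJ : j ∉ J := fun h => Finset.disjoint_left.1 hJR h hj
      have hjD : j ∉ D := fun h => Finset.disjoint_left.1 hDR h hj
      have hR' : (R.erase j).card = n := by rw [Finset.card_erase_of_mem hj, hRn]; rfl
      have hR'A : R.erase j ⊆ A := (Finset.erase_subset _ _).trans hRA
      have hTR' : ∀ t ∈ T, ∀ i ∈ I t, ∀ j' ∈ R.erase j, i ≠ j' ∧ ¬ r i j' :=
        fun t ht i hi j' hj' => hTR t ht i hi j' (Finset.mem_of_mem_erase hj')
      have hJR' : Disjoint J (R.erase j) := hJR.mono_right (Finset.erase_subset _ _)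
      have hDR' : Disjoint D (R.erase j) := hDR.mono_right (Finset.erase_subset _ _)
      have hsplit : cosFactor Kc ρc * ((∏ t ∈ T, cosFactor (K' t) (ρ' t)) *
          ∏ i ∈ R, cosFactor (K i) (ρ i)) = (cosFactor Kc ρc * cosFactor (K j) (ρ j)) *
          ((∏ t ∈ T, cosFactor (K' t) (ρ' t)) * ∏ i ∈ R.erase j, cosFactor (K i) (ρ i)) := by
        rw [← Finset.mul_prod_erase R _ hj]; ring
      rw [hsplit, cosFactor_mul_cosFactor]
      simp only [add_mul, smul_mul_assoc]
      have hKJ : ∏ i ∈ insert j J, |K i| = |K j| * ∏ i ∈ J, |K i| := Finset.prod_insert hjJ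
      -- Merging costs a factor 2, covered by the 4 that the new member of `J` brings.
      have hmerge : ∀ s : ℤ, s = 1 ∨ s = -1 → cosFactor (2 * Kc * K j) (ρc + s • ρ j) *
          ((∏ t ∈ T, cosFactor (K' t) (ρ' t)) * ∏ i ∈ R.erase j, cosFactor (K i) (ρ i)) ∈
          convexHull ℝ (clusterProducts A r ρ K) := by
        intro s hs
        refine ih (R.erase j) hR' hR'A T I ρ' K' hcl hTR' (insert j J) D c _ _
          (Function.update ε j s) (Finset.mem_insert_of_mem hcJ)
          (Finset.insert_subset (hRA hj) hJA) (hJc.insert hr hi hij) ?_ ?_ ?_ hDA hDR' ?_ ?_ ?_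
        · intro i'
          by_cases h : i' = j
          · subst h; simpa using hs
          · simpa [h] using hε i'
        · rw [Finset.sum_insert hjJ, hρc, add_comm]
          simp only [Function.update_self]
          congr 1
          refine Finset.sum_congr rfl fun i' hi' => ?_
          have : i' ≠ j := fun hh => hjJ (hh ▸ hi')
          simp [this]
        · rw [Finset.disjoint_insert_left]; exact ⟨by simp, hJR'⟩
        · intro j' hj'
          obtain ⟨i', hi', h'⟩ := hDJ j' hj'
          exact ⟨i', Finset.mem_insert_of_mem hi', h'⟩
        · rw [hKJ, Finset.card_insert_of_notMem hjJ, abs_mul, abs_mul, abs_two]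
          have h4 : (4 : ℝ) ^ (J.card + 1 + D.card) = 4 * 4 ^ (J.card + D.card) := by ring
          rw [h4]
          have hpos : 0 ≤ (∏ i ∈ J, |K i|) * (4 : ℝ) ^ (J.card + D.card) :=
            mul_nonneg (Finset.prod_nonneg fun _ _ => abs_nonneg _) (by positivity)
          nlinarith [mul_le_mul_of_nonneg_right hKc (abs_nonneg (K j)),
            mul_nonneg hpos (abs_nonneg (K j))]
        · intro t ht i' hi' j' hj'
          rcases Finset.mem_insert.1 hj' with rfl | hj'
          · exact hTR t ht i' hi' _ hj
          · exact hTJ t ht i' hi' j' hj'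
      -- The factor of `j` is given up and `j` is recorded in `D`, which pays for the 4.
      have e1 : cosFactor (4 * Kc) ρc * ((∏ t ∈ T, cosFactor (K' t) (ρ' t)) *
          ∏ i ∈ R.erase j, cosFactor (K i) (ρ i)) ∈ convexHull ℝ (clusterProducts A r ρ K) := by
        refine ih (R.erase j) hR' hR'A T I ρ' K' hcl hTR' J (insert j D) c _ _ ε hcJ hJA hJc hε hρc
          hJR' (Finset.insert_subset (hRA hj) hDA) ?_ ?_ ?_ hTJ
        · rw [Finset.disjoint_insert_left]; exact ⟨by simp, hDR'⟩
        · intro j' hj'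
          rcases Finset.mem_insert.1 hj' with rfl | hj'
          · exact ⟨i, hi, hij⟩
          · exact hDJ j' hj'
        · rw [Finset.card_insert_of_notMem hjD, abs_mul, ← add_assoc, pow_succ]
          have : |(4 : ℝ)| = 4 := by norm_num
          rw [this]; linarith
      -- The whole growing cluster is given up and growth restarts from `j`. Recording the single
      -- neighbour `i` pays for the 4.
      have e2 : cosFactor (4 * K j) (ρ j) * ((∏ t ∈ T, cosFactor (K' t) (ρ' t)) *
          ∏ i ∈ R.erase j, cosFactor (K i) (ρ i)) ∈ convexHull ℝ (clusterProducts A r ρ K) := by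
        refine ih (R.erase j) hR' hR'A T I ρ' K' hcl hTR' {j} {i} j _ _ (fun _ => 1)
          (by simp) (by simpa using hRA hj) (CutConnected.singleton r j) (fun _ => Or.inl rfl)
          (by simp) (by simp) (by simpa using hJA hi) ?_ ?_ ?_ ?_
        · rw [Finset.disjoint_singleton_left]
          exact fun h => Finset.disjoint_left.1 hJR' hi h
        · intro j' hj'
          rw [Finset.mem_singleton] at hj'
          subst hj'
          exact ⟨j, by simp, hr hij⟩
        · simp only [Finset.prod_singleton, Finset.card_singleton, abs_mul]
          have : |(4 : ℝ)| = 4 := by norm_num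
          rw [this]; norm_num; linarith [abs_nonneg (K j)]
        · intro t ht i' hi' j' hj'
          rw [Finset.mem_singleton] at hj'
          subst hj'
          exact hTR t ht i' hi' _ hj
      have e3 := hmerge 1 (Or.inl rfl)
      have e4 := hmerge (-1) (Or.inr rfl)
      rw [one_smul] at e3
      rw [neg_one_smul, ← sub_eq_add_neg] at e4
      have hconv := convex_convexHull ℝ (clusterProducts A r ρ K)
      have m1 := hconv e1 e2 (a := 1 / 2) (b := 1 / 2) (by norm_num) (by norm_num) (by norm_num)
      have m2 := hconv e3 e4 (a := 1 / 2) (b := 1 / 2) (by norm_num) (by norm_num) (by norm_num)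
      have m3 := hconv m1 m2 (a := 1 / 2) (b := 1 / 2) (by norm_num) (by norm_num) (by norm_num)
      convert m3 using 1
      module
    · push Not at hex
      obtain ⟨j, hj⟩ : R.Nonempty := Finset.card_pos.1 (by omega)
      have hR' : (R.erase j).card = n := by rw [Finset.card_erase_of_mem hj, hRn]; rfl
      have hR'A : R.erase j ⊆ A := (Finset.erase_subset _ _).trans hRA
      have hnew : ∀ t ∈ insert c T, ∀ i ∈ Function.update I c J t, ∀ j ∈ R, i ≠ j ∧ ¬ r i j := by
        intro t ht i hi j' hj'
        by_cases htc : t = c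
        · subst htc
          simp only [Function.update_self] at hi
          exact ⟨fun hh => Finset.disjoint_left.1 hJR hi (hh ▸ hj'), hex i hi j' hj'⟩
        · simp only [Function.update_of_ne htc] at hi
          exact hTR t ((Finset.mem_insert.1 ht).resolve_left htc) i hi j' hj'
      have := ih (R.erase j) hR' hR'A _ _ _ _ hcl'
        (fun t ht i hi j' hj' => hnew t ht i hi j' (Finset.mem_of_mem_erase hj')) {j} ∅ j (ρ j) (K j)
        (fun _ => 1) (by simp) (by simpa using hRA hj) (CutConnected.singleton r j)
        (fun _ => Or.inl rfl) (by simp) (by simp) (by simp) (by simp) (by simp)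
        (by simp only [Finset.prod_singleton, Finset.card_singleton, Finset.card_empty]
            norm_num; linarith [abs_nonneg (K j)])
        (fun t ht i hi j' hj' => by
          rw [Finset.mem_singleton] at hj'
          subst hj'
          exact hnew t ht i hi _ hj)
      convert this using 1
      rw [← hprod, ← Finset.mul_prod_erase R _ hj]
      ring

/-- A product of cosine factors is a convex combination of products over clusterings. -/
theorem prod_cosFactor_mem_convexHull {ι Γ : Type*} [DecidableEq ι] [AddCommGroup Γ]
    (A : Finset ι) {r : ι → ι → Prop} [DecidableRel r] (hr : ∀ ⦃x y⦄, r x y → r y x) (ρ : ι → Γ) (K : ι → ℝ) :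
    ∏ i ∈ A, cosFactor (K i) (ρ i) ∈ convexHull ℝ (clusterProducts A r ρ K) := by
  have hempty : IsClustering A r ρ K ∅ (fun _ => ∅) ρ K :=
    ⟨by simp, by simp, by simp, by simp, by simp, by simp⟩
  rcases A.eq_empty_or_nonempty with h | ⟨j, hj⟩
  · refine subset_convexHull ℝ _ ⟨∅, fun _ => ∅, ρ, K, hempty, ?_⟩
    rw [h]
  · have := cosFactor_mul_prod_mem_convexHull hr (A.erase j).card (A.erase j) rfl
      (Finset.erase_subset _ _) ∅ (fun _ => ∅) ρ K hempty (by simp) {j} ∅ j (ρ j) (K j)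
      (fun _ => 1) (by simp) (by simpa using hj) (CutConnected.singleton r j)
      (fun _ => Or.inl rfl) (by simp) (by simp) (by simp) (by simp) (by simp)
      (by simp only [Finset.prod_singleton, Finset.card_singleton, Finset.card_empty]
          norm_num; linarith [abs_nonneg (K j)]) (by simp)
    rw [Finset.prod_empty, one_mul,
      Finset.mul_prod_erase A (fun i => cosFactor (K i) (ρ i)) hj] at this
    exact this

/-! ### Scales -/

/-- The length scales `128 ^ k`. -/
def scale (k : ℕ) : ℕ := 128 ^ k

/-- The scale at which a neutral cluster born at scale `j` is frozen. -/
def freezeTime (j : ℕ) : ℕ := j + j / 2 + 2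

theorem scale_pos (k : ℕ) : 0 < scale k := Nat.pow_pos (by norm_num)

theorem scale_succ (k : ℕ) : scale (k + 1) = 128 * scale k := by
  simp [scale, pow_succ, mul_comm]

theorem scale_mono {j k : ℕ} (h : j ≤ k) : scale j ≤ scale k :=
  Nat.pow_le_pow_right (by norm_num) h

/-- Balls frozen with birth scale `j` are separated by far more than their size, with a ratio
growing like 2^j. Making them flat then distorts distances by a relative amount of order 2^(-j),
which is summable over scales. -/
theorem scale_freezeTime_le (j : ℕ) : 2 ^ (j + 10) * scale j ≤ scale (freezeTime j) := by
  have h : freezeTime j = j + (j / 2 + 2) := by unfold freezeTime; omega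
  rw [h, scale, scale, pow_add 128 j, mul_comm]
  refine Nat.mul_le_mul_left _ ?_
  rw [show (128 : ℕ) = 2 ^ 7 by norm_num, ← pow_mul]
  exact Nat.pow_le_pow_right (by norm_num) (by omega)

/-! ### Flattened metrics -/

/-- A pseudometric dominated by the graph distance of `G`. -/
structure IsSubmetric {V : Type*} (G : SimpleGraph V) (D : V → V → ℝ) : Prop where
  self : ∀ x, D x x = 0
  symm : ∀ x y, D x y = D y x
  triangle : ∀ x y z, D x z ≤ D x y + D y z
  le_dist : ∀ x y, D x y ≤ G.dist x y

theorem IsSubmetric.nonneg {V : Type*} {G : SimpleGraph V} {D : V → V → ℝ} (h : IsSubmetric G D)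
    (x y : V) : 0 ≤ D x y := by
  have h1 := h.triangle x y x
  rw [h.self, h.symm y x] at h1
  linarith

/-- A submetric can be made constant on well separated balls of equal radii at a small cost. -/
theorem IsSubmetric.exists_flatten {V ι : Type*} [Fintype V] {G : SimpleGraph V} {D : V → V → ℝ}
    (hD : IsSubmetric G D) (F : Finset ι) (c : ι → V) {r δ : ℝ} (hδ : 0 ≤ δ) (hr : 0 ≤ r)
    (hsep : ∀ i ∈ F, ∀ i' ∈ F, i ≠ i' → 2 * r * (1 + δ) ≤ δ * D (c i) (c i')) :
    ∃ D' : V → V → ℝ, IsSubmetric G D' ∧ (∀ x y, D' x y ≤ D x y) ∧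
      (∀ i ∈ F, ∀ x y, (G.dist (c i) x : ℝ) ≤ r → (G.dist (c i) y : ℝ) ≤ r → D' x y = 0) ∧
      ∀ x y, (D x y - 2 * r) / (1 + δ) ≤ D' x y := by
  classical
  let O : Finset (Option ι) := F.insertNone
  -- Besides the distance from `z`, each ball offers a cone that is flat on the ball at height `D z
  -- (c i) - r` and rises outside with slope `1 + δ`. The separation hypothesis is exactly what
  -- prevents the cone of another ball from being lower there, so that the infimum `f z` is constant
  -- on every ball.
  let g : V → Option ι → V → ℝ := fun z o y => o.elim (D z y)
    fun i => D z (c i) - r + (1 + δ) * max (D (c i) y - r) 0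
  have hO : O.Nonempty := ⟨none, by simp [O]⟩
  let f : V → V → ℝ := fun z y => O.inf' hO fun o => g z o y
  have hDlip : ∀ z x y, D z x ≤ D z y + D x y := fun z x y => by
    have := hD.triangle z y x; rw [hD.symm y x] at this; exact this
  have hg : ∀ z o x y, g z o x ≤ g z o y + (1 + δ) * D x y := by
    intro z o x y
    have h0 := hD.nonneg x y
    cases o with
    | none =>
      simp only [g, Option.elim]
      nlinarith [hDlip z x y]
    | some i =>
      simp only [g, Option.elim]
      have : max (D (c i) x - r) 0 ≤ max (D (c i) y - r) 0 + D x y := by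
        refine max_le ?_ ?_
        · linarith [hDlip (c i) x y, le_max_left (D (c i) y - r) 0]
        · linarith [le_max_right (D (c i) y - r) 0]
      nlinarith
  have hf : ∀ z x y, f z x ≤ f z y + (1 + δ) * D x y := by
    intro z x y
    rw [← sub_le_iff_le_add]
    refine Finset.le_inf' _ _ fun o ho => ?_
    rw [sub_le_iff_le_add]
    exact (Finset.inf'_le _ ho).trans (hg z o x y)
  have hfabs : ∀ z x y, |f z x - f z y| ≤ (1 + δ) * D x y := by
    intro z x y
    rw [abs_sub_le_iff]
    have h1 := hf z x y
    have h2 := hf z y x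
    rw [hD.symm y x] at h2
    constructor <;> linarith
  have hball : ∀ i ∈ F, ∀ z y, (G.dist (c i) y : ℝ) ≤ r → f z y = D z (c i) - r := by
    intro i hi z y hy
    have hyD : D (c i) y ≤ r := (hD.le_dist _ _).trans hy
    apply le_antisymm
    · refine (Finset.inf'_le _ (show some i ∈ O by simp [O, hi])).trans ?_
      simp only [g, Option.elim]
      rw [max_eq_right (by linarith)]
      linarith
    · refine Finset.le_inf' _ _ fun o ho => ?_
      cases o with
      | none =>
        simp only [g, Option.elim]
        have := hD.triangle z y (c i)
        rw [hD.symm y] at this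
        linarith
      | some i' =>
        simp only [g, Option.elim]
        by_cases hii : i = i'
        · subst hii
          have : 0 ≤ (1 + δ) * max (D (c i) y - r) 0 :=
            mul_nonneg (by linarith) (le_max_right _ _)
          linarith
        · have hi' : i' ∈ F := by simpa [O] using ho
          have hs := hsep i hi i' hi' hii
          have t1 := hD.triangle z (c i') (c i)
          have t2 := hD.triangle (c i) y (c i')
          rw [hD.symm y (c i')] at t2
          rw [hD.symm (c i') (c i)] at t1
          have h1 : (1 + δ) * (D (c i') y - r) ≤ (1 + δ) * max (D (c i') y - r) 0 :=
            mul_le_mul_of_nonneg_left (le_max_left _ _) (by linarith)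
          have h2 : δ * D (c i) (c i') ≤ δ * (r + D (c i') y) :=
            mul_le_mul_of_nonneg_left (by linarith) hδ
          nlinarith
  have hV : ∀ x : V, (Finset.univ : Finset V).Nonempty := fun x => ⟨x, Finset.mem_univ x⟩
  -- The functions `f z` are `(1 + δ)`-Lipschitz and constant on the balls; the largest of their
  -- normalized increments is a pseudometric with both properties. The lower bound uses `z = x`.
  let D' : V → V → ℝ := fun x y => (Finset.univ : Finset V).sup' (hV x)
    fun z => |f z x - f z y| / (1 + δ)
  have hδ1 : 0 < 1 + δ := by linarith
  have hle : ∀ x y, D' x y ≤ D x y := fun x y =>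
    Finset.sup'_le _ _ fun z _ => by rw [div_le_iff₀ hδ1]; linarith [hfabs z x y]
  have hge : ∀ z x y, |f z x - f z y| / (1 + δ) ≤ D' x y := fun z x y =>
    Finset.le_sup' (fun z => |f z x - f z y| / (1 + δ)) (Finset.mem_univ z)
  refine ⟨D', ⟨fun x => ?_, fun x y => ?_, fun x y z => ?_, fun x y => (hle x y).trans
    (hD.le_dist x y)⟩, hle, fun i hi x y hx hy => ?_, fun x y => ?_⟩
  · simp [D']
  · simp only [D', abs_sub_comm]
  · refine Finset.sup'_le _ _ fun w _ => ?_
    refine le_trans ?_ (add_le_add (hge w x y) (hge w y z))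
    rw [← add_div]
    exact div_le_div_of_nonneg_right (abs_sub_le _ _ _) hδ1.le
  · simp [D', hball i hi _ x hx, hball i hi _ y hy]
  · refine le_trans (div_le_div_of_nonneg_right ?_ hδ1.le) (hge x x y)
    have h1 : f x x ≤ 0 := (Finset.inf'_le _ (show none ∈ O by simp [O])).trans
      (by simp [g, hD.self])
    have h2 : D x y - 2 * r ≤ f x y := by
      refine Finset.le_inf' _ _ fun o ho => ?_
      cases o with
      | none => simp only [g, Option.elim]; linarith
      | some i =>
        simp only [g, Option.elim]
        have := hD.triangle x (c i) y
        have h3 := le_max_left (D (c i) y - r) 0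
        have h4 := le_max_right (D (c i) y - r) 0
        nlinarith
    rw [abs_sub_comm]
    exact le_trans (by linarith) (le_abs_self _)

/-- There is a submetric vanishing on balls around centres which are well separated at each scale,
and comparable to the graph distance at large scales. -/
theorem exists_flat_submetric {V ι : Type*} [Fintype V] {G : SimpleGraph V} (hG : G.Connected)
    (F : Finset ι) (c : ι → V) (b : ι → ℕ)
    (hsep : ∀ i ∈ F, ∀ i' ∈ F, i ≠ i' → b i = b i' → scale (freezeTime (b i)) ≤ G.dist (c i) (c i'))
    (J : ℕ) :
    ∃ D : V → V → ℝ, IsSubmetric G D ∧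
      (∀ i ∈ F, b i < J → ∀ x y, G.dist (c i) x ≤ 3 * scale (b i) →
        G.dist (c i) y ≤ 3 * scale (b i) → D x y = 0) ∧
      ∀ x y, (G.dist x y : ℝ) - scale J / 2 ≤ (2 - (1 / 2) ^ J) * D x y := by
  classical
  induction J with
  | zero =>
    refine ⟨fun x y => G.dist x y, ⟨fun x => by simp, fun x y => by rw [G.dist_comm],
      fun x y z => by exact_mod_cast hG.dist_triangle, fun x y => le_rfl⟩, by simp, fun x y => ?_⟩
    simp only [scale]
    norm_num
  | succ J ih =>
    obtain ⟨D, hD, hflat, hlow⟩ := ih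
    set η : ℝ := (1 / 2) ^ J with hη
    have hη0 : 0 < η := by positivity
    have hη1 : η ≤ 1 := pow_le_one₀ (by norm_num) (by norm_num)
    have hℓ : (0 : ℝ) < scale J := by exact_mod_cast scale_pos J
    have hη2 : η * 2 ^ J = 1 := by rw [hη, ← mul_pow]; norm_num
    -- With `δ = η / 4` the multiplicative constant stays below 2, as (2 - η)(1 + η/4) ≤ 2 - η/2.
    -- The additive error, at most 12 + 1/2 times the current scale, fits into the 64 available at
    -- the next one.
    obtain ⟨D', hD', hle, hflat', hlow'⟩ := hD.exists_flatten (F.filter fun i => b i = J) c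
      (r := 3 * scale J) (δ := η / 4) (by positivity) (by positivity) (by
        intro i hi i' hi' hii
        rw [Finset.mem_filter] at hi hi'
        have h1 := hsep i hi.1 i' hi'.1 hii (hi.2.trans hi'.2.symm)
        rw [hi.2] at h1
        have h2 : (2 : ℝ) ^ (J + 10) * scale J ≤ G.dist (c i) (c i') := by
          exact_mod_cast (scale_freezeTime_le J).trans h1
        have h3 := hlow (c i) (c i')
        have h4 : (2 : ℝ) ^ (J + 10) * scale J - scale J / 2 ≤ 2 * D (c i) (c i') := by
          nlinarith [hD.nonneg (c i) (c i')]
        have h5 : η / 8 * ((2 : ℝ) ^ (J + 10) * scale J - scale J / 2) ≤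
            η / 8 * (2 * D (c i) (c i')) := mul_le_mul_of_nonneg_left h4 (by positivity)
        have h6 : η / 8 * ((2 : ℝ) ^ (J + 10) * scale J - scale J / 2) =
            (η * 2 ^ J) * 128 * scale J - η * scale J / 16 := by ring
        rw [h6, hη2] at h5
        nlinarith)
    refine ⟨D', hD', ?_, ?_⟩
    · intro i hi hiJ x y hx hy
      rcases Nat.lt_succ_iff_lt_or_eq.1 hiJ with h | h
      · have h0 := hflat i hi h x y hx hy
        exact le_antisymm (h0 ▸ hle x y) (hD'.nonneg x y)
      · rw [h] at hx hy
        exact hflat' i (Finset.mem_filter.2 ⟨hi, h⟩) x y (by exact_mod_cast hx)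
          (by exact_mod_cast hy)
    · intro x y
      have h1 := hlow' x y
      rw [div_le_iff₀ (by positivity)] at h1
      have h2 := hlow x y
      have h3 := hD'.nonneg x y
      rw [scale_succ, pow_succ, ← hη]
      push_cast
      have h4 : (2 - η) * (D x y - 2 * (3 * scale J)) ≤ (2 - η) * (D' x y * (1 + η / 4)) :=
        mul_le_mul_of_nonneg_left h1 (by linarith)
      have h5 : (2 - η) * (1 + η / 4) * D' x y ≤ (2 - η * (1 / 2)) * D' x y :=
        mul_le_mul_of_nonneg_right (by nlinarith) h3
      nlinarith

/-- A cutoff function at scale `t` which is constant on the balls of the frozen clusters. -/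
theorem exists_cutoff {V ι : Type*} [Fintype V] {G : SimpleGraph V} (hG : G.Connected)
    (F : Finset ι) (c : ι → V) (b : ι → ℕ)
    (hsep : ∀ i ∈ F, ∀ i' ∈ F, i ≠ i' → b i = b i' → scale (freezeTime (b i)) ≤ G.dist (c i) (c i'))
    (p : V) (t : ℕ) :
    ∃ a : V → ℝ, (∀ x, G.dist p x ≤ 3 * scale t → a x = 1) ∧
      (∀ x, 32 * scale t ≤ G.dist p x → a x = 0) ∧
      (∀ x y, G.Adj x y → |a x - a y| ≤ 1 / scale t) ∧
      ∀ i ∈ F, freezeTime (b i) ≤ t → ∀ x y, G.dist (c i) x ≤ 3 * scale (b i) →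
        G.dist (c i) y ≤ 3 * scale (b i) → a x = a y := by
  obtain ⟨D, hD, hflat, hlow⟩ := exists_flat_submetric hG F c b hsep t
  have hℓ : (0 : ℝ) < scale t := by exact_mod_cast scale_pos t
  -- A linear ramp in the flattened distance, from 1 at 3ℓ to 0 at 15ℓ. The flattening loses at most
  -- a factor 2 and ℓ/2, so graph distance 32ℓ forces flattened distance above 15ℓ.
  refine ⟨fun x => max 0 (min 1 ((15 * scale t - D p x) / (12 * scale t))), ?_, ?_, ?_, ?_⟩
  · intro x hx
    have h1 : D p x ≤ 3 * scale t := (hD.le_dist p x).trans (by exact_mod_cast hx)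
    have h2 : 1 ≤ (15 * scale t - D p x) / (12 * scale t) := by
      rw [le_div_iff₀ (by positivity)]; linarith
    simp [h2]
  · intro x hx
    have h1 : (32 : ℝ) * scale t ≤ G.dist p x := by exact_mod_cast hx
    have h2 := hlow p x
    have h4 : (0 : ℝ) < (1 / 2) ^ t := by positivity
    have h3 : (15 * scale t - D p x) / (12 * scale t) ≤ 0 := by
      refine div_nonpos_of_nonpos_of_nonneg ?_ (by positivity)
      nlinarith [hD.nonneg p x]
    exact max_eq_left ((min_le_right _ _).trans h3)
  · intro x y hxy
    have hd : (G.dist x y : ℝ) ≤ 1 := by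
      rw [SimpleGraph.dist_eq_one_iff_adj.2 hxy]; simp
    have h1 : |D p x - D p y| ≤ 1 := by
      rw [abs_sub_le_iff]
      have t1 := hD.triangle p y x
      have t2 := hD.triangle p x y
      rw [hD.symm y x] at t1
      have := hD.le_dist x y
      constructor <;> linarith
    refine (abs_max_sub_max_le_max _ _ _ _).trans (max_le (by simp) ?_)
    refine (abs_min_sub_min_le_max _ _ _ _).trans (max_le (by simp) ?_)
    rw [← sub_div, abs_div, abs_of_pos (by positivity : (0 : ℝ) < 12 * scale t)]
    rw [show (15 * (scale t : ℝ) - D p x - (15 * scale t - D p y)) = -(D p x - D p y) by ring,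
      abs_neg, div_le_div_iff₀ (by positivity) hℓ]
    nlinarith
  · intro i hi hit x y hx hy
    have hlt : b i < t := by unfold freezeTime at hit; omega
    have h0 := hflat i hi hlt x y hx hy
    have t1 := hD.triangle p y x
    have t2 := hD.triangle p x y
    rw [hD.symm y x] at t1
    have : D p x = D p y := by linarith
    simp only [this]

/-! ### Multiscale clusters -/

/-- A cluster of the multiscale analysis: its sites, charge density, activity, bumps (each a centre
and a scale), cover centres, main centre and birth scale. -/
structure Cluster (V : Type*) where
  sites : Finset V
  density : V → ℤ
  activity : ℝ
  bumps : Finset (V × ℕ)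
  cover : Finset V
  center : V
  birth : ℕ

/-- The effective size of a cluster. -/
noncomputable def Cluster.weight {V : Type*} [Fintype V] (γ : ℝ) (x : Cluster V) : ℝ :=
  |x.activity| * Real.exp (∑ y, |(x.density y : ℝ)| - γ * x.bumps.card)

theorem Cluster.weight_nonneg {V : Type*} [Fintype V] (γ : ℝ) (x : Cluster V) :
    0 ≤ x.weight γ := mul_nonneg (abs_nonneg _) (Real.exp_pos _).le

/-- The bumps of a cluster see a nonzero charge of this cluster. -/
structure HasBumps {V : Type*} [Fintype V] (G : SimpleGraph V) (x : Cluster V) : Prop where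
  supp : ∀ y, x.density y ≠ 0 → y ∈ x.sites
  mem : ∀ e ∈ x.bumps, e.1 ∈ x.sites
  iso : ∀ e ∈ x.bumps, ∀ y ∈ x.sites, G.dist e.1 y < 32 * scale e.2 → G.dist e.1 y ≤ 3 * scale e.2
  charge : ∀ e ∈ x.bumps, ∑ y with G.dist e.1 y ≤ 3 * scale e.2, x.density y ≠ 0

/-- The properties of a cluster still being merged at scale `k`. -/
structure IsActive {V : Type*} [Fintype V] [DecidableEq V] (G : SimpleGraph V) (γ s C : ℝ)
    (k k' : ℕ) (x : Cluster V) : Prop extends HasBumps G x where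
  cover_nonempty : x.cover.Nonempty
  cover_subset : x.cover ⊆ x.sites
  exists_cover : ∀ y ∈ x.sites, ∃ p ∈ x.cover, G.dist p y ≤ 2 * scale k
  conn : CutConnected (fun p q => G.dist p q ≤ 6 * scale k) x.cover
  bump_lt : ∀ e ∈ x.bumps, e.2 < k
  weight_large : 2 ≤ x.cover.card →
    x.weight γ ≤ Real.exp (-(1.9 * (s * (k + 100)) + 8 * s * (x.cover.card - 2)))
  cover_eq : x.cover.card = 1 → x.cover = {x.center}
  weight_charged : x.cover.card = 1 → ∑ y, x.density y ≠ 0 →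
    x.weight γ ≤ Real.exp (-(s * (k + 100)))
  neutral : x.cover.card = 1 → ∑ y, x.density y = 0 → x.birth ≤ k ∧ k' ≤ freezeTime x.birth ∧
    (∀ y ∈ x.sites, G.dist x.center y ≤ 2 * scale x.birth) ∧ (∀ e ∈ x.bumps, e.2 < x.birth) ∧
    x.weight γ ≤ Real.exp (-(1.8 * (s * (x.birth + 100)) - C * (k - x.birth)))

/-- The properties of a neutral cluster which is not merged any more. -/
structure IsFrozen {V : Type*} [Fintype V] (G : SimpleGraph V) (γ s : ℝ) (x : Cluster V) : Prop
    extends HasBumps G x where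
  center_mem : x.center ∈ x.sites
  neutral : ∑ y, x.density y = 0
  dist_le : ∀ y ∈ x.sites, G.dist x.center y ≤ 2 * scale x.birth
  bump_lt : ∀ e ∈ x.bumps, e.2 < x.birth
  weight_le : x.weight γ ≤ Real.exp (-(s * (x.birth + 100)))

/-- The cutoff functions of two bumps have disjoint gradients, given the frozen clusters. -/
def BumpSep {V : Type*} (G : SimpleGraph V) (fz : Finset V) (it : V → Cluster V) (e e' : V × ℕ) :
    Prop :=
  32 * scale e.2 + 32 * scale e'.2 < G.dist e.1 e'.1 ∨
  (∀ y, G.dist e.1 y ≤ 32 * scale e.2 → G.dist e'.1 y ≤ 3 * scale e'.2) ∨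
  ∃ f ∈ fz, freezeTime (it f).birth ≤ e'.2 ∧
    ∀ y, G.dist e.1 y ≤ 32 * scale e.2 → G.dist (it f).center y ≤ 3 * scale (it f).birth

/-- The relations between the clusters of a multiscale state and its frozen clusters. -/
structure IsNetwork {V : Type*} [Fintype V] [DecidableEq V] (G : SimpleGraph V) (γ s : ℝ)
    (N fz : Finset V) (it : V → Cluster V) : Prop where
  subset : fz ⊆ N
  frozen : ∀ i ∈ fz, IsFrozen G γ s (it i)
  disj : ∀ i ∈ N, ∀ i' ∈ N, i ≠ i' → Disjoint (it i).sites (it i').sites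
  frozen_sep : ∀ i ∈ fz, ∀ i' ∈ fz, i ≠ i' → (it i).birth = (it i').birth →
    scale (freezeTime (it i).birth) ≤ G.dist (it i).center (it i').center
  bump_other : ∀ i ∈ N, ∀ e ∈ (it i).bumps, ∀ i' ∈ N, i' ≠ i →
    (i' ∈ fz ∧ freezeTime (it i').birth ≤ e.2) ∨ ∀ y ∈ (it i').sites, 32 * scale e.2 ≤ G.dist e.1 y
  bump_sep : ∀ i ∈ N, ∀ i' ∈ N, ∀ e ∈ (it i).bumps, ∀ d ∈ (it i').bumps, e ≠ d →
    BumpSep G fz it e d ∨ BumpSep G fz it d e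

/-- A state of the multiscale analysis at scale `k`, where clusters have been frozen up to `k'`. -/
structure IsState {V : Type*} [Fintype V] [DecidableEq V] (G : SimpleGraph V) (γ s C : ℝ)
    (k k' : ℕ) (ac fz : Finset V) (it : V → Cluster V) : Prop
    extends IsNetwork G γ s (ac ∪ fz) fz it where
  disj_idx : Disjoint ac fz
  active : ∀ i ∈ ac, IsActive G γ s C k k' (it i)
  frozen_lt : ∀ i ∈ fz, freezeTime (it i).birth < k'
  sep : ∀ i ∈ ac, ∀ i' ∈ ac, i ≠ i' → ∀ y ∈ (it i).sites, ∀ y' ∈ (it i').sites,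
    scale k ≤ G.dist y y'

theorem freezeTime_cast_le (b : ℕ) : (freezeTime b : ℝ) ≤ b + b / 2 + 2 := by
  have h : 2 * freezeTime b ≤ 3 * b + 4 := by unfold freezeTime; omega
  have h' : (2 : ℝ) * freezeTime b ≤ 3 * b + 4 := by exact_mod_cast h
  linarith

/-- Freezing the neutral clusters which are old enough. -/
theorem IsState.freeze {V : Type*} [Fintype V] [DecidableEq V] {G : SimpleGraph V} {γ s C : ℝ}
    {k : ℕ} {ac fz : Finset V} {it : V → Cluster V} (h : IsState G γ s C k k ac fz it)
    (hC : 0 ≤ C) (hs : 4 * C ≤ s) :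
    ∃ ac' fz', ac' ∪ fz' = ac ∪ fz ∧ IsState G γ s C k (k + 1) ac' fz' it := by
  classical
  let q : V → Prop := fun i => (it i).cover.card = 1 ∧ ∑ y, (it i).density y = 0 ∧
    freezeTime (it i).birth = k
  have hun : ac.filter (fun i => ¬ q i) ∪ (fz ∪ ac.filter q) = ac ∪ fz := by
    ext i; simp only [Finset.mem_union, Finset.mem_filter]; tauto
  have hnew : ∀ i ∈ ac.filter q, IsFrozen G γ s (it i) := by
    intro i hi
    obtain ⟨hi, hq1, hq2, hq3⟩ := Finset.mem_filter.1 hi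
    have ha := h.active i hi
    obtain ⟨n1, n2, n3, n4, n5⟩ := ha.neutral hq1 hq2
    refine ⟨ha.toHasBumps, ha.cover_subset (by rw [ha.cover_eq hq1]; simp), hq2, n3, n4,
      n5.trans (Real.exp_le_exp.2 ?_)⟩
    have h1 := freezeTime_cast_le (it i).birth
    rw [hq3] at h1
    have h2 : (0 : ℝ) ≤ (it i).birth := Nat.cast_nonneg _
    have h3 : C * (k - (it i).birth) ≤ C * ((it i).birth / 2 + 2) :=
      mul_le_mul_of_nonneg_left (by linarith) hC
    have h4 : 4 * C * ((it i).birth + 100) ≤ s * ((it i).birth + 100) :=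
      mul_le_mul_of_nonneg_right hs (by positivity)
    have h5 : 0 ≤ C * (it i).birth := mul_nonneg hC h2
    nlinarith
  have hfz : ∀ i ∈ fz ∪ ac.filter q, IsFrozen G γ s (it i) := fun i hi =>
    (Finset.mem_union.1 hi).elim (h.frozen i) (hnew i)
  refine ⟨ac.filter fun i => ¬ q i, fz ∪ ac.filter q, hun, ?_⟩
  have hbs : ∀ e e', BumpSep G fz it e e' → BumpSep G (fz ∪ ac.filter q) it e e' := by
    rintro e e' (h1 | h1 | ⟨f, hf, h1⟩)
    · exact Or.inl h1
    · exact Or.inr (Or.inl h1)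
    · exact Or.inr (Or.inr ⟨f, Finset.mem_union_left _ hf, h1⟩)
  refine ⟨⟨Finset.subset_union_right, hfz, ?_, ?_, ?_, ?_⟩, ?_, ?_, ?_, ?_⟩
  · rw [hun]; exact h.disj
  · intro i hi i' hi' hii hb
    rcases Finset.mem_union.1 hi with h1 | h1 <;> rcases Finset.mem_union.1 hi' with h2 | h2
    · exact h.frozen_sep i h1 i' h2 hii hb
    · have := h.frozen_lt i h1
      rw [hb, (Finset.mem_filter.1 h2).2.2.2] at this
      exact absurd this (lt_irrefl _)
    · have := h.frozen_lt i' h2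
      rw [← hb, (Finset.mem_filter.1 h1).2.2.2] at this
      exact absurd this (lt_irrefl _)
    -- Clusters frozen now have `freezeTime` of their birth equal to `k`, and active clusters are
    -- `scale k` apart: this is the separation demanded of frozen clusters with a common birth
    -- scale.
    · rw [(Finset.mem_filter.1 h1).2.2.2]
      exact h.sep i (Finset.mem_filter.1 h1).1 i' (Finset.mem_filter.1 h2).1 hii _
        (hnew i h1).center_mem _ (hnew i' h2).center_mem
  · rw [hun]
    intro i hi e he i' hi' hii
    rcases h.bump_other i hi e he i' hi' hii with h1 | h1
    · exact Or.inl ⟨Finset.mem_union_left _ h1.1, h1.2⟩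
    · exact Or.inr h1
  · rw [hun]
    intro i hi i' hi' e he e' he' hee
    exact (h.bump_sep i hi i' hi' e he e' he' hee).imp (hbs _ _) (hbs _ _)
  · rw [Finset.disjoint_left]
    intro i hi hi'
    rw [Finset.mem_filter] at hi
    rcases Finset.mem_union.1 hi' with h1 | h1
    · exact Finset.disjoint_left.1 h.disj_idx hi.1 h1
    · exact hi.2 (Finset.mem_filter.1 h1).2
  · intro i hi
    rw [Finset.mem_filter] at hi
    have ha := h.active i hi.1
    refine { ha with neutral := fun h1 h2 => ?_ }
    obtain ⟨n1, n2, n3⟩ := ha.neutral h1 h2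
    exact ⟨n1, lt_of_le_of_ne n2 fun hk => hi.2 ⟨h1, h2, hk.symm⟩, n3⟩
  · intro i hi
    rcases Finset.mem_union.1 hi with h1 | h1
    · exact (h.frozen_lt i h1).trans (Nat.lt_succ_self _)
    · rw [(Finset.mem_filter.1 h1).2.2.2]; exact Nat.lt_succ_self _
  · intro i hi j hj
    exact h.sep i (Finset.mem_filter.1 hi).1 j (Finset.mem_filter.1 hj).1

/-! ### Merging clusters -/

/-- A cut-connected set of centres has a coarser set of centres of at most half its size. -/
theorem exists_coarse_cover {V : Type*} [DecidableEq V] {G : SimpleGraph V} (hG : G.Connected)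
    {P : Finset V} {r : ℕ} (h : CutConnected (fun p q => G.dist p q ≤ r) P) (hP : 2 ≤ P.card) :
    ∃ D ⊆ P, D.Nonempty ∧ 2 * D.card ≤ P.card ∧ (∀ p ∈ P, ∃ q ∈ D, G.dist q p ≤ r) ∧
      CutConnected (fun p q => G.dist p q ≤ 3 * r) D := by
  obtain ⟨D, hD, hcard, hdom⟩ := h.exists_dominating
    (fun x y hxy => by rwa [G.dist_comm]) hP
  have hdom' : ∀ p ∈ P, ∃ q ∈ D, G.dist q p ≤ r := by
    intro p hp
    rcases hdom p hp with h1 | ⟨q, hq, h1⟩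
    · exact ⟨p, h1, by simp⟩
    · exact ⟨q, hq, by rwa [G.dist_comm]⟩
  have hne : D.Nonempty := by
    obtain ⟨p, hp⟩ := Finset.card_pos.1 (by omega : 0 < P.card)
    obtain ⟨q, hq, -⟩ := hdom' p hp
    exact ⟨q, hq⟩
  refine ⟨D, hD, hne, hcard, hdom', ?_⟩
  intro B hB hBne hBD
  -- `B'` is the `r`-neighbourhood of `B` in `P`. If it is everything, any centre outside `B` is
  -- within `r` of `B`; otherwise a link leaving `B'` joins `B` to another centre in three steps of
  -- length at most `r`.
  let B' := P.filter fun x => ∃ b ∈ B, G.dist b x ≤ r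
  have hBB' : B ⊆ B' := fun b hb => Finset.mem_filter.2 ⟨hD (hB hb), b, hb, by simp⟩
  by_cases hB' : B' = P
  · obtain ⟨q, hq, hqB⟩ : ∃ q ∈ D, q ∉ B := by
      by_contra hcon
      push Not at hcon
      exact hBD (Finset.Subset.antisymm hB hcon)
    obtain ⟨b, hb, h1⟩ := (Finset.mem_filter.1 (hB'.symm ▸ hD hq : q ∈ B')).2
    exact ⟨b, hb, q, Finset.mem_sdiff.2 ⟨hq, hqB⟩, by simp only; omega⟩
  · obtain ⟨x, hx, y, hy, hxy⟩ := h B' (Finset.filter_subset _ _) (hBne.mono hBB') hB'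
    obtain ⟨b, hb, h1⟩ := (Finset.mem_filter.1 hx).2
    rw [Finset.mem_sdiff] at hy
    obtain ⟨q, hq, h2⟩ := hdom' y hy.1
    refine ⟨b, hb, q, Finset.mem_sdiff.2 ⟨hq, fun hqB => hy.2 ?_⟩, ?_⟩
    · exact Finset.mem_filter.2 ⟨hy.1, q, hqB, h2⟩
    · have t1 := hG.dist_triangle (u := b) (v := x) (w := q)
      have t2 := hG.dist_triangle (u := x) (v := y) (w := q)
      rw [G.dist_comm (u := y)] at t2
      simp only at hxy ⊢
      omega

/-- A neutral cluster not yet frozen satisfies k ≤ 3b/2 + 1 for its birth scale b, so 1.8s(b + 100)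
still exceeds s(k + 100) plus the loss C(k - b). The choice of the freezing time rests on this. -/
theorem IsActive.weight_single {V : Type*} [Fintype V] [DecidableEq V] {G : SimpleGraph V}
    {γ s C : ℝ} {k : ℕ} {x : Cluster V} (h : IsActive G γ s C k (k + 1) x) (hC : 0 ≤ C)
    (hs : 4 * C ≤ s) (hx : x.cover.card = 1) : x.weight γ ≤ Real.exp (-(s * (k + 100))) := by
  by_cases hc : ∑ y, x.density y = 0
  · obtain ⟨n1, n2, -, -, n5⟩ := h.neutral hx hc
    refine n5.trans (Real.exp_le_exp.2 ?_)
    have h1 := freezeTime_cast_le x.birth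
    have h1' : (k : ℝ) + 1 ≤ freezeTime x.birth := by exact_mod_cast n2
    have h2 : (0 : ℝ) ≤ x.birth := Nat.cast_nonneg _
    have h2' : (x.birth : ℝ) ≤ k := by exact_mod_cast n1
    have h3 : 4 * C * (k - x.birth) ≤ s * (k - x.birth) :=
      mul_le_mul_of_nonneg_right hs (by linarith)
    have hs0 : 0 ≤ s := by linarith
    have h4 : s * (k - x.birth) ≤ s * (x.birth / 2 + 1) :=
      mul_le_mul_of_nonneg_left (by linarith) hs0
    have h5 : 0 ≤ s * x.birth := mul_nonneg hs0 h2
    nlinarith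
  · exact h.weight_charged hx hc

/-- For two or more centres, the surplus 0.9s(k + 100) over the leading term is more than the 8s
needed to pass from `card - 2` to `card - 1`. -/
theorem IsActive.weight_le {V : Type*} [Fintype V] [DecidableEq V] {G : SimpleGraph V}
    {γ s C : ℝ} {k : ℕ} {x : Cluster V} (h : IsActive G γ s C k (k + 1) x) (hC : 0 ≤ C)
    (hs : 4 * C ≤ s) :
    x.weight γ ≤ Real.exp (-(s * (k + 100) - 8 * s + 8 * s * x.cover.card)) := by
  have hs0 : 0 ≤ s := by linarith
  rcases Nat.lt_or_ge x.cover.card 2 with h1 | h1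
  · have h2 : x.cover.card = 1 := by
      have := h.cover_nonempty.card_pos
      omega
    refine (h.weight_single hC hs h2).trans (Real.exp_le_exp.2 ?_)
    rw [h2]; push_cast; linarith
  · refine (h.weight_large h1).trans (Real.exp_le_exp.2 ?_)
    have : 0 ≤ s * k := mul_nonneg hs0 (Nat.cast_nonneg k)
    nlinarith

/-- The data of a cluster obtained by merging the clusters indexed by `I` at scale `k`. -/
structure IsMerge {V : Type*} [Fintype V] [DecidableEq V] (G : SimpleGraph V) (γ s C : ℝ) (k : ℕ)
    (it : V → Cluster V) (I : Finset V) (ρ : V → ℤ) (K : ℝ) : Prop where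
  nonempty : I.Nonempty
  active : ∀ i ∈ I, IsActive G γ s C k (k + 1) (it i)
  conn : CutConnected (fun i i' => ∃ y ∈ (it i).sites, ∃ y' ∈ (it i').sites,
    G.dist y y' < scale (k + 1)) I
  disj : ∀ i ∈ I, ∀ i' ∈ I, i ≠ i' → Disjoint (it i).sites (it i').sites
  bump_other : ∀ i ∈ I, ∀ e ∈ (it i).bumps, ∀ i' ∈ I, i' ≠ i →
    ∀ y ∈ (it i').sites, 32 * scale e.2 ≤ G.dist e.1 y
  sign : ∃ ε : V → ℤ, (∀ i, ε i = 1 ∨ ε i = -1) ∧ ρ = ∑ i ∈ I, ε i • (it i).density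
  bound : |K| ≤ ∏ i ∈ I, (|(it i).activity| * Real.exp (C * (it i).cover.card))

/-- The cluster formed by the union of the sites and bumps of the clusters indexed by `I`. -/
def mergedCluster {V : Type*} [DecidableEq V] (it : V → Cluster V) (I : Finset V) (ρ : V → ℤ)
    (K : ℝ) (P : Finset V) (c : V) (b : ℕ) : Cluster V where
  sites := I.biUnion fun i => (it i).sites
  density := ρ
  activity := K
  bumps := I.biUnion fun i => (it i).bumps
  cover := P
  center := c
  birth := b

/-- The other clusters of `I` have no site within distance 32 scales of a bump. The empty annulus
around it survives the merging, and the charge inside changes at most by a sign. -/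
theorem IsMerge.hasBumps {V : Type*} [Fintype V] [DecidableEq V] {G : SimpleGraph V} {γ s C : ℝ}
    {k : ℕ} {it : V → Cluster V} {I : Finset V} {ρ : V → ℤ} {K : ℝ}
    (h : IsMerge G γ s C k it I ρ K) (P : Finset V) (c : V) (b : ℕ) :
    HasBumps G (mergedCluster it I ρ K P c b) := by
  obtain ⟨ε, hε, hρ⟩ := h.sign
  have hρy : ∀ y, ρ y = ∑ i ∈ I, ε i * (it i).density y := fun y => by
    rw [hρ, Finset.sum_apply]; rfl
  refine ⟨fun y hy => ?_, fun e he => ?_, fun e he y hy hd => ?_, fun e he => ?_⟩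
  · change ρ y ≠ 0 at hy
    rw [hρy] at hy
    obtain ⟨i, hi, hne⟩ := Finset.exists_ne_zero_of_sum_ne_zero hy
    exact Finset.mem_biUnion.2 ⟨i, hi, (h.active i hi).supp y (right_ne_zero_of_mul hne)⟩
  · obtain ⟨i, hi, he⟩ := Finset.mem_biUnion.1 he
    exact Finset.mem_biUnion.2 ⟨i, hi, (h.active i hi).mem e he⟩
  · obtain ⟨i, hi, he⟩ := Finset.mem_biUnion.1 he
    obtain ⟨i', hi', hy⟩ := Finset.mem_biUnion.1 hy
    by_cases hii : i' = i
    · subst hii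
      exact (h.active i' hi').iso e he y hy hd
    · exact absurd (h.bump_other i hi e he i' hi' hii y hy) (by omega)
  · obtain ⟨i, hi, he⟩ := Finset.mem_biUnion.1 he
    change ∑ y with G.dist e.1 y ≤ 3 * scale e.2, ρ y ≠ 0
    simp only [hρy]
    rw [Finset.sum_comm, Finset.sum_eq_single_of_mem i hi, ← Finset.mul_sum]
    · refine mul_ne_zero ?_ ((h.active i hi).charge e he)
      rcases hε i with h1 | h1 <;> rw [h1] <;> norm_num
    · intro i' hi' hii
      refine Finset.sum_eq_zero fun y hy => ?_
      by_contra hne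
      have h1 := (h.active i' hi').supp y (right_ne_zero_of_mul hne)
      have h2 := h.bump_other i hi e he i' hi' hii y h1
      have h3 := (Finset.mem_filter.1 hy).2
      have h4 := scale_pos e.2
      omega

/-- The weight is submultiplicative: the ℓ¹ norm of the density is subadditive under signed sums,
while the numbers of bumps of disjoint clusters add up. -/
theorem IsMerge.weight_le {V : Type*} [Fintype V] [DecidableEq V] {G : SimpleGraph V} {γ s C : ℝ}
    {k : ℕ} {it : V → Cluster V} {I : Finset V} {ρ : V → ℤ} {K : ℝ}
    (h : IsMerge G γ s C k it I ρ K) (P : Finset V) (c : V) (b : ℕ) :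
    (mergedCluster it I ρ K P c b).weight γ ≤
      ∏ i ∈ I, ((it i).weight γ * Real.exp (C * (it i).cover.card)) := by
  obtain ⟨ε, hε, hρ⟩ := h.sign
  have hB : (I.biUnion fun i => (it i).bumps).card = ∑ i ∈ I, (it i).bumps.card := by
    refine Finset.card_biUnion fun i hi i' hi' hii => ?_
    change Disjoint (it i).bumps (it i').bumps
    rw [Finset.disjoint_left]
    intro e he he'
    exact Finset.disjoint_left.1 (h.disj i hi i' hi' hii) ((h.active i hi).mem e he)
      ((h.active i' hi').mem e he')
  have hsum : ∑ y, |(ρ y : ℝ)| ≤ ∑ i ∈ I, ∑ y, |((it i).density y : ℝ)| := by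
    rw [Finset.sum_comm]
    refine Finset.sum_le_sum fun y _ => ?_
    have : (ρ y : ℝ) = ∑ i ∈ I, (ε i : ℝ) * (it i).density y := by
      rw [hρ, Finset.sum_apply]; simp
    rw [this]
    refine (Finset.abs_sum_le_sum_abs _ _).trans (Finset.sum_le_sum fun i _ => ?_)
    rw [abs_mul]
    rcases hε i with h1 | h1 <;> simp [h1]
  have e1 : ∏ i ∈ I, ((it i).weight γ * Real.exp (C * (it i).cover.card)) =
      (∏ i ∈ I, (|(it i).activity| * Real.exp (C * (it i).cover.card))) *
      Real.exp (∑ i ∈ I, ∑ y, |((it i).density y : ℝ)| - γ * ∑ i ∈ I, ((it i).bumps.card : ℝ)) := by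
    rw [Finset.mul_sum, ← Finset.sum_sub_distrib, Real.exp_sum, ← Finset.prod_mul_distrib]
    refine Finset.prod_congr rfl fun i _ => ?_
    unfold Cluster.weight
    ring
  rw [e1]
  refine mul_le_mul h.bound (Real.exp_le_exp.2 ?_) (Real.exp_pos _).le
    (Finset.prod_nonneg fun i _ => mul_nonneg (abs_nonneg _) (Real.exp_pos _).le)
  change ∑ y, |(ρ y : ℝ)| - γ * ((I.biUnion fun i => (it i).bumps).card : ℝ) ≤ _
  rw [hB]
  push_cast
  linarith

/-- The numerical estimate for the weight of a cluster with several centres. -/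
theorem IsMerge.weight_le_exp {V : Type*} [Fintype V] [DecidableEq V] {G : SimpleGraph V}
    {γ s C : ℝ} {k : ℕ} {it : V → Cluster V} {I : Finset V} {ρ : V → ℤ} {K : ℝ}
    (h : IsMerge G γ s C k it I ρ K) (P : Finset V) (c : V) (b : ℕ) (hC : 0 ≤ C) (hs : 4 * C ≤ s)
    (n' : ℕ) (hn' : 1 ≤ n') (hn : 2 * n' ≤ ∑ i ∈ I, (it i).cover.card) :
    (mergedCluster it I ρ K P c b).weight γ ≤
      Real.exp (-(if n' = 1 then 1.8 * (s * ((k + 1 : ℕ) + 100)) else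
        1.9 * (s * ((k + 1 : ℕ) + 100)) + 8 * s * (n' - 2))) := by
  have hs0 : 0 ≤ s := by linarith
  have hk : 0 ≤ s * k := mul_nonneg hs0 (Nat.cast_nonneg k)
  refine (h.weight_le P c b).trans ?_
  have hn1 : (1 : ℝ) ≤ n' := by exact_mod_cast hn'
  have hnR : 2 * (n' : ℝ) ≤ ∑ i ∈ I, ((it i).cover.card : ℝ) := by exact_mod_cast hn
  set m : ℝ := ∑ i ∈ I, ((it i).cover.card : ℝ) with hm
  have hCm : C * m ≤ s / 4 * m := mul_le_mul_of_nonneg_right (by linarith) (by linarith)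
  have hsn : s * (2 * n') ≤ s * m := mul_le_mul_of_nonneg_left hnR hs0
  have hsn1 : s * 1 ≤ s * n' := mul_le_mul_of_nonneg_left hn1 hs0
  -- For a single cluster the cover shrinks from at least `2 * n'` centres to `n'`. If one centre
  -- remains, the margin from 1.9 to 1.8 pays for `C * m` and for the next scale; otherwise each
  -- lost centre frees 8s. For at least two clusters the leading terms add up to 2s(k + 100), above
  -- 1.9s(k + 101) with room to spare.
  by_cases hI : I.card = 1
  · obtain ⟨i, rfl⟩ := Finset.card_eq_one.1 hI
    simp only [Finset.prod_singleton, Finset.sum_singleton] at hn hm ⊢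
    have h1 := (h.active i (Finset.mem_singleton_self i)).weight_large (by omega)
    refine (mul_le_mul_of_nonneg_right h1 (Real.exp_pos _).le).trans ?_
    rw [← Real.exp_add, ← hm]
    refine Real.exp_le_exp.2 ?_
    split_ifs with hc
    · push_cast; nlinarith
    · have h2 : (2 : ℝ) ≤ n' := by exact_mod_cast (by omega : 2 ≤ n')
      have h3 : s * 2 ≤ s * n' := mul_le_mul_of_nonneg_left h2 hs0
      push_cast; nlinarith
  · have hI2 : (2 : ℝ) ≤ I.card := by
      have := h.nonempty.card_pos
      exact_mod_cast (by omega : 2 ≤ I.card)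
    have h1 : ∏ i ∈ I, ((it i).weight γ * Real.exp (C * (it i).cover.card)) ≤
        ∏ i ∈ I, Real.exp (-(s * (k + 100) - 8 * s + 8 * s * (it i).cover.card) +
          C * (it i).cover.card) := by
      refine Finset.prod_le_prod (fun i _ => mul_nonneg (Cluster.weight_nonneg _ _)
        (Real.exp_pos _).le) fun i hi => ?_
      rw [Real.exp_add]
      exact mul_le_mul_of_nonneg_right ((h.active i hi).weight_le hC hs) (Real.exp_pos _).le
    refine h1.trans ?_
    rw [← Real.exp_sum]
    refine Real.exp_le_exp.2 ?_
    rw [Finset.sum_add_distrib, Finset.sum_neg_distrib, Finset.sum_add_distrib, ← Finset.mul_sum,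
      ← Finset.mul_sum, ← hm, Finset.sum_const, nsmul_eq_mul]
    have h4 : 2 * (s * (k + 100) - 8 * s) ≤ I.card * (s * (k + 100) - 8 * s) :=
      mul_le_mul_of_nonneg_right hI2 (by nlinarith)
    split_ifs with hc
    · rw [hc] at hsn; push_cast at hsn ⊢; nlinarith
    · have h2 : (2 : ℝ) ≤ n' := by exact_mod_cast (by omega : 2 ≤ n')
      have h3 : s * 2 ≤ s * n' := mul_le_mul_of_nonneg_left h2 hs0
      push_cast; nlinarith

/-- Near clusters have centres within 2 + 128 + 2 = 132 times `scale k`, so the union of the covers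
is connected at that range. Passing to a dominating half gives sites within 134 and links of at most
396, below the 256 and 768 allowed at the next scale. The halving is what drives the weight
estimate. -/
theorem IsMerge.exists_isActive_of_two_le {V : Type*} [Fintype V] [DecidableEq V]
    {G : SimpleGraph V} (hG : G.Connected) {γ s C : ℝ} {k : ℕ} {it : V → Cluster V} {I : Finset V}
    {ρ : V → ℤ} {K : ℝ} (h : IsMerge G γ s C k it I ρ K) (hC : 0 ≤ C) (hs : 4 * C ≤ s)
    (hI : 2 ≤ ∑ i ∈ I, (it i).cover.card) :
    ∃ P c b, IsActive G γ s C (k + 1) (k + 1) (mergedCluster it I ρ K P c b) := by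
  have hcard : (I.biUnion fun i => (it i).cover).card = ∑ i ∈ I, (it i).cover.card := by
    refine Finset.card_biUnion fun i hi i' hi' hii => ?_
    exact (h.disj i hi i' hi' hii).mono (h.active i hi).cover_subset (h.active i' hi').cover_subset
  have hscale := scale_succ k
  have hpos := scale_pos k
  have hconn : CutConnected (fun p q => G.dist p q ≤ 132 * scale k)
      (I.biUnion fun i => (it i).cover) := by
    refine h.conn.biUnion (fun i hi => (h.active i hi).conn.mono fun p q hpq => by omega) ?_
    rintro i hi i' hi' ⟨y, hy, y', hy', hd⟩
    obtain ⟨p, hp, h1⟩ := (h.active i hi).exists_cover y hy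
    obtain ⟨p', hp', h2⟩ := (h.active i' hi').exists_cover y' hy'
    refine ⟨p, hp, p', hp', ?_⟩
    have t1 := hG.dist_triangle (u := p) (v := y) (w := p')
    have t2 := hG.dist_triangle (u := y) (v := y') (w := p')
    rw [G.dist_comm (u := y') (v := p')] at t2
    omega
  obtain ⟨D, hDP, hDne, hDcard, hdom, hDconn⟩ := exists_coarse_cover hG hconn (by omega)
  rw [hcard] at hDcard
  have hDpos := hDne.card_pos
  have hDS : D ⊆ I.biUnion fun i => (it i).sites := hDP.trans
    (Finset.biUnion_mono fun i hi => (h.active i hi).cover_subset)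
  obtain ⟨c, hc⟩ : ∃ c, D.card = 1 → D = {c} := by
    by_cases h1 : D.card = 1
    · obtain ⟨c, hc⟩ := Finset.card_eq_one.1 h1
      exact ⟨c, fun _ => hc⟩
    · exact ⟨hDne.choose, fun hh => absurd hh h1⟩
  have hw := fun c => h.weight_le_exp D c (k + 1) hC hs D.card hDpos hDcard
  have hs0 : 0 ≤ s := by linarith
  have hcov : ∀ y ∈ I.biUnion fun i => (it i).sites, ∃ p ∈ D, G.dist p y ≤ 2 * scale (k + 1) := by
    intro y hy
    obtain ⟨i, hi, hy⟩ := Finset.mem_biUnion.1 hy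
    obtain ⟨p, hp, h1⟩ := (h.active i hi).exists_cover y hy
    obtain ⟨q, hq, h2⟩ := hdom p (Finset.mem_biUnion.2 ⟨i, hi, hp⟩)
    refine ⟨q, hq, ?_⟩
    have t1 := hG.dist_triangle (u := q) (v := p) (w := y)
    omega
  have hblt : ∀ e ∈ I.biUnion fun i => (it i).bumps, e.2 < k + 1 := by
    intro e he
    obtain ⟨i, hi, he⟩ := Finset.mem_biUnion.1 he
    exact ((h.active i hi).bump_lt e he).trans (Nat.lt_succ_self k)
  refine ⟨D, c, k + 1, ⟨h.hasBumps D c (k + 1), hDne, hDS, hcov,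
    hDconn.mono fun p q hpq => by omega, hblt, ?_, hc, ?_, ?_⟩⟩
  · intro h2
    have := hw c
    rw [if_neg (by change 2 ≤ D.card at h2; omega)] at this
    exact this
  · intro h1 _
    have := hw c
    change D.card = 1 at h1
    rw [if_pos h1] at this
    refine this.trans (Real.exp_le_exp.2 ?_)
    have : 0 ≤ s * ((k + 1 : ℕ) + 100) := by positivity
    linarith
  · intro h1 _
    have hw1 := hw c
    change D.card = 1 at h1
    rw [if_pos h1] at hw1
    refine ⟨le_rfl, ?_, ?_, hblt, ?_⟩
    · change k + 1 ≤ freezeTime (k + 1)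
      unfold freezeTime; omega
    · intro y hy
      obtain ⟨p, hp, h2⟩ := hcov y hy
      rw [hc h1, Finset.mem_singleton] at hp
      exact hp ▸ h2
    · refine hw1.trans (Real.exp_le_exp.2 ?_)
      change _ ≤ -(1.8 * (s * ((k + 1 : ℕ) + 100)) - C * ((k + 1 : ℕ) - (k + 1 : ℕ)))
      linarith

/-- Merging clusters yields an active cluster at the next scale, with at most one new bump. -/
theorem IsMerge.exists_isActive {V : Type*} [Fintype V] [DecidableEq V]
    {G : SimpleGraph V} (hG : G.Connected) {γ s C : ℝ} {k : ℕ} {it : V → Cluster V} {I : Finset V}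
    {ρ : V → ℤ} {K : ℝ} (h : IsMerge G γ s C k it I ρ K) (hC : 0 ≤ C) (hs : 4 * C ≤ s)
    (hγ : s + C ≤ γ) :
    ∃ x : Cluster V, IsActive G γ s C (k + 1) (k + 1) x ∧
      x.sites = (I.biUnion fun i => (it i).sites) ∧ x.density = ρ ∧ x.activity = K ∧
      ∃ p, ∀ e ∈ x.bumps, (∃ i ∈ I, e ∈ (it i).bumps) ∨
        (e = (p, k) ∧ p ∈ x.sites ∧ ∀ y ∈ x.sites, G.dist p y ≤ 2 * scale k) := by
  have hpos := scale_pos k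
  have hscale := scale_succ k
  rcases Nat.lt_or_ge (∑ i ∈ I, (it i).cover.card) 2 with hI | hI
  · obtain ⟨i, rfl⟩ : ∃ i, I = {i} := by
      rw [← Finset.card_eq_one]
      have h1 : I.card ≤ ∑ i ∈ I, (it i).cover.card := by
        rw [Finset.card_eq_sum_ones]
        exact Finset.sum_le_sum fun i hi => (h.active i hi).cover_nonempty.card_pos
      have := h.nonempty.card_pos
      omega
    have ha := h.active i (Finset.mem_singleton_self i)
    rw [Finset.sum_singleton] at hI
    have hcard : (it i).cover.card = 1 := by have := ha.cover_nonempty.card_pos; omega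
    have hcov := ha.cover_eq hcard
    obtain ⟨ε, hε, hρ⟩ := h.sign
    have hch : ∑ y, ρ y = ε i * ∑ y, (it i).density y := by
      rw [hρ, Finset.sum_singleton, Finset.mul_sum]; rfl
    have hw := h.weight_le (it i).cover (it i).center (it i).birth
    rw [Finset.prod_singleton, hcard] at hw
    have hw1 := ha.weight_single hC hs hcard
    have hbump := h.hasBumps (it i).cover (it i).center (it i).birth
    have hcsites : (it i).center ∈ (it i).sites := ha.cover_subset (by rw [hcov]; simp)
    have hball : ∀ y ∈ (it i).sites, G.dist (it i).center y ≤ 2 * scale k := by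
      intro y hy
      obtain ⟨p, hp, h1⟩ := ha.exists_cover y hy
      rw [hcov, Finset.mem_singleton] at hp
      exact hp ▸ h1
    have hball' : ∀ y ∈ (it i).sites, ∃ p ∈ (it i).cover, G.dist p y ≤ 2 * scale (k + 1) := by
      intro y hy
      exact ⟨(it i).center, by rw [hcov]; simp, (hball y hy).trans (by omega)⟩
    -- A lone neutral cluster keeps its birth scale and loses a factor exp C. A lone charged cluster
    -- sees its whole charge inside a ball of radius 2 scales with no other sites of its own
    -- outside, hence acquires a bump at scale `k`; the gain γ ≥ s + C pays for both the
    -- combinatorial cost and the step to k + 1.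
    by_cases hneu : ∑ y, ρ y = 0
    · have hneu' : ∑ y, (it i).density y = 0 := by
        rw [hch] at hneu
        rcases hε i with h1 | h1 <;> simpa [h1] using hneu
      obtain ⟨n1, n2, n3, n4, n5⟩ := ha.neutral hcard hneu'
      refine ⟨mergedCluster it {i} ρ K (it i).cover (it i).center (it i).birth,
        ⟨hbump, ha.cover_nonempty, ?_, ?_, ?_, ?_, ?_, fun _ => hcov, ?_, ?_⟩, rfl, rfl, rfl,
        (it i).center, fun e he => Or.inl (by simpa [mergedCluster] using he)⟩
      · simpa [mergedCluster] using ha.cover_subset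
      · simpa [mergedCluster] using hball'
      · exact ha.conn.mono fun p q hpq => by omega
      · intro e he
        exact (ha.bump_lt e (by simpa [mergedCluster] using he)).trans (Nat.lt_succ_self k)
      · intro h2
        change 2 ≤ (it i).cover.card at h2
        omega
      · exact fun _ hh => absurd hneu hh
      · intro _ _
        refine ⟨n1.trans (Nat.le_succ k), n2, by simpa [mergedCluster] using n3,
          by simpa [mergedCluster] using n4, ?_⟩
        refine hw.trans ((mul_le_mul_of_nonneg_right n5 (Real.exp_pos _).le).trans ?_)
        rw [← Real.exp_add]
        refine Real.exp_le_exp.2 ?_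
        change _ ≤ -(1.8 * (s * ((it i).birth + 100)) - C * ((k + 1 : ℕ) - (it i).birth))
        push_cast
        linarith
    · have hnotin : ((it i).center, k) ∉ (it i).bumps := fun hh =>
        lt_irrefl _ (ha.bump_lt _ hh)
      refine ⟨{ mergedCluster it {i} ρ K (it i).cover (it i).center (it i).birth with
        bumps := insert ((it i).center, k) (it i).bumps },
        ⟨⟨hbump.supp, ?_, ?_, ?_⟩, ha.cover_nonempty, ?_, ?_, ?_, ?_, ?_, fun _ => hcov, ?_, ?_⟩,
        rfl, rfl, rfl, (it i).center, ?_⟩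
      · intro e he
        rcases Finset.mem_insert.1 he with rfl | he
        · simpa [mergedCluster] using hcsites
        · exact hbump.mem e (by simpa [mergedCluster] using he)
      · intro e he y hy hd
        rcases Finset.mem_insert.1 he with rfl | he
        · have := hball y (by simpa [mergedCluster] using hy)
          simp only at *
          omega
        · exact hbump.iso e (by simpa [mergedCluster] using he) y hy hd
      · intro e he
        rcases Finset.mem_insert.1 he with rfl | he
        · change ∑ y with G.dist (it i).center y ≤ 3 * scale k, ρ y ≠ 0
          rw [Finset.sum_filter_of_ne]
          · exact hneu
          · intro y _ hy
            have := hball y (by simpa [mergedCluster] using hbump.supp y hy)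
            omega
        · exact hbump.charge e (by simpa [mergedCluster] using he)
      · simpa [mergedCluster] using ha.cover_subset
      · simpa [mergedCluster] using hball'
      · exact ha.conn.mono fun p q hpq => by omega
      · intro e he
        rcases Finset.mem_insert.1 he with rfl | he
        · exact Nat.lt_succ_self k
        · exact (ha.bump_lt e he).trans (Nat.lt_succ_self k)
      · intro h2
        change 2 ≤ (it i).cover.card at h2
        omega
      · intro _ _
        have hwe : Cluster.weight γ { mergedCluster it {i} ρ K (it i).cover (it i).center
            (it i).birth with bumps := insert ((it i).center, k) (it i).bumps } =
            (mergedCluster it {i} ρ K (it i).cover (it i).center (it i).birth).weight γ *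
              Real.exp (-γ) := by
          simp only [Cluster.weight, mergedCluster, Finset.singleton_biUnion]
          rw [Finset.card_insert_of_notMem hnotin, mul_assoc, ← Real.exp_add]
          push_cast
          ring_nf
        rw [hwe]
        refine (mul_le_mul_of_nonneg_right (hw.trans (mul_le_mul_of_nonneg_right hw1
          (Real.exp_pos _).le)) (Real.exp_pos _).le).trans ?_
        rw [← Real.exp_add, ← Real.exp_add]
        refine Real.exp_le_exp.2 ?_
        push_cast
        linarith
      · exact fun _ hh => absurd hh hneu
      · intro e he
        rcases Finset.mem_insert.1 he with rfl | he
        · exact Or.inr ⟨rfl, by simpa [mergedCluster] using hcsites,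
            by simpa [mergedCluster] using hball⟩
        · exact Or.inl ⟨i, by simp, he⟩
  · obtain ⟨P, c, b, hP⟩ := h.exists_isActive_of_two_le hG hC hs hI
    exact ⟨_, hP, rfl, rfl, rfl, c, fun e he => Or.inl (by simpa [mergedCluster] using he)⟩

/-! ### One step of the multiscale analysis -/

/-- Separated points in a ball of comparable radius are bounded in number. -/
def HasPacking {V : Type*} (G : SimpleGraph V) (M : ℕ) : Prop :=
  ∀ (k : ℕ) (p : V) (A : Finset V), (∀ x ∈ A, G.dist p x ≤ 2 * scale (k + 1)) →
    (∀ x ∈ A, ∀ y ∈ A, x ≠ y → scale k ≤ G.dist x y) → A.card ≤ M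

/-- The relation of clusters which are merged at scale `k + 1`. -/
def NearBy {V : Type*} (G : SimpleGraph V) (k : ℕ) (it : V → Cluster V) (i i' : V) : Prop :=
  ∃ y ∈ (it i).sites, ∃ y' ∈ (it i').sites, G.dist y y' < scale (k + 1)

theorem scale_mul_le {t k : ℕ} (h : t < k) : 128 * scale t ≤ scale k := by
  rw [← scale_succ]; exact scale_mono h

/-- Every near cluster has a site within `2 * scale (k + 1)` of one of the centres. One such site
per cluster gives points `scale k` apart, because active clusters are, and packing bounds their
number for each centre. -/
theorem IsState.card_nearBy_le {V : Type*} [Fintype V] [DecidableEq V] {G : SimpleGraph V}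
    (hG : G.Connected) {M : ℕ} (hM : HasPacking G M) {γ s C : ℝ} {k k' : ℕ} {ac fz : Finset V}
    {it : V → Cluster V} (h : IsState G γ s C k k' ac fz it) {i : V} (hi : i ∈ ac)
    [DecidablePred (NearBy G k it i)] :
    (ac.filter (NearBy G k it i)).card ≤ (it i).cover.card * M := by
  classical
  have hscale := scale_succ k
  have hpos := scale_pos k
  refine (Finset.card_le_card (t := (it i).cover.biUnion fun p => ac.filter fun i' =>
    ∃ y' ∈ (it i').sites, G.dist p y' ≤ 2 * scale (k + 1)) ?_).trans
    (Finset.card_biUnion_le_card_mul _ _ _ fun p hp => ?_)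
  · intro i' hi'
    obtain ⟨hi', y, hy, y', hy', hd⟩ := Finset.mem_filter.1 hi'
    obtain ⟨p, hp, h1⟩ := (h.active i hi).exists_cover y hy
    refine Finset.mem_biUnion.2 ⟨p, hp, Finset.mem_filter.2 ⟨hi', y', hy', ?_⟩⟩
    have := hG.dist_triangle (u := p) (v := y) (w := y')
    omega
  · have hch : ∀ i' : V, ∃ y' : V, i' ∈ ac.filter (fun i' => ∃ y' ∈ (it i').sites,
        G.dist p y' ≤ 2 * scale (k + 1)) → y' ∈ (it i').sites ∧
        G.dist p y' ≤ 2 * scale (k + 1) := by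
      intro i'
      by_cases h1 : i' ∈ ac.filter (fun i' => ∃ y' ∈ (it i').sites,
        G.dist p y' ≤ 2 * scale (k + 1))
      · obtain ⟨-, y', h2⟩ := Finset.mem_filter.1 h1
        exact ⟨y', fun _ => h2⟩
      · exact ⟨i', fun hh => absurd hh h1⟩
    choose f hf using hch
    have hsep : ∀ a ∈ ac.filter (fun i' => ∃ y' ∈ (it i').sites, G.dist p y' ≤ 2 * scale (k + 1)),
        ∀ b ∈ ac.filter (fun i' => ∃ y' ∈ (it i').sites, G.dist p y' ≤ 2 * scale (k + 1)),
        a ≠ b → scale k ≤ G.dist (f a) (f b) := fun a ha b hb hab =>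
      h.sep a (Finset.mem_filter.1 ha).1 b (Finset.mem_filter.1 hb).1 hab _ (hf a ha).1 _ (hf b hb).1
    rw [← Finset.card_image_of_injOn (f := f)]
    · refine hM k p _ ?_ ?_
      · intro x hx
        obtain ⟨a, ha, rfl⟩ := Finset.mem_image.1 hx
        exact (hf a ha).2
      · intro x hx y hy hxy
        obtain ⟨a, ha, rfl⟩ := Finset.mem_image.1 hx
        obtain ⟨b, hb, rfl⟩ := Finset.mem_image.1 hy
        exact hsep a ha b hb fun hab => hxy (hab ▸ rfl)
    · intro a ha b hb hab
      by_contra hne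
      have := hsep a ha b hb hne
      rw [hab, SimpleGraph.dist_self] at this
      omega

/-- The combinatorial factor 4^(1 + degree) becomes exp(C · number of centres), since the degree is
at most `M` per centre and C = (1 + M) log 4. -/
theorem IsState.isMerge {V : Type*} [Fintype V] [DecidableEq V] {G : SimpleGraph V}
    (hG : G.Connected) {M : ℕ} (hM : HasPacking G M) {γ s C : ℝ} {k : ℕ} {ac fz : Finset V}
    {it : V → Cluster V} (h : IsState G γ s C k (k + 1) ac fz it) (hC : C = (1 + M) * Real.log 4)
    [DecidableRel (NearBy G k it)] {T : Finset V} {I : V → Finset V} {ρ : V → V → ℤ} {K : V → ℝ}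
    (hcl : IsClustering ac (NearBy G k it) (fun i => (it i).density) (fun i => (it i).activity)
      T I ρ K) {t : V} (ht : t ∈ T) : IsMerge G γ s C k it (I t) (ρ t) (K t) := by
  have hsub := hcl.subset t ht
  refine ⟨⟨t, hcl.mem t ht⟩, fun i hi => h.active i (hsub hi), hcl.conn t ht,
    fun i hi i' hi' => h.disj i (Finset.mem_union_left _ (hsub hi)) i'
      (Finset.mem_union_left _ (hsub hi')), ?_, hcl.sign t ht, ?_⟩
  · intro i hi e he i' hi' hii
    rcases h.bump_other i (Finset.mem_union_left _ (hsub hi)) e he i'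
      (Finset.mem_union_left _ (hsub hi')) hii with h1 | h1
    · exact absurd h1.1 (Finset.disjoint_left.1 h.disj_idx (hsub hi'))
    · exact h1
  · refine (hcl.bound t ht).trans (Finset.prod_le_prod (fun i _ => by positivity) fun i hi => ?_)
    refine mul_le_mul_of_nonneg_left ?_ (abs_nonneg _)
    have h1 := h.card_nearBy_le hG hM (hsub hi)
    have h2 := (h.active i (hsub hi)).cover_nonempty.card_pos
    have h3 : 1 + (ac.filter (NearBy G k it i)).card ≤ (1 + M) * (it i).cover.card := by nlinarith
    have h4 : (4 : ℝ) ^ (1 + (ac.filter (NearBy G k it i)).card) ≤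
        4 ^ ((1 + M) * (it i).cover.card) := pow_le_pow_right₀ (by norm_num) h3
    refine h4.trans (le_of_eq ?_)
    rw [hC, show (1 + (M : ℝ)) * Real.log 4 * (it i).cover.card =
      ((1 + M) * (it i).cover.card : ℕ) * Real.log 4 by push_cast; ring,
      Real.exp_nat_mul, Real.exp_log (by norm_num)]

/-- One step of the multiscale analysis. -/
theorem IsState.merge {V : Type*} [Fintype V] [DecidableEq V] {G : SimpleGraph V}
    (hG : G.Connected) {M : ℕ} (hM : HasPacking G M) {γ s C : ℝ} {k : ℕ} {ac fz : Finset V}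
    {it : V → Cluster V} (h : IsState G γ s C k (k + 1) ac fz it) (hC : C = (1 + M) * Real.log 4)
    (hs : 4 * C ≤ s) (hγ : s + C ≤ γ)
    [DecidableRel (NearBy G k it)] {T : Finset V} {I : V → Finset V} {ρ : V → V → ℤ} {K : V → ℝ}
    (hcl : IsClustering ac (NearBy G k it) (fun i => (it i).density) (fun i => (it i).activity)
      T I ρ K) :
    ∃ it', IsState G γ s C (k + 1) (k + 1) T fz it' ∧ (∀ f ∈ fz, it' f = it f) ∧
      ∀ t ∈ T, (it' t).density = ρ t ∧ (it' t).activity = K t := by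
  classical
  have hscale := scale_succ k
  have hpos := scale_pos k
  have hC0 : 0 ≤ C := by rw [hC]; have := Real.log_nonneg (by norm_num : (1 : ℝ) ≤ 4); positivity
  have hex : ∀ t : V, ∃ x : Cluster V, ∃ p, t ∈ T → IsActive G γ s C (k + 1) (k + 1) x ∧
      x.sites = ((I t).biUnion fun i => (it i).sites) ∧ x.density = ρ t ∧ x.activity = K t ∧
      ∀ e ∈ x.bumps, (∃ i ∈ I t, e ∈ (it i).bumps) ∨
        (e = (p, k) ∧ p ∈ x.sites ∧ ∀ y ∈ x.sites, G.dist p y ≤ 2 * scale k) := by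
    intro t
    by_cases ht : t ∈ T
    · obtain ⟨x, h1, h2, h3, h4, p, h5⟩ := (h.isMerge hG hM hC hcl ht).exists_isActive hG hC0 hs hγ
      exact ⟨x, p, fun _ => ⟨h1, h2, h3, h4, h5⟩⟩
    · exact ⟨it t, t, fun hh => absurd hh ht⟩
  choose X p hX using hex
  let it' : V → Cluster V := fun t => if t ∈ T then X t else it t
  -- The old clusters out of which `it' t` is made; a frozen cluster consists of itself.
  let J : V → Finset V := fun t => if t ∈ T then I t else {t}
  have hTac : T ⊆ ac := fun t ht => hcl.subset t ht (hcl.mem t ht)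
  have hTfz : ∀ f ∈ fz, f ∉ T := fun f hf hT => Finset.disjoint_left.1 h.disj_idx (hTac hT) hf
  have hitT : ∀ t ∈ T, it' t = X t := fun t ht => if_pos ht
  have hitf : ∀ t ∉ T, it' t = it t := fun t ht => if_neg ht
  have hJT : ∀ t ∈ T, J t = I t := fun t ht => if_pos ht
  have hJf : ∀ t ∉ T, J t = {t} := fun t ht => if_neg ht
  have hJsub : ∀ t ∈ T ∪ fz, ∀ i ∈ J t, i ∈ ac ∪ fz := by
    intro t ht i hi
    by_cases hT : t ∈ T
    · rw [hJT t hT] at hi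
      exact Finset.mem_union_left _ (hcl.subset t hT hi)
    · rw [hJf t hT, Finset.mem_singleton] at hi
      exact hi ▸ Finset.mem_union_right _ ((Finset.mem_union.1 ht).resolve_left hT)
  have hJdisj : ∀ t ∈ T ∪ fz, ∀ t' ∈ T ∪ fz, t ≠ t' → ∀ i ∈ J t, ∀ i' ∈ J t', i ≠ i' := by
    intro t ht t' ht' htt i hi i' hi'
    by_cases hT : t ∈ T <;> by_cases hT' : t' ∈ T
    · rw [hJT t hT] at hi
      rw [hJT t' hT'] at hi'
      exact (hcl.sep t hT t' hT' htt i hi i' hi').1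
    · rw [hJT t hT] at hi
      rw [hJf t' hT', Finset.mem_singleton] at hi'
      rintro rfl
      exact Finset.disjoint_left.1 h.disj_idx (hcl.subset t hT hi)
        (hi' ▸ (Finset.mem_union.1 ht').resolve_left hT')
    · rw [hJf t hT, Finset.mem_singleton] at hi
      rw [hJT t' hT'] at hi'
      rintro rfl
      exact Finset.disjoint_left.1 h.disj_idx (hcl.subset t' hT' hi')
        (hi ▸ (Finset.mem_union.1 ht).resolve_left hT)
    · rw [hJf t hT, Finset.mem_singleton] at hi
      rw [hJf t' hT', Finset.mem_singleton] at hi'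
      rw [hi, hi']
      exact htt
  have hsites : ∀ t, ∀ y ∈ (it' t).sites, ∃ i ∈ J t, y ∈ (it i).sites := by
    intro t y hy
    by_cases hT : t ∈ T
    · rw [hitT t hT, (hX t hT).2.1] at hy
      rw [hJT t hT]
      exact Finset.mem_biUnion.1 hy
    · rw [hitf t hT] at hy
      exact ⟨t, by simp [hJf t hT], hy⟩
  have hbumps : ∀ t, ∀ e ∈ (it' t).bumps, (∃ i ∈ J t, e ∈ (it i).bumps) ∨
      (t ∈ T ∧ e = (p t, k) ∧ p t ∈ (it' t).sites ∧
        ∀ y ∈ (it' t).sites, G.dist (p t) y ≤ 2 * scale k) := by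
    intro t e he
    by_cases hT : t ∈ T
    · rw [hitT t hT] at he ⊢
      rw [hJT t hT]
      exact ((hX t hT).2.2.2.2 e he).imp id fun h1 => ⟨hT, h1⟩
    · rw [hitf t hT] at he
      exact Or.inl ⟨t, by simp [hJf t hT], he⟩
  have hTsep : ∀ t ∈ T, ∀ t' ∈ T, t ≠ t' → ∀ y ∈ (it' t).sites, ∀ y' ∈ (it' t').sites,
      scale (k + 1) ≤ G.dist y y' := by
    intro t ht t' ht' htt y hy y' hy'
    obtain ⟨i, hi, h1⟩ := hsites t y hy
    obtain ⟨i', hi', h2⟩ := hsites t' y' hy'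
    rw [hJT t ht] at hi
    rw [hJT t' ht'] at hi'
    by_contra hcon
    exact (hcl.sep t ht t' ht' htt i hi i' hi').2 ⟨y, h1, y', h2, not_le.1 hcon⟩
  have hbs : ∀ e e', BumpSep G fz it e e' → BumpSep G fz it' e e' := by
    rintro e e' (h1 | h1 | ⟨f, hf, h1⟩)
    · exact Or.inl h1
    · exact Or.inr (Or.inl h1)
    · exact Or.inr (Or.inr ⟨f, hf, by rw [hitf f (hTfz f hf)]; exact h1⟩)
  have hfrlt : ∀ f ∈ fz, freezeTime (it f).birth ≤ k := fun f hf =>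
    Nat.lt_succ_iff.1 (h.frozen_lt f hf)
  -- An older bump against a bump created now at scale `k`. In the same cluster, the support of the
  -- older cutoff lies in the plateau of the new one (2 + 32/128 ≤ 3 scales). In another active
  -- cluster, the distance of 128 scales separates the supports. In a frozen cluster, the older
  -- support lies in a ball on which the new cutoff is constant.
  have hnewold : ∀ t ∈ T, p t ∈ (it' t).sites → (∀ y ∈ (it' t).sites, G.dist (p t) y ≤ 2 * scale k) →
      ∀ t' ∈ T ∪ fz, ∀ e ∈ (it' t').bumps, (∃ i ∈ J t', e ∈ (it i).bumps) →
      BumpSep G fz it' e (p t, k) := by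
    intro t ht hp hball t' ht' e he' ⟨i, hi, he⟩
    by_cases hT : t' ∈ T
    · rw [hJT t' hT] at hi
      have hia := h.active i (hcl.subset t' hT hi)
      have hes : e.1 ∈ (it' t').sites := by
        rw [hitT t' hT, (hX t' hT).2.1]
        exact Finset.mem_biUnion.2 ⟨i, hi, hia.mem e he⟩
      have hlt := scale_mul_le (hia.bump_lt e he)
      by_cases htt : t' = t
      · subst htt
        refine Or.inr (Or.inl fun y hy => ?_)
        have h1 := hball _ hes
        have := hG.dist_triangle (u := p t') (v := e.1) (w := y)
        simp only
        omega
      · have := hTsep t' hT t ht htt _ hes _ hp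
        refine Or.inl ?_
        simp only
        omega
    · have hf := (Finset.mem_union.1 ht').resolve_left hT
      rw [hJf t' hT, Finset.mem_singleton] at hi
      subst hi
      have hfr := h.frozen i hf
      refine Or.inr (Or.inr ⟨i, hf, by rw [hitf i hT]; exact hfrlt i hf, fun y hy => ?_⟩)
      rw [hitf i hT]
      have h1 := hfr.dist_le _ (hfr.mem e he)
      have h2 := scale_mul_le (hfr.bump_lt e he)
      have := hG.dist_triangle (u := (it i).center) (v := e.1) (w := y)
      omega
  refine ⟨it', ⟨⟨Finset.subset_union_right, ?_, ?_, ?_, ?_, ?_⟩, ?_, ?_, ?_, hTsep⟩, ?_, ?_⟩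
  · intro f hf
    rw [hitf f (hTfz f hf)]
    exact h.frozen f hf
  · intro t ht t' ht' htt
    rw [Finset.disjoint_left]
    intro y hy hy'
    obtain ⟨i, hi, h1⟩ := hsites t y hy
    obtain ⟨i', hi', h2⟩ := hsites t' y hy'
    exact Finset.disjoint_left.1 (h.disj i (hJsub t ht i hi) i' (hJsub t' ht' i' hi')
      (hJdisj t ht t' ht' htt i hi i' hi')) h1 h2
  · intro f hf f' hf'
    rw [hitf f (hTfz f hf), hitf f' (hTfz f' hf')]
    exact h.frozen_sep f hf f' hf'
  · intro t ht e he t' ht' htt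
    rcases hbumps t e he with ⟨i, hi, h1⟩ | ⟨hT, rfl, hp, hball⟩
    · by_cases hT' : t' ∈ T
      · right
        intro y hy
        obtain ⟨i', hi', h2⟩ := hsites t' y hy
        have hne := hJdisj t' ht' t ht htt i' hi' i hi
        rw [hJT t' hT'] at hi'
        have hi'ac := hcl.subset t' hT' hi'
        rcases h.bump_other i (hJsub t ht i hi) e h1 i' (Finset.mem_union_left _ hi'ac) hne
          with h3 | h3
        · exact absurd h3.1 (Finset.disjoint_left.1 h.disj_idx hi'ac)
        · exact h3 y h2
      · have hf := (Finset.mem_union.1 ht').resolve_left hT'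
        rw [hitf t' hT']
        exact h.bump_other i (hJsub t ht i hi) e h1 t' (Finset.mem_union_right _ hf)
          (hJdisj t' ht' t ht htt t' (by simp [hJf t' hT']) i hi)
    · by_cases hT' : t' ∈ T
      · right
        intro y hy
        have := hTsep t hT t' hT' htt.symm _ hp y hy
        simp only
        omega
      · have hf := (Finset.mem_union.1 ht').resolve_left hT'
        exact Or.inl ⟨hf, by rw [hitf t' hT']; exact hfrlt t' hf⟩
  · intro t ht t' ht' e he e' he' hee
    rcases hbumps t e he with h1 | ⟨hT, rfl, hp, hball⟩ <;>
      rcases hbumps t' e' he' with h2 | ⟨hT', rfl, hp', hball'⟩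
    · obtain ⟨i, hi, h1⟩ := h1
      obtain ⟨i', hi', h2⟩ := h2
      exact (h.bump_sep i (hJsub t ht i hi) i' (hJsub t' ht' i' hi') e h1 e' h2 hee).imp
        (hbs _ _) (hbs _ _)
    · exact Or.inl (hnewold t' hT' hp' hball' t ht e he h1)
    · exact Or.inr (hnewold t hT hp hball t' ht' e' he' h2)
    · have htt : t ≠ t' := fun hh => hee (by rw [hh])
      have := hTsep t hT t' hT' htt _ hp _ hp'
      refine Or.inl (Or.inl ?_)
      simp only
      omega
  · exact Finset.disjoint_of_subset_left hTac h.disj_idx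
  · intro t ht
    rw [hitT t ht]
    exact (hX t ht).1
  · intro f hf
    rw [hitf f (hTfz f hf)]
    exact h.frozen_lt f hf
  · exact fun f hf => hitf f (hTfz f hf)
  · intro t ht
    rw [hitT t ht]
    exact ⟨(hX t ht).2.2.1, (hX t ht).2.2.2.1⟩

/-- The products of cosine factors of the states at scale `k`. -/
def stateProducts {V : Type*} [Fintype V] [DecidableEq V] (G : SimpleGraph V) (γ s C : ℝ) (k : ℕ) :
    Set (AddMonoidAlgebra ℝ (V → ℤ)) :=
  {F | ∃ ac fz it, IsState G γ s C k k ac fz it ∧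
    F = ∏ i ∈ ac ∪ fz, cosFactor (it i).activity (it i).density}

/-- Only the active factors are expanded. The product of the frozen factors is a fixed multiplier,
and multiplication by it is linear, so it maps convex hulls to convex hulls. -/
theorem stateProducts_subset_convexHull {V : Type*} [Fintype V] [DecidableEq V]
    {G : SimpleGraph V} (hG : G.Connected) {M : ℕ} (hM : HasPacking G M) {γ s C : ℝ} (k : ℕ)
    (hC : C = (1 + M) * Real.log 4) (hs : 4 * C ≤ s) (hγ : s + C ≤ γ) :
    stateProducts G γ s C k ⊆ convexHull ℝ (stateProducts G γ s C (k + 1)) := by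
  classical
  rintro F ⟨ac₀, fz₀, it, h₀, rfl⟩
  have hC0 : 0 ≤ C := by rw [hC]; have := Real.log_nonneg (by norm_num : (1 : ℝ) ≤ 4); positivity
  obtain ⟨ac, fz, hun, h⟩ := h₀.freeze hC0 hs
  rw [← hun, Finset.prod_union h.disj_idx]
  have hmem := prod_cosFactor_mem_convexHull ac (r := NearBy G k it)
    (fun i i' ⟨y, hy, y', hy', hd⟩ => ⟨y', hy', y, hy, by rwa [G.dist_comm]⟩)
    (fun i => (it i).density) (fun i => (it i).activity)
  set Pf := ∏ i ∈ fz, cosFactor (it i).activity (it i).density with hPf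
  have himg := Set.mem_image_of_mem (LinearMap.mulRight ℝ Pf) hmem
  rw [LinearMap.image_convexHull] at himg
  refine convexHull_mono ?_ himg
  rintro _ ⟨_, ⟨T, I, ρ, K, hcl, rfl⟩, rfl⟩
  obtain ⟨it', h', hf, hT⟩ := h.merge hG hM hC hs hγ hcl
  refine ⟨T, fz, it', h', ?_⟩
  rw [Finset.prod_union h'.disj_idx, LinearMap.mulRight_apply, hPf]
  congr 1
  · exact Finset.prod_congr rfl fun t ht => by rw [(hT t ht).1, (hT t ht).2]
  · exact Finset.prod_congr rfl fun f hf' => by rw [hf f hf']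

theorem convexHull_stateProducts_subset {V : Type*} [Fintype V] [DecidableEq V]
    {G : SimpleGraph V} (hG : G.Connected) {M : ℕ} (hM : HasPacking G M) {γ s C : ℝ}
    (hC : C = (1 + M) * Real.log 4) (hs : 4 * C ≤ s) (hγ : s + C ≤ γ) (k : ℕ) :
    stateProducts G γ s C 0 ⊆ convexHull ℝ (stateProducts G γ s C k) := by
  induction k with
  | zero => exact subset_convexHull ℝ _
  | succ k ih => exact ih.trans (convexHull_min
      (stateProducts_subset_convexHull hG hM k hC hs hγ) (convex_convexHull ℝ _))

/-! ### The first and the last scale -/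

/-- The products over networks of frozen clusters, up to a factor which is trivial or charged. -/
def networkProducts {V : Type*} [Fintype V] [DecidableEq V] (G : SimpleGraph V) (γ s : ℝ) :
    Set (AddMonoidAlgebra ℝ (V → ℤ)) :=
  {F | ∃ N it K ρ, IsNetwork G γ s N N it ∧ (K = 0 ∨ ∑ y, ρ y ≠ 0) ∧
    F = (∏ i ∈ N, cosFactor (it i).activity (it i).density) * cosFactor K ρ}

theorem cosFactor_zero {Γ : Type*} [AddCommGroup Γ] (ρ : Γ) : cosFactor 0 ρ = 1 := by
  simp [cosFactor]

theorem IsNetwork.restrict {V : Type*} [Fintype V] [DecidableEq V] {G : SimpleGraph V} {γ s : ℝ}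
    {N fz : Finset V} {it : V → Cluster V} (h : IsNetwork G γ s N fz it) :
    IsNetwork G γ s fz fz it :=
  ⟨subset_rfl, h.frozen, fun i hi i' hi' => h.disj i (h.subset hi) i' (h.subset hi'), h.frozen_sep,
    fun i hi e he i' hi' => h.bump_other i (h.subset hi) e he i' (h.subset hi'),
    fun i hi i' hi' => h.bump_sep i (h.subset hi) i' (h.subset hi')⟩

/-- Beyond the diameter two active clusters cannot be separated, so at most one is left. If neutral,
it joins the frozen ones with birth scale `k`; if charged, it becomes the extra factor. -/
theorem IsState.prod_mem_networkProducts {V : Type*} [Fintype V] [DecidableEq V]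
    {G : SimpleGraph V} {γ s C : ℝ} {k : ℕ} {ac fz : Finset V}
    {it : V → Cluster V} (h : IsState G γ s C k (k + 1) ac fz it) (hC : 0 ≤ C) (hs : 4 * C ≤ s)
    (hdiam : ∀ x y, G.dist x y < scale k) :
    ∏ i ∈ ac ∪ fz, cosFactor (it i).activity (it i).density ∈ networkProducts G γ s := by
  have hle : ac.card ≤ 1 := by
    rw [Finset.card_le_one]
    intro i hi i' hi'
    by_contra hne
    obtain ⟨y, hy⟩ := (h.active i hi).cover_nonempty
    obtain ⟨y', hy'⟩ := (h.active i' hi').cover_nonempty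
    have := h.sep i hi i' hi' hne y ((h.active i hi).cover_subset hy) y'
      ((h.active i' hi').cover_subset hy')
    exact absurd (hdiam y y') (not_lt.2 this)
  have hs0 : 0 ≤ s := by linarith
  rcases Nat.lt_or_ge ac.card 1 with h0 | h1
  · have hac : ac = ∅ := Finset.card_eq_zero.1 (by omega)
    refine ⟨fz, it, 0, 0, h.toIsNetwork.restrict, Or.inl rfl, ?_⟩
    rw [cosFactor_zero, mul_one, hac, Finset.empty_union]
  · obtain ⟨i, rfl⟩ := Finset.card_eq_one.1 (le_antisymm hle h1)
    have hifz : i ∉ fz := Finset.disjoint_singleton_left.1 h.disj_idx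
    have ha := h.active i (Finset.mem_singleton_self i)
    by_cases hch : ∑ y, (it i).density y = 0
    · obtain ⟨p, hp⟩ := ha.cover_nonempty
      let x : Cluster V := { it i with center := p, birth := k }
      let it' := Function.update it i x
      have hfz : ∀ f ∈ fz, it' f = it f := fun f hf =>
        Function.update_of_ne (fun hh : f = i => hifz (hh ▸ hf)) _ _
      have hi' : it' i = x := Function.update_self _ _ _
      have hsites : ∀ f, (it' f).sites = (it f).sites := by
        intro f
        by_cases hf : f = i
        · subst hf; rw [hi']
        · rw [show it' f = it f from Function.update_of_ne hf _ _]
      have hbumps : ∀ f, (it' f).bumps = (it f).bumps := by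
        intro f
        by_cases hf : f = i
        · subst hf; rw [hi']
        · rw [show it' f = it f from Function.update_of_ne hf _ _]
      have hx : IsFrozen G γ s x := by
        refine ⟨⟨ha.supp, ha.mem, ha.iso, ha.charge⟩, ha.cover_subset hp, hch, ?_, ha.bump_lt, ?_⟩
        · intro y _
          have := hdiam p y
          change G.dist p y ≤ 2 * scale k
          omega
        · change (it i).weight γ ≤ Real.exp (-(s * (k + 100)))
          refine (ha.weight_le hC hs).trans (Real.exp_le_exp.2 ?_)
          have : (1 : ℝ) ≤ (it i).cover.card := by exact_mod_cast ha.cover_nonempty.card_pos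
          nlinarith
      have hbs : ∀ e e', BumpSep G fz it e e' → BumpSep G ({i} ∪ fz) it' e e' := by
        rintro e e' (h1 | h1 | ⟨f, hf, h1⟩)
        · exact Or.inl h1
        · exact Or.inr (Or.inl h1)
        · exact Or.inr (Or.inr ⟨f, Finset.mem_union_right _ hf, by rw [hfz f hf]; exact h1⟩)
      -- Frozen clusters are born well before `k`, so the separation at equal birth scales is
      -- vacuous for the added one.
      have hbirth : ∀ f ∈ fz, (it f).birth ≠ k := by
        intro f hf hh
        have := h.frozen_lt f hf
        rw [hh] at this
        unfold freezeTime at this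
        omega
      refine ⟨{i} ∪ fz, it', 0, 0, ⟨subset_rfl, ?_, ?_, ?_, ?_, ?_⟩, Or.inl rfl, ?_⟩
      · intro f hf
        rcases Finset.mem_union.1 hf with h1 | h1
        · rw [Finset.mem_singleton.1 h1, hi']; exact hx
        · rw [hfz f h1]; exact h.frozen f h1
      · simp only [hsites]; exact h.disj
      · intro f hf f' hf' hne hb
        rcases Finset.mem_union.1 hf with h1 | h1 <;> rcases Finset.mem_union.1 hf' with h2 | h2
        · exact absurd ((Finset.mem_singleton.1 h1).trans (Finset.mem_singleton.1 h2).symm) hne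
        · rw [Finset.mem_singleton.1 h1, hi', hfz f' h2] at hb
          exact absurd hb.symm (hbirth f' h2)
        · rw [Finset.mem_singleton.1 h2, hi', hfz f h1] at hb
          exact absurd hb (hbirth f h1)
        · rw [hfz f h1, hfz f' h2] at *
          exact h.frozen_sep f h1 f' h2 hne hb
      · intro f hf e he f' hf' hne
        rw [hbumps] at he
        rw [hsites]
        rcases h.bump_other f hf e he f' hf' hne with h1 | h1
        · exact Or.inl ⟨hf', by rw [hfz f' h1.1]; exact h1.2⟩
        · exact Or.inr h1
      · intro f hf f' hf' e he e' he' hee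
        rw [hbumps] at he he'
        exact (h.bump_sep f hf f' hf' e he e' he' hee).imp (hbs _ _) (hbs _ _)
      · rw [cosFactor_zero, mul_one]
        refine Finset.prod_congr rfl fun f _ => ?_
        by_cases hf : f = i
        · subst hf; rw [hi']
        · rw [show it' f = it f from Function.update_of_ne hf _ _]
    · refine ⟨fz, it, (it i).activity, (it i).density, h.toIsNetwork.restrict, Or.inr hch, ?_⟩
      rw [Finset.prod_union h.disj_idx, Finset.prod_singleton, mul_comm]

theorem stateProducts_zero_subset {V : Type*} [Fintype V] [DecidableEq V]
    {G : SimpleGraph V} (hG : G.Connected) {M : ℕ} (hM : HasPacking G M) {γ s C : ℝ}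
    (hC : C = (1 + M) * Real.log 4) (hs : 4 * C ≤ s) (hγ : s + C ≤ γ) :
    stateProducts G γ s C 0 ⊆ convexHull ℝ (networkProducts G γ s) := by
  have hC0 : 0 ≤ C := by rw [hC]; have := Real.log_nonneg (by norm_num : (1 : ℝ) ≤ 4); positivity
  obtain ⟨k, hk⟩ : ∃ k, ∀ x y, G.dist x y < scale k := by
    refine ⟨Finset.univ.sup fun z : V × V => G.dist z.1 z.2, fun x y => ?_⟩
    refine lt_of_le_of_lt (Finset.le_sup (f := fun z : V × V => G.dist z.1 z.2)
      (Finset.mem_univ (x, y))) (Nat.lt_pow_self (by norm_num))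
  refine (convexHull_stateProducts_subset hG hM hC hs hγ k).trans (convexHull_mono ?_)
  rintro F ⟨ac₀, fz₀, it, h₀, rfl⟩
  obtain ⟨ac, fz, hun, h⟩ := h₀.freeze hC0 hs
  rw [← hun]
  exact h.prod_mem_networkProducts hC0 hs hk

/-- The cluster consisting of a single charged site. -/
def siteCluster {V : Type*} [DecidableEq V] (x : V) (n : ℤ) (K : ℝ) : Cluster V where
  sites := {x}
  density := Pi.single x n
  activity := K
  bumps := ∅
  cover := {x}
  center := x
  birth := 0

/-- At scale `128 ^ 0 = 1` distinct sites are separated automatically. All charges are nonzero, so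
there are no neutral clusters to begin with. -/
theorem prod_siteCluster_mem {V : Type*} [Fintype V] [DecidableEq V] (G : SimpleGraph V)
    (hG : G.Connected) (γ s C : ℝ) (A : Finset V) (n : V → ℤ) (K : V → ℝ)
    (hn : ∀ x ∈ A, n x ≠ 0) (hK : ∀ x ∈ A, |K x| * Real.exp |(n x : ℝ)| ≤ Real.exp (-(s * 100))) :
    ∏ x ∈ A, cosFactor (K x) (Pi.single x (n x) : V → ℤ) ∈ stateProducts G γ s C 0 := by
  refine ⟨A, ∅, fun x => siteCluster x (n x) (K x), ⟨⟨by simp, by simp, ?_, by simp, ?_, ?_⟩,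
    by simp, ?_, by simp, ?_⟩, by simp [siteCluster]⟩
  · intro i _ i' _ hii
    simpa [siteCluster] using hii
  · intro i _ e he
    simp [siteCluster] at he
  · intro i _ i' _ e he
    simp [siteCluster] at he
  · intro x hx
    have hch : ∑ y, (Pi.single x (n x) : V → ℤ) y = n x := Finset.sum_pi_single' x (n x) _ |>.trans
      (by simp)
    have hw : (siteCluster x (n x) (K x)).weight γ ≤ Real.exp (-(s * 100)) := by
      have h1 : ∑ y, |((Pi.single x (n x) : V → ℤ) y : ℝ)| = |(n x : ℝ)| := by
        rw [Finset.sum_eq_single x] <;> simp +contextual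
      simpa [Cluster.weight, siteCluster, h1] using hK x hx
    refine ⟨⟨?_, ?_, ?_, ?_⟩, ?_, ?_, ?_, ?_, ?_, ?_, ?_, ?_, ?_⟩
    · intro y hy
      by_contra hne
      simp only [siteCluster, Finset.mem_singleton] at hne hy
      exact hy (Pi.single_eq_of_ne hne _)
    · simp [siteCluster]
    · simp [siteCluster]
    · simp [siteCluster]
    · simp [siteCluster]
    · simp [siteCluster]
    · simp [siteCluster]
    · exact CutConnected.singleton _ _
    · simp [siteCluster]
    · intro h; simp [siteCluster] at h
    · simp [siteCluster]
    · intro _ _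
      simpa using hw
    · intro _ h0
      exact absurd (hch.symm.trans h0) (hn x hx)
  · intro i _ i' _ hii y hy y' hy'
    simp only [siteCluster, Finset.mem_singleton] at hy hy'
    rw [hy, hy']
    exact Nat.succ_le_of_lt ((hG.preconnected i i').pos_dist_of_ne hii)

/-- The generating function of the integer charges at `x` with Gaussian weights, truncated at `m`. -/
noncomputable def truncatedSite {V : Type*} [DecidableEq V] (κ : ℝ) (m : ℕ) (x : V) :
    AddMonoidAlgebra ℝ (V → ℤ) :=
  1 + ∑ n ∈ Finset.Icc 1 m, (AddMonoidAlgebra.single (Pi.single x (n : ℤ)) (Real.exp (-(κ * n ^ 2))) +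
    AddMonoidAlgebra.single (-Pi.single x (n : ℤ)) (Real.exp (-(κ * n ^ 2))))

theorem sum_half_pow (m : ℕ) : ∑ n ∈ Finset.Icc 1 m, (1 / 2 : ℝ) ^ n = 1 - (1 / 2) ^ m := by
  induction m with
  | zero => simp
  | succ m ih => rw [Finset.sum_Icc_succ_top (by omega), ih]; ring

/-- A convex decomposition of the site factor: charge `n` is given probability 2^(-n) and its
coefficient is enlarged by 2^n in compensation. The remaining probability 2^(-m) goes to the trivial
factor. -/
theorem truncatedSite_eq {V : Type*} [DecidableEq V] (κ : ℝ) (m : ℕ) (x : V) :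
    truncatedSite κ m x = ∑ n ∈ Finset.range (m + 1),
      (if n = 0 then (1 / 2 : ℝ) ^ m else (1 / 2) ^ n) •
        (if n = 0 then (1 : AddMonoidAlgebra ℝ (V → ℤ)) else
          cosFactor (2 ^ (n + 1) * Real.exp (-(κ * n ^ 2))) (Pi.single x (n : ℤ))) := by
  rw [Finset.sum_range_succ', if_pos rfl, if_pos rfl]
  have h1 : ∑ n ∈ Finset.range m, (if n + 1 = 0 then (1 / 2 : ℝ) ^ m else (1 / 2) ^ (n + 1)) •
        (if n + 1 = 0 then (1 : AddMonoidAlgebra ℝ (V → ℤ)) else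
          cosFactor (2 ^ (n + 1 + 1) * Real.exp (-(κ * (n + 1 : ℕ) ^ 2)))
            (Pi.single x ((n + 1 : ℕ) : ℤ))) =
      ∑ n ∈ Finset.Icc 1 m, (1 / 2 : ℝ) ^ n •
          cosFactor (2 ^ (n + 1) * Real.exp (-(κ * n ^ 2))) (Pi.single x (n : ℤ)) := by
    rw [Finset.range_eq_Ico, Finset.sum_Ico_add' (fun n => (if n = 0 then (1 / 2 : ℝ) ^ m else
      (1 / 2) ^ n) • (if n = 0 then (1 : AddMonoidAlgebra ℝ (V → ℤ)) else
          cosFactor (2 ^ (n + 1) * Real.exp (-(κ * (n : ℕ) ^ 2))) (Pi.single x (n : ℤ)))) 0 m 1]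
    refine Finset.sum_congr (by ext n; simp) fun n hn => ?_
    have : n ≠ 0 := by have := (Finset.mem_Icc.1 hn).1; omega
    rw [if_neg this, if_neg this]
  rw [h1]
  have h2 : ∀ n : ℕ, (1 / 2 : ℝ) ^ n •
      cosFactor (2 ^ (n + 1) * Real.exp (-(κ * n ^ 2))) (Pi.single x (n : ℤ) : V → ℤ) =
      (1 / 2 : ℝ) ^ n • (1 : AddMonoidAlgebra ℝ (V → ℤ)) +
        (AddMonoidAlgebra.single (Pi.single x (n : ℤ)) (Real.exp (-(κ * n ^ 2))) +
          AddMonoidAlgebra.single (-Pi.single x (n : ℤ)) (Real.exp (-(κ * n ^ 2)))) := by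
    intro n
    have h3 : (1 / 2 : ℝ) ^ n * (2 ^ (n + 1) * Real.exp (-(κ * n ^ 2)) / 2) =
        Real.exp (-(κ * n ^ 2)) := by
      rw [pow_succ, div_pow, one_pow]; field_simp
    simp only [cosFactor, smul_add, AddMonoidAlgebra.smul_single, smul_eq_mul, h3, add_assoc]
  simp only [h2, Finset.sum_add_distrib, ← Finset.sum_smul, sum_half_pow]
  rw [truncatedSite, Finset.sum_add_distrib]
  module

/-- Expanding the product chooses a charge independently at each site, with product probabilities.
The Gaussian self-energy beats the enlargement 2^(n+1) and the factor exp(n) in the initial weight.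
-/
theorem prod_truncatedSite_mem {V : Type*} [Fintype V] [DecidableEq V] (G : SimpleGraph V)
    (hG : G.Connected) (γ s C κ : ℝ) (m : ℕ)
    (hκ : ∀ n : ℕ, 1 ≤ n → 2 ^ (n + 1) * Real.exp (-(κ * n ^ 2)) * Real.exp n ≤
      Real.exp (-(s * 100))) :
    ∏ x, truncatedSite κ m x ∈ convexHull ℝ (stateProducts G γ s C 0) := by
  simp only [truncatedSite_eq]
  rw [Finset.prod_univ_sum]
  simp only [Finset.prod_smul]
  refine (convex_convexHull ℝ _).sum_mem (fun p _ => Finset.prod_nonneg fun x _ => ?_) ?_ ?_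
  · split_ifs <;> positivity
  · rw [← Finset.prod_univ_sum (t := fun _ : V => Finset.range (m + 1))
      (f := fun _ n => if n = 0 then (1 / 2 : ℝ) ^ m else (1 / 2) ^ n)]
    refine Finset.prod_eq_one fun x _ => ?_
    rw [Finset.sum_range_succ', if_pos rfl]
    have h1 : ∀ m : ℕ, ∑ n ∈ Finset.range m, (1 / 2 : ℝ) ^ (n + 1) = 1 - (1 / 2) ^ m := by
      intro m
      induction m with
      | zero => simp
      | succ m ih => rw [Finset.sum_range_succ, ih]; ring
    simp only [Nat.add_eq_zero_iff, one_ne_zero, and_false, if_false]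
    rw [h1]; ring
  · intro p _
    refine subset_convexHull ℝ _ ?_
    have h1 : ∏ x, (if p x = 0 then (1 : AddMonoidAlgebra ℝ (V → ℤ)) else
        cosFactor (2 ^ (p x + 1) * Real.exp (-(κ * p x ^ 2))) (Pi.single x (p x : ℤ))) =
        ∏ x with p x ≠ 0,
          cosFactor (2 ^ (p x + 1) * Real.exp (-(κ * p x ^ 2))) (Pi.single x (p x : ℤ)) := by
      rw [Finset.prod_filter]
      exact Finset.prod_congr rfl fun x _ => by by_cases h : p x = 0 <;> simp [h]
    rw [h1]
    refine prod_siteCluster_mem G hG γ s C _ (fun x => (p x : ℤ)) _ ?_ ?_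
    · intro x hx; simpa using hx
    · intro x hx
      have h2 := hκ (p x) (Nat.one_le_iff_ne_zero.2 (by simpa using hx))
      rw [abs_of_nonneg (by positivity)]
      simpa using h2

/-! ### The Dirichlet form -/

open Classical in
/-- The Dirichlet form `∑_{j ∼ ℓ} (a_j - a_ℓ) (b_j - b_ℓ)`, each edge being counted once. -/
noncomputable def dirForm {V : Type*} [Fintype V] (G : SimpleGraph V) (a b : V → ℝ) : ℝ :=
  (∑ z : V × V with G.Adj z.1 z.2, (a z.1 - a z.2) * (b z.1 - b z.2)) / 2

theorem dirForm_self_nonneg {V : Type*} [Fintype V] (G : SimpleGraph V) (a : V → ℝ) :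
    0 ≤ dirForm G a a :=
  div_nonneg (Finset.sum_nonneg fun z _ => mul_self_nonneg _) (by norm_num)

theorem dirForm_sq_le {V : Type*} [Fintype V] (G : SimpleGraph V) (a b : V → ℝ) :
    dirForm G a b ^ 2 ≤ dirForm G a a * dirForm G b b := by
  classical
  have h := Finset.sum_mul_sq_le_sq_mul_sq
    (Finset.univ.filter fun z : V × V => G.Adj z.1 z.2) (fun z => a z.1 - a z.2)
    (fun z => b z.1 - b z.2)
  simp only [dirForm, ← sq]
  rw [div_pow, div_mul_div_comm]
  norm_num
  gcongr

theorem pairing_neg_laplacian {V : Type*} [Fintype V] (G : SimpleGraph V) (h a : V → ℝ) :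
    pairing (-(graphLaplacian G h)) a = dirForm G h a := by
  classical
  have h1 : ∀ f : V → V → ℝ, ∑ z : V × V with G.Adj z.1 z.2, f z.1 z.2 =
      ∑ x, ∑ y, if G.Adj x y then f x y else 0 := fun f => by
    rw [Finset.sum_filter, Fintype.sum_prod_type]
  have h2 : pairing (-(graphLaplacian G h)) a =
      ∑ x, ∑ y, if G.Adj x y then (h x - h y) * a x else 0 := by
    simp only [pairing, graphLaplacian, Pi.neg_apply, LinearMap.coe_mk, AddHom.coe_mk]
    refine Finset.sum_congr rfl fun x _ => ?_
    rw [Finset.sum_filter, ← Finset.sum_neg_distrib, Finset.sum_mul]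
    refine Finset.sum_congr rfl fun y _ => ?_
    split_ifs <;> ring
  have h3 : pairing (-(graphLaplacian G h)) a =
      ∑ x, ∑ y, if G.Adj x y then -((h x - h y) * a y) else 0 := by
    rw [h2, Finset.sum_comm]
    refine Finset.sum_congr rfl fun x _ => Finset.sum_congr rfl fun y _ => ?_
    simp only [G.adj_comm y x]
    split_ifs <;> ring
  have h4 : dirForm G h a = (pairing (-(graphLaplacian G h)) a +
      pairing (-(graphLaplacian G h)) a) / 2 := by
    nth_rewrite 2 [h3]
    rw [h2, dirForm, ← Finset.sum_add_distrib]
    congr 1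
    convert h1 (fun x y => (h x - h y) * (a x - a y)) using 1
    refine Finset.sum_congr rfl fun x _ => ?_
    rw [← Finset.sum_add_distrib]
    refine Finset.sum_congr rfl fun y _ => ?_
    split_ifs <;> ring
  linarith

/-- The electrostatic energy of a neutral charge density. -/
noncomputable def greenEnergy {V : Type*} [Fintype V] (G : SimpleGraph V) (hG : G.Connected)
    (q : V → ℝ) : ℝ := pairing q (-(laplacianPseudoinverse G hG q))

theorem pairing_eq_dirForm {V : Type*} [Fintype V] (G : SimpleGraph V) (hG : G.Connected)
    {q : V → ℝ} (hq : ∑ x, q x = 0) (a : V → ℝ) :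
    pairing q a = dirForm G (-(laplacianPseudoinverse G hG q)) a := by
  rw [← pairing_neg_laplacian, map_neg, neg_neg,
    (laplacianPseudoinverse_spec G hG).laplacian_apply q hq]

theorem greenEnergy_eq_dirForm {V : Type*} [Fintype V] (G : SimpleGraph V) (hG : G.Connected)
    {q : V → ℝ} (hq : ∑ x, q x = 0) : greenEnergy G hG q =
      dirForm G (-(laplacianPseudoinverse G hG q)) (-(laplacianPseudoinverse G hG q)) :=
  pairing_eq_dirForm G hG hq _

/-- The dual description of the energy: ⟨q, ·⟩ is the Dirichlet form against the potential of `q`,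
to which Cauchy–Schwarz applies. Every lower bound on the energy below is obtained by choosing a
test function. -/
theorem pairing_sq_le {V : Type*} [Fintype V] (G : SimpleGraph V) (hG : G.Connected)
    {q : V → ℝ} (hq : ∑ x, q x = 0) (a : V → ℝ) :
    pairing q a ^ 2 ≤ greenEnergy G hG q * dirForm G a a := by
  rw [greenEnergy_eq_dirForm G hG hq, pairing_eq_dirForm G hG hq]
  exact dirForm_sq_le _ _ _

theorem greenEnergy_nonneg {V : Type*} [Fintype V] (G : SimpleGraph V) (hG : G.Connected)
    {q : V → ℝ} (hq : ∑ x, q x = 0) : 0 ≤ greenEnergy G hG q := by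
  rw [greenEnergy_eq_dirForm G hG hq]
  exact dirForm_self_nonneg _ _

/-- The test function is the charge density itself. -/
theorem pairing_self_le_greenEnergy {V : Type*} [Fintype V] {G : SimpleGraph V} (hG : G.Connected)
    (hdeg : ∀ q : V → ℝ, dirForm G q q ≤ 8 * pairing q q) {q : V → ℝ} (hq : ∑ x, q x = 0) :
    pairing q q ≤ 8 * greenEnergy G hG q := by
  have h3 := pairing_sq_le G hG hq q
  have h4 := hdeg q
  have h5 := greenEnergy_nonneg G hG hq
  have h6 : 0 ≤ pairing q q := Finset.sum_nonneg fun x _ => mul_self_nonneg _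
  rcases h6.eq_or_lt with h0 | h0
  · rw [← h0]; positivity
  · have : pairing q q * pairing q q ≤ pairing q q * (8 * greenEnergy G hG q) := by nlinarith
    exact le_of_mul_le_mul_left this h0

/-! ### Cutoff functions of a network -/

open Classical in
/-- The number of edges in a ball grows at most quadratically. -/
def HasVolumeGrowth {V : Type*} [Fintype V] (G : SimpleGraph V) (M : ℝ) : Prop :=
  ∀ (k : ℕ) (p : V), ((Finset.univ.filter fun z : V × V =>
    G.Adj z.1 z.2 ∧ G.dist p z.1 ≤ 32 * scale k).card : ℝ) ≤ M * (scale k : ℝ) ^ 2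

theorem Finset.sq_sum_of_pairwise {ι : Type*} (s : Finset ι) (f : ι → ℝ)
    (h : ∀ i ∈ s, ∀ j ∈ s, i ≠ j → f i = 0 ∨ f j = 0) : (∑ i ∈ s, f i) ^ 2 = ∑ i ∈ s, f i ^ 2 := by
  classical
  by_cases hex : ∃ i ∈ s, f i ≠ 0
  · obtain ⟨i, hi, hfi⟩ := hex
    have h0 : ∀ j ∈ s, j ≠ i → f j = 0 := fun j hj hji => (h j hj i hi hji).resolve_right hfi
    rw [Finset.sum_eq_single_of_mem i hi h0, Finset.sum_eq_single_of_mem i hi]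
    intro j hj hji
    rw [h0 j hj hji]; norm_num
  · push Not at hex
    rw [Finset.sum_eq_zero hex, Finset.sum_eq_zero fun i hi => by rw [hex i hi]; norm_num]
    norm_num

/-- The test function is ∑⟨q, a_e⟩a_e: its pairing with `q` is the sum S on the left, and because at
most one gradient is nonzero on each edge, its Dirichlet energy is at most M·S. -/
theorem sum_pairing_sq_le {V ι : Type*} [Fintype V] (G : SimpleGraph V) (hG : G.Connected)
    (E : Finset ι) (a : ι → V → ℝ) {M : ℝ} (hM0 : 0 ≤ M)
    (hM : ∀ e ∈ E, dirForm G (a e) (a e) ≤ M)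
    (hdisj : ∀ e ∈ E, ∀ e' ∈ E, e ≠ e' → ∀ x y, G.Adj x y → a e x = a e y ∨ a e' x = a e' y)
    {q : V → ℝ} (hq : ∑ x, q x = 0) :
    ∑ e ∈ E, pairing q (a e) ^ 2 ≤ M * greenEnergy G hG q := by
  classical
  set S := ∑ e ∈ E, pairing q (a e) ^ 2 with hS
  set A : V → ℝ := fun x => ∑ e ∈ E, pairing q (a e) * a e x with hA
  have h1 : pairing q A = S := by
    simp only [hS, sq, hA, pairing, Finset.mul_sum]
    rw [Finset.sum_comm]
    refine Finset.sum_congr rfl fun e _ => Finset.sum_congr rfl fun x _ => by ring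
  have h2 : dirForm G A A = ∑ e ∈ E, pairing q (a e) ^ 2 * dirForm G (a e) (a e) := by
    simp only [dirForm, ← mul_div_assoc, ← Finset.sum_div]
    congr 1
    simp only [Finset.mul_sum]
    rw [Finset.sum_comm]
    refine Finset.sum_congr rfl fun z hz => ?_
    have hz' := (Finset.mem_filter.1 hz).2
    have h3 : A z.1 - A z.2 = ∑ e ∈ E, pairing q (a e) * (a e z.1 - a e z.2) := by
      simp only [hA, mul_sub, Finset.sum_sub_distrib]
    rw [h3, ← sq, Finset.sq_sum_of_pairwise]
    · exact Finset.sum_congr rfl fun e _ => by ring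
    · intro e he e' he' hee
      rcases hdisj e he e' he' hee z.1 z.2 hz' with h4 | h4
      · left; rw [h4]; ring
      · right; rw [h4]; ring
  have hS0 : 0 ≤ S := Finset.sum_nonneg fun e _ => sq_nonneg _
  have h3 : dirForm G A A ≤ M * S := by
    rw [h2, hS, Finset.mul_sum]
    refine Finset.sum_le_sum fun e he => ?_
    rw [mul_comm]
    exact mul_le_mul_of_nonneg_right (hM e he) (sq_nonneg _)
  have hg := greenEnergy_nonneg G hG hq
  have h4 := pairing_sq_le G hG hq A
  rw [h1] at h4
  have h5 : S * S ≤ S * (M * greenEnergy G hG q) := by nlinarith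
  rcases hS0.eq_or_lt with h0 | h0
  · rw [← h0]; exact mul_nonneg hM0 hg
  · exact le_of_mul_le_mul_left h5 h0

/-- The cutoff functions of the bumps of a network: each sees only the cluster owning it, and their
gradients are disjoint. -/
theorem IsNetwork.exists_cutoffs {V : Type*} [Fintype V] [DecidableEq V] {G : SimpleGraph V}
    (hG : G.Connected) {M : ℝ} (hM : HasVolumeGrowth G M) {γ s : ℝ} {N : Finset V}
    {it : V → Cluster V} (h : IsNetwork G γ s N N it) :
    ∃ a : V × ℕ → V → ℝ,
      (∀ i ∈ N, ∀ e ∈ (it i).bumps, 1 ≤ pairing (fun y => ((it i).density y : ℝ)) (a e) ^ 2) ∧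
      (∀ i ∈ N, ∀ e ∈ (it i).bumps, ∀ i' ∈ N, i' ≠ i →
        pairing (fun y => ((it i').density y : ℝ)) (a e) = 0) ∧
      ∀ q : V → ℝ, ∑ x, q x = 0 →
        ∑ i ∈ N, ∑ e ∈ (it i).bumps, pairing q (a e) ^ 2 ≤ M * greenEnergy G hG q := by
  classical
  have hex := fun e : V × ℕ => exists_cutoff hG N (fun i => (it i).center) (fun i => (it i).birth)
    h.frozen_sep e.1 e.2
  choose a ha1 ha0 hlip hconst using hex
  have hnear : ∀ e x y, G.Adj x y → a e x ≠ a e y → G.dist e.1 x ≤ 32 * scale e.2 ∧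
      G.dist e.1 y ≤ 32 * scale e.2 := by
    intro e x y hxy hne
    have hd : G.dist x y = 1 := SimpleGraph.dist_eq_one_iff_adj.2 hxy
    have t1 := hG.dist_triangle (u := e.1) (v := x) (w := y)
    have t2 := hG.dist_triangle (u := e.1) (v := y) (w := x)
    rw [G.dist_comm (u := y) (v := x)] at t2
    by_cases hx : 32 * scale e.2 ≤ G.dist e.1 x
    · have hy : ¬ 32 * scale e.2 ≤ G.dist e.1 y := fun hy =>
        hne ((ha0 e x hx).trans (ha0 e y hy).symm)
      omega
    · omega
  -- The gradient of the first cutoff lives in its ball of radius 32 scales. There the second cutoff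
  -- has vanishing gradient, by distance, as part of its plateau, or by flatness on a frozen ball.
  have hgrad : ∀ e e', BumpSep G N it e e' → ∀ x y, G.Adj x y → a e x = a e y ∨ a e' x = a e' y := by
    intro e e' hs x y hxy
    by_contra hcon
    push Not at hcon
    obtain ⟨n1, n2⟩ := hnear e x y hxy hcon.1
    obtain ⟨n1', n2'⟩ := hnear e' x y hxy hcon.2
    rcases hs with h1 | h1 | ⟨f, hf, h1, h2⟩
    · have := hG.dist_triangle (u := e.1) (v := x) (w := e'.1)
      rw [G.dist_comm (u := x) (v := e'.1)] at this
      omega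
    · exact hcon.2 ((ha1 e' x (h1 x n1)).trans (ha1 e' y (h1 y n2)).symm)
    · exact hcon.2 (hconst e' f hf h1 x y (h2 x n1) (h2 y n2))
  have hM0 : ∀ p : V, 0 ≤ M := fun p => by
    have := (Nat.cast_nonneg _).trans (hM 0 p)
    simpa [scale] using this
  -- Two dimensions enter here: gradients of size 1/ℓ on at most Mℓ² edges have energy bounded
  -- independently of ℓ.
  have hdir : ∀ e, dirForm G (a e) (a e) ≤ M := by
    intro e
    have hℓ : (0 : ℝ) < scale e.2 := by exact_mod_cast scale_pos e.2
    have h1 : ∑ z : V × V with G.Adj z.1 z.2, (a e z.1 - a e z.2) * (a e z.1 - a e z.2) ≤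
        ∑ z : V × V with G.Adj z.1 z.2 ∧ G.dist e.1 z.1 ≤ 32 * scale e.2,
          (1 / (scale e.2 : ℝ)) ^ 2 := by
      rw [Finset.sum_filter, Finset.sum_filter]
      refine Finset.sum_le_sum fun z _ => ?_
      by_cases hz : G.Adj z.1 z.2
      · by_cases hne : a e z.1 = a e z.2
        · rw [if_pos hz, hne, sub_self, zero_mul]; positivity
        · rw [if_pos hz, if_pos ⟨hz, (hnear e _ _ hz hne).1⟩, ← sq]
          exact sq_le_sq' (by linarith [neg_abs_le (a e z.1 - a e z.2), hlip e _ _ hz])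
            ((le_abs_self _).trans (hlip e _ _ hz))
      · rw [if_neg hz]; positivity
    rw [Finset.sum_const, nsmul_eq_mul] at h1
    have h2 := hM e.2 e.1
    have h3 : ((Finset.univ.filter fun z : V × V =>
        G.Adj z.1 z.2 ∧ G.dist e.1 z.1 ≤ 32 * scale e.2).card : ℝ) * (1 / (scale e.2 : ℝ)) ^ 2 ≤
        M * (scale e.2 : ℝ) ^ 2 * (1 / (scale e.2 : ℝ)) ^ 2 :=
      mul_le_mul_of_nonneg_right (by convert h2) (by positivity)
    have h4 : M * (scale e.2 : ℝ) ^ 2 * (1 / (scale e.2 : ℝ)) ^ 2 = M := by field_simp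
    rw [h4] at h3
    have h5 := hM0 e.1
    unfold dirForm
    have h6 := h1.trans h3
    have h7 : ∑ z : V × V with G.Adj z.1 z.2, (a e z.1 - a e z.2) * (a e z.1 - a e z.2) ≤ 2 * M :=
      by linarith
    rw [div_le_iff₀ (by norm_num)]
    linarith
  refine ⟨a, ?_, ?_, ?_⟩
  · intro i hi e he
    have hf := h.frozen i hi
    have h1 : pairing (fun y => ((it i).density y : ℝ)) (a e) =
        ((∑ y with G.dist e.1 y ≤ 3 * scale e.2, (it i).density y : ℤ) : ℝ) := by
      rw [Finset.sum_filter, pairing]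
      push_cast
      refine Finset.sum_congr rfl fun y _ => ?_
      split_ifs with hy
      · rw [ha1 e y hy, mul_one]
      · by_cases hr : (it i).density y = 0
        · rw [hr]; simp
        · have h2 : 32 * scale e.2 ≤ G.dist e.1 y := by
            by_contra hcon
            exact hy (hf.iso e he y (hf.supp y hr) (not_le.1 hcon))
          rw [ha0 e y h2]; simp
    rw [h1]
    have h2 := hf.charge e he
    -- The cutoff is 1 on the charge inside and 0 on the rest of the cluster, so the pairing is a
    -- nonzero integer.
    have h3 : (1 : ℤ) ≤ (∑ y with G.dist e.1 y ≤ 3 * scale e.2, (it i).density y) ^ 2 :=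
      Int.add_one_le_iff.2 ((sq_nonneg _).lt_of_ne (pow_ne_zero 2 h2).symm)
    exact_mod_cast h3
  · intro i hi e he i' hi' hii
    have hf := h.frozen i' hi'
    rcases h.bump_other i hi e he i' hi' hii with h1 | h1
    -- The cutoff is constant on this frozen cluster, whose total charge is zero.
    · have h2 : ∀ y, ((it i').density y : ℝ) * a e y =
          (it i').density y * a e (it i').center := by
        intro y
        by_cases hr : (it i').density y = 0
        · rw [hr]; simp
        · rw [hconst e i' hi' h1.2 y (it i').center
            ((hf.dist_le y (hf.supp y hr)).trans (by omega)) (by simp)]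
      rw [pairing, Finset.sum_congr rfl fun y _ => h2 y, ← Finset.sum_mul]
      have := hf.neutral
      have h3 : ∑ y, ((it i').density y : ℝ) = 0 := by exact_mod_cast this
      rw [h3, zero_mul]
    · refine Finset.sum_eq_zero fun y _ => ?_
      by_cases hr : (it i').density y = 0
      · simp [hr]
      · rw [ha0 e y (h1 y (hf.supp y hr)), mul_zero]
  · intro q hq
    have hdisj : (N : Set V).PairwiseDisjoint fun i => (it i).bumps := by
      intro i hi i' hi' hii
      change Disjoint (it i).bumps (it i').bumps
      rw [Finset.disjoint_left]
      intro e he he'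
      exact Finset.disjoint_left.1 (h.disj i hi i' hi' hii) ((h.frozen i hi).mem e he)
        ((h.frozen i' hi').mem e he')
    obtain ⟨v⟩ := hG.nonempty
    rw [← Finset.sum_biUnion hdisj]
    refine sum_pairing_sq_le G hG _ a (hM0 v) (fun e _ => hdir e) ?_ hq
    intro e he e' he' hee x y hxy
    obtain ⟨i, hi, he⟩ := Finset.mem_biUnion.1 he
    obtain ⟨i', hi', he'⟩ := Finset.mem_biUnion.1 he'
    rcases h.bump_sep i hi i' hi' e he e' he' hee with h1 | h1
    · exact hgrad e e' h1 x y hxy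
    · exact (hgrad e' e h1 x y hxy).symm

/-! ### Gaussian averages of products of cosine factors -/

/-- The coefficients of `1 + z cos` as a trigonometric polynomial. -/
noncomputable def cosCoeff (z : ℝ) (ε : SignType) : ℝ := if ε = 0 then 1 else z / 2

theorem SignType.sum_univ {R : Type*} [AddCommMonoid R] (f : SignType → R) :
    ∑ ε, f ε = f 0 + (f (-1) + f 1) := by
  rw [SignType.univ_eq, Finset.sum_insert (by decide), Finset.sum_insert (by decide),
    Finset.sum_singleton]

/-- Each factor is a combination of the exponentials with frequencies -1, 0 and 1. All coefficients
are real, so taking real parts of the expanded product leaves cosines. -/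
theorem prod_one_add_mul_cos {ι : Type*} [Fintype ι] [DecidableEq ι] (z t : ι → ℝ) :
    ∏ i, (1 + z i * Real.cos (t i)) =
      ∑ ε : ι → SignType, (∏ i, cosCoeff (z i) (ε i)) * Real.cos (∑ i, (ε i : ℝ) * t i) := by
  have h1 : ∀ i, ((1 + z i * Real.cos (t i) : ℝ) : ℂ) =
      ∑ ε : SignType, (cosCoeff (z i) ε : ℂ) * Complex.exp (((ε : ℝ) * t i : ℝ) * Complex.I) := by
    intro i
    rw [SignType.sum_univ]
    simp only [cosCoeff]
    push_cast
    rw [Complex.cos]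
    simp
    ring
  have h2 : ((∏ i, (1 + z i * Real.cos (t i)) : ℝ) : ℂ) =
      ∑ ε : ι → SignType, ((∏ i, cosCoeff (z i) (ε i) : ℝ) : ℂ) *
        Complex.exp ((∑ i, (ε i : ℝ) * t i : ℝ) * Complex.I) := by
    rw [Complex.ofReal_prod, Finset.prod_congr rfl fun i _ => h1 i, Finset.prod_univ_sum,
      Fintype.piFinset_univ]
    refine Finset.sum_congr rfl fun ε _ => ?_
    rw [Finset.prod_mul_distrib, ← Complex.exp_sum, Complex.ofReal_prod, Complex.ofReal_sum,
      Finset.sum_mul]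
  have h3 := congrArg Complex.re h2
  rw [Complex.ofReal_re, Complex.re_sum] at h3
  rw [h3]
  refine Finset.sum_congr rfl fun ε _ => ?_
  rw [Complex.re_ofReal_mul, Complex.exp_ofReal_mul_I_re]

/-- The Gaussian average of a product of cosine factors, as a finite sum. -/
noncomputable def gaussianCosSum {ι : Type*} [Fintype ι] [DecidableEq ι] (z : ι → ℝ)
    (S : Matrix ι ι ℝ) (θ : ι → ℝ) : ℝ :=
  ∑ ε : ι → SignType, (∏ i, cosCoeff (z i) (ε i)) *
    (Real.exp (-((fun i => (ε i : ℝ)) ⬝ᵥ S.mulVec fun i => (ε i : ℝ)) / 2) *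
      Real.cos (∑ i, (ε i : ℝ) * θ i))

open MeasureTheory ProbabilityTheory in
theorem integral_cos_multivariateGaussian {ι : Type*} [Fintype ι] [DecidableEq ι]
    {S : Matrix ι ι ℝ} (hS : S.PosSemidef) (x : ι → ℝ) (b : ℝ) :
    ∫ y, Real.cos (∑ i, x i * y i + b) ∂(multivariateGaussian 0 S) =
      Real.exp (-(x ⬝ᵥ S.mulVec x) / 2) * Real.cos b := by
  have h := charFun_multivariateGaussian (μ := 0) hS (WithLp.toLp 2 x)
  rw [charFun_apply] at h
  have h1 : ∀ y : EuclideanSpace ℝ ι, Real.cos (∑ i, x i * y i + b) =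
      (Complex.exp (b * Complex.I) *
        Complex.exp ((inner ℝ y (WithLp.toLp 2 x) : ℝ) * Complex.I)).re := by
    intro y
    rw [← Complex.exp_add, ← add_mul, ← Complex.ofReal_add, Complex.exp_ofReal_mul_I_re]
    congr 1
    rw [add_comm]
    congr 1
  have hintegrable : Integrable (fun y : EuclideanSpace ℝ ι => Complex.exp (b * Complex.I) *
      Complex.exp ((inner ℝ y (WithLp.toLp 2 x) : ℝ) * Complex.I)) (multivariateGaussian 0 S) := by
    refine Integrable.of_bound (by fun_prop) 1 (Filter.Eventually.of_forall fun y => ?_)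
    rw [norm_mul, Complex.norm_exp_ofReal_mul_I, Complex.norm_exp_ofReal_mul_I, one_mul]
  simp only [h1]
  have h2 := integral_re (μ := multivariateGaussian 0 S) (𝕜 := ℂ) hintegrable
  simp only [RCLike.re_eq_complex_re] at h2
  rw [h2, integral_const_mul, h]
  simp only [inner_zero_right, Complex.ofReal_zero, zero_mul, zero_sub]
  rw [show -(((x ⬝ᵥ S.mulVec x : ℝ) : ℂ) / 2) = ((-(x ⬝ᵥ S.mulVec x) / 2 : ℝ) : ℂ) by
    push_cast; ring, ← Complex.ofReal_exp, Complex.re_mul_ofReal, Complex.exp_ofReal_mul_I_re,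
    mul_comm]

-- The quadratic exponential is the characteristic function of a Gaussian vector. The sum, with its
-- possibly negative terms, becomes the integral of a product of positive factors when the
-- activities are small.
open MeasureTheory ProbabilityTheory in
theorem gaussianCosSum_eq_integral {ι : Type*} [Fintype ι] [DecidableEq ι] (z : ι → ℝ)
    {S : Matrix ι ι ℝ} (hS : S.PosSemidef) (θ : ι → ℝ) :
    gaussianCosSum z S θ = ∫ y, ∏ i, (1 + z i * Real.cos (y i + θ i)) ∂(multivariateGaussian 0 S) := by
  simp only [prod_one_add_mul_cos]
  have h1 : ∀ (ε : ι → SignType) (y : EuclideanSpace ℝ ι),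
      Real.cos (∑ i, (ε i : ℝ) * (y i + θ i)) =
      Real.cos (∑ i, (ε i : ℝ) * y i + ∑ i, (ε i : ℝ) * θ i) := fun ε y => by
    simp only [mul_add, Finset.sum_add_distrib]
  simp only [h1]
  rw [integral_finsetSum]
  · refine Finset.sum_congr rfl fun ε _ => ?_
    rw [integral_const_mul, integral_cos_multivariateGaussian hS]
  · intro ε _
    refine Integrable.const_mul (Integrable.of_bound (by fun_prop) 1
      (Filter.Eventually.of_forall fun y => ?_)) _
    exact Real.abs_cos_le_one _

theorem gaussianCosSum_neg {ι : Type*} [Fintype ι] [DecidableEq ι] (z : ι → ℝ)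
    (S : Matrix ι ι ℝ) (θ : ι → ℝ) : gaussianCosSum z S (-θ) = gaussianCosSum z S θ := by
  unfold gaussianCosSum
  refine Finset.sum_congr rfl fun ε _ => ?_
  simp only [Pi.neg_apply, mul_neg, Finset.sum_neg_distrib, Real.cos_neg]

/-- The difference of the two products is 2z cos α (1 - cos θ) + z² sin² θ, which is O(|z|θ²)
without a term linear in θ, while the right side is at least 9/16. -/
theorem one_add_mul_cos_pair {z : ℝ} (hz : |z| ≤ 1 / 4) (α θ : ℝ) :
    (1 + z * Real.cos α) ^ 2 * Real.exp (-(8 * |z| * θ ^ 2)) ≤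
      (1 + z * Real.cos (α + θ)) * (1 + z * Real.cos (α - θ)) := by
  have hc : ∀ u, |z * Real.cos u| ≤ 1 / 4 := fun u => by
    rw [abs_mul]
    calc |z| * |Real.cos u| ≤ |z| * 1 :=
          mul_le_mul_of_nonneg_left (Real.abs_cos_le_one u) (abs_nonneg z)
      _ ≤ 1 / 4 := by linarith
  have b1 := abs_le.1 (hc α)
  have b2 := abs_le.1 (hc (α + θ))
  have b3 := abs_le.1 (hc (α - θ))
  set u := (1 + z * Real.cos α) ^ 2 with hu
  set w := (1 + z * Real.cos (α + θ)) * (1 + z * Real.cos (α - θ)) with hw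
  have hu1 : u ≤ 25 / 16 := by rw [hu]; nlinarith
  have hw1 : 9 / 16 ≤ w := by rw [hw]; nlinarith
  have hz0 := abs_nonneg z
  have hdiff : u - w ≤ 5 / 4 * |z| * θ ^ 2 := by
    have e1 : u - w = 2 * (z * Real.cos α) * (1 - Real.cos θ) + z ^ 2 * Real.sin θ ^ 2 := by
      rw [hu, hw, Real.cos_add, Real.cos_sub]
      have h1 := Real.sin_sq_add_cos_sq α
      have h2 := Real.sin_sq_add_cos_sq θ
      have h3 : Real.sin α ^ 2 = 1 - Real.cos α ^ 2 := by linarith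
      have h4 : Real.cos θ ^ 2 = 1 - Real.sin θ ^ 2 := by linarith
      ring_nf
      rw [h3, h4]
      ring
    have h1 : 1 - Real.cos θ ≤ θ ^ 2 / 2 := by linarith [Real.one_sub_sq_div_two_le_cos (x := θ)]
    have h2 : 0 ≤ 1 - Real.cos θ := by linarith [Real.cos_le_one θ]
    have h3 : Real.sin θ ^ 2 ≤ θ ^ 2 := sq_le_sq.2 Real.abs_sin_le_abs
    have h4 : z * Real.cos α ≤ |z| := by
      refine (le_abs_self _).trans ?_
      rw [abs_mul]
      exact mul_le_of_le_one_right hz0 (Real.abs_cos_le_one α)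
    have h5 : z ^ 2 ≤ |z| / 4 := by rw [← sq_abs]; nlinarith
    have h6 : 2 * (z * Real.cos α) * (1 - Real.cos θ) ≤ 2 * |z| * (θ ^ 2 / 2) := by
      have := mul_le_mul_of_nonneg_right h4 h2
      have := mul_le_mul_of_nonneg_left h1 hz0
      nlinarith
    have h7 : z ^ 2 * Real.sin θ ^ 2 ≤ |z| / 4 * θ ^ 2 :=
      mul_le_mul h5 h3 (sq_nonneg _) (by positivity)
    rw [e1]; linarith
  have hx : 0 ≤ 8 * |z| * θ ^ 2 := by positivity
  have h1 : u ≤ w * (1 + 8 * |z| * θ ^ 2) := by nlinarith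
  have h2 : u ≤ w * Real.exp (8 * |z| * θ ^ 2) :=
    h1.trans (mul_le_mul_of_nonneg_left (by linarith [Real.add_one_le_exp (8 * |z| * θ ^ 2)])
      (by linarith))
  rw [Real.exp_neg, ← div_eq_mul_inv, div_le_iff₀ (Real.exp_pos _)]
  exact h2

open MeasureTheory ProbabilityTheory in
/-- A shift lowers a Gaussian average of a product of cosine factors by a controlled amount. -/
theorem gaussianCosSum_ge {ι : Type*} [Fintype ι] [DecidableEq ι] {z : ι → ℝ}
    (hz : ∀ i, |z i| ≤ 1 / 4) {S : Matrix ι ι ℝ} (hS : S.PosSemidef) (θ : ι → ℝ) :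
    Real.exp (-(4 * ∑ i, |z i| * θ i ^ 2)) * gaussianCosSum z S 0 ≤ gaussianCosSum z S θ := by
  have hpos : ∀ i u, 0 ≤ 1 + z i * Real.cos u := by
    intro i u
    have : |z i * Real.cos u| ≤ 1 / 4 := by
      rw [abs_mul]
      calc |z i| * |Real.cos u| ≤ |z i| * 1 :=
            mul_le_mul_of_nonneg_left (Real.abs_cos_le_one u) (abs_nonneg _)
        _ ≤ 1 / 4 := by linarith [hz i]
    linarith [(abs_le.1 this).1]
  have hintegrable : ∀ θ : ι → ℝ, Integrable (fun y : EuclideanSpace ℝ ι =>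
      ∏ i, (1 + z i * Real.cos (y i + θ i))) (multivariateGaussian 0 S) := by
    intro θ
    refine Integrable.of_bound (by fun_prop) (∏ i : ι, 2)
      (Filter.Eventually.of_forall fun y => ?_)
    rw [Real.norm_eq_abs, Finset.abs_prod]
    refine Finset.prod_le_prod (fun i _ => abs_nonneg _) fun i _ => ?_
    rw [abs_of_nonneg (hpos i _)]
    have : z i * Real.cos (y i + θ i) ≤ 1 := by
      refine (le_abs_self _).trans ?_
      rw [abs_mul]
      nlinarith [Real.abs_cos_le_one (y i + θ i), hz i, abs_nonneg (z i),
        abs_nonneg (Real.cos (y i + θ i))]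
    linarith
  -- Averaging over θ and -θ and applying the arithmetic-geometric inequality under the integral
  -- leaves the product of the two shifted factors, which the pair inequality treats site by site.
  have hsym : gaussianCosSum z S θ = (gaussianCosSum z S θ + gaussianCosSum z S (-θ)) / 2 := by
    rw [gaussianCosSum_neg]; ring
  rw [hsym, gaussianCosSum_eq_integral z hS, gaussianCosSum_eq_integral z hS,
    gaussianCosSum_eq_integral z hS, ← integral_add (hintegrable _) (hintegrable _), ← integral_div,
    ← integral_const_mul]
  refine integral_mono ((hintegrable 0).const_mul _) (((hintegrable θ).add (hintegrable (-θ))).div_const 2) fun y => ?_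
  simp only [Pi.zero_apply, add_zero, Pi.neg_apply, ← sub_eq_add_neg]
  set X := ∏ i, (1 + z i * Real.cos (y i + θ i)) with hX
  set Y := ∏ i, (1 + z i * Real.cos (y i - θ i)) with hY
  set W := Real.exp (-(4 * ∑ i, |z i| * θ i ^ 2)) * ∏ i, (1 + z i * Real.cos (y i)) with hW
  have hX0 : 0 ≤ X := Finset.prod_nonneg fun i _ => hpos i _
  have hY0 : 0 ≤ Y := Finset.prod_nonneg fun i _ => hpos i _
  have hW0 : 0 ≤ W := mul_nonneg (Real.exp_pos _).le (Finset.prod_nonneg fun i _ => hpos i _)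
  have hle : W ^ 2 ≤ X * Y := by
    have e1 : W ^ 2 = ∏ i, ((1 + z i * Real.cos (y i)) ^ 2 *
        Real.exp (-(8 * |z i| * θ i ^ 2))) := by
      rw [hW, mul_pow, ← Real.exp_nat_mul, Finset.prod_mul_distrib, Finset.prod_pow,
        ← Real.exp_sum, mul_comm]
      congr 2
      rw [Finset.sum_neg_distrib, Finset.mul_sum, mul_neg, Finset.mul_sum]
      congr 1
      exact Finset.sum_congr rfl fun i _ => by push_cast; ring
    rw [e1, hX, hY, ← Finset.prod_mul_distrib]
    exact Finset.prod_le_prod (fun i _ => by positivity) fun i _ =>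
      one_add_mul_cos_pair (hz i) (y i) (θ i)
  have h1 : W ^ 2 ≤ ((X + Y) / 2) ^ 2 := by nlinarith [sq_nonneg (X - Y)]
  exact (sq_le_sq₀ hW0 (by linarith)).1 h1

open MeasureTheory ProbabilityTheory in
theorem gaussianCosSum_zero_nonneg {ι : Type*} [Fintype ι] [DecidableEq ι] {z : ι → ℝ}
    (hz : ∀ i, |z i| ≤ 1 / 4) {S : Matrix ι ι ℝ} (hS : S.PosSemidef) :
    0 ≤ gaussianCosSum z S 0 := by
  rw [gaussianCosSum_eq_integral z hS]
  refine integral_nonneg fun y => Finset.prod_nonneg fun i _ => ?_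
  have : |z i * Real.cos (y i + (0 : ι → ℝ) i)| ≤ 1 := by
    rw [abs_mul]
    nlinarith [Real.abs_cos_le_one (y i + (0 : ι → ℝ) i), hz i, abs_nonneg (z i),
      abs_nonneg (Real.cos (y i + (0 : ι → ℝ) i))]
  linarith [(abs_le.1 this).1]

/-! ### The energy of neutral clusters -/

open Classical in
/-- Twice the Dirichlet energy of `σ` inside the ball of radius `R` around `c`. -/
noncomputable def localEnergy {V : Type*} [Fintype V] (G : SimpleGraph V) (σ : V → ℝ) (c : V)
    (R : ℕ) : ℝ :=
  ∑ z : V × V with G.Adj z.1 z.2 ∧ G.dist c z.1 ≤ R ∧ G.dist c z.2 ≤ R, (σ z.1 - σ z.2) ^ 2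

theorem localEnergy_nonneg {V : Type*} [Fintype V] (G : SimpleGraph V) (σ : V → ℝ) (c : V)
    (R : ℕ) : 0 ≤ localEnergy G σ c R := Finset.sum_nonneg fun _ _ => sq_nonneg _

/-- Telescoping along a geodesic and Cauchy–Schwarz. The factor `R` is wasteful in two dimensions,
but the weights decay faster than any loss of this kind. -/
theorem sq_sub_le_localEnergy {V : Type*} [Fintype V] {G : SimpleGraph V} (hG : G.Connected)
    (σ : V → ℝ) {c x : V} {R : ℕ} (hx : G.dist c x ≤ R) :
    (σ x - σ c) ^ 2 ≤ R * localEnergy G σ c R := by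
  classical
  obtain ⟨p, hp⟩ := hG.exists_walk_length_eq_dist c x
  have hpath := p.isPath_of_length_eq_dist hp
  have h1 : σ x - σ c = ∑ m ∈ Finset.range p.length, (σ (p.getVert (m + 1)) - σ (p.getVert m)) := by
    rw [Finset.sum_range_sub (fun m => σ (p.getVert m))]; simp
  have hinj := hpath.getVert_injOn
  have hball : ∀ m ≤ p.length, G.dist c (p.getVert m) ≤ R := by
    intro m hm
    have := SimpleGraph.dist_le (p.take m)
    rw [SimpleGraph.Walk.take_length] at this
    omega
  have h2 : ∑ m ∈ Finset.range p.length, (σ (p.getVert (m + 1)) - σ (p.getVert m)) ^ 2 ≤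
      localEnergy G σ c R := by
    let f : ℕ → V × V := fun m => (p.getVert (m + 1), p.getVert m)
    have hf : Set.InjOn f (Finset.range p.length : Set ℕ) := by
      intro m hm m' hm' hmm
      simp only [Finset.coe_range, Set.mem_Iio] at hm hm'
      exact hinj (show m ≤ p.length by omega) (show m' ≤ p.length by omega)
        (congrArg Prod.snd hmm)
    rw [show ∑ m ∈ Finset.range p.length, (σ (p.getVert (m + 1)) - σ (p.getVert m)) ^ 2 =
      ∑ m ∈ Finset.range p.length, (σ (f m).1 - σ (f m).2) ^ 2 from rfl,
      ← Finset.sum_image (f := fun z : V × V => (σ z.1 - σ z.2) ^ 2) hf]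
    refine Finset.sum_le_sum_of_subset_of_nonneg ?_ fun _ _ _ => sq_nonneg _
    intro z hz
    obtain ⟨m, hm, rfl⟩ := Finset.mem_image.1 hz
    have hm' := Finset.mem_range.1 hm
    simp only [Finset.mem_filter, Finset.mem_univ, true_and, f]
    exact ⟨(p.adj_getVert_succ hm').symm, hball _ hm', hball _ hm'.le⟩
  rw [h1]
  refine sq_sum_le_card_mul_sum_sq.trans ?_
  rw [Finset.card_range]
  have h3 : (p.length : ℝ) ≤ R := by exact_mod_cast hp.le.trans hx
  exact mul_le_mul h3 h2 (Finset.sum_nonneg fun _ _ => sq_nonneg _) (Nat.cast_nonneg _)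

/-- By neutrality the value of `σ` at the centre may be subtracted, so only differences of `σ`
inside the ball of the cluster enter. -/
theorem IsFrozen.pairing_sq_le {V : Type*} [Fintype V] {G : SimpleGraph V} (hG : G.Connected)
    {γ s : ℝ} {x : Cluster V} (h : IsFrozen G γ s x) (σ : V → ℝ) :
    pairing (fun y => (x.density y : ℝ)) σ ^ 2 ≤ (∑ y, |(x.density y : ℝ)|) ^ 2 *
      (2 * scale x.birth * localEnergy G σ x.center (2 * scale x.birth)) := by
  set D := 2 * scale x.birth * localEnergy G σ x.center (2 * scale x.birth) with hD
  have hD0 : 0 ≤ D := mul_nonneg (by positivity) (localEnergy_nonneg _ _ _ _)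
  have hn : ∑ y, (x.density y : ℝ) = 0 := by exact_mod_cast h.neutral
  have h1 : pairing (fun y => (x.density y : ℝ)) σ =
      ∑ y, (x.density y : ℝ) * (σ y - σ x.center) := by
    simp only [pairing, mul_sub, Finset.sum_sub_distrib, ← Finset.sum_mul, hn, zero_mul, sub_zero]
  have h2 : |pairing (fun y => (x.density y : ℝ)) σ| ≤
      (∑ y, |(x.density y : ℝ)|) * Real.sqrt D := by
    rw [h1, Finset.sum_mul]
    refine (Finset.abs_sum_le_sum_abs _ _).trans (Finset.sum_le_sum fun y _ => ?_)
    rw [abs_mul]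
    by_cases hy : x.density y = 0
    · simp [hy]
    · refine mul_le_mul_of_nonneg_left (Real.abs_le_sqrt ?_) (abs_nonneg _)
      have := sq_sub_le_localEnergy hG σ (h.dist_le y (h.supp y hy))
      push_cast at this
      exact this
  rw [← sq_abs]
  refine (pow_le_pow_left₀ (abs_nonneg _) h2 2).trans ?_
  rw [mul_pow, Real.sq_sqrt hD0]

theorem sum_localEnergy_le {V ι : Type*} [Fintype V] {G : SimpleGraph V} (hG : G.Connected)
    (σ : V → ℝ) (N : Finset ι) (c : ι → V) (R : ℕ)
    (hsep : ∀ i ∈ N, ∀ i' ∈ N, i ≠ i' → 2 * R < G.dist (c i) (c i')) :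
    ∑ i ∈ N, localEnergy G σ (c i) R ≤ 2 * dirForm G σ σ := by
  classical
  unfold localEnergy dirForm
  rw [← Finset.sum_biUnion, mul_div_cancel₀ _ (by norm_num : (2 : ℝ) ≠ 0)]
  · simp only [← sq]
    refine Finset.sum_le_sum_of_subset_of_nonneg ?_ fun _ _ _ => sq_nonneg _
    intro z hz
    simp only [Finset.mem_biUnion, Finset.mem_filter, Finset.mem_univ, true_and] at hz ⊢
    obtain ⟨i, -, h, -⟩ := hz
    exact h
  · intro i hi i' hi' hii
    rw [Function.onFun, Finset.disjoint_left]
    intro z hz hz'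
    simp only [Finset.mem_filter, Finset.mem_univ, true_and] at hz hz'
    have h1 := hsep i hi i' hi' hii
    have h2 := hG.dist_triangle (u := c i) (v := z.1) (w := c i')
    rw [G.dist_comm (u := z.1)] at h2
    omega

/-- Clusters of equal birth scale occupy disjoint balls, so their local energies add up to at most
twice the Dirichlet form. Across scales, exp(-s) outweighs the factor 128 and leaves the geometric
series of 1/2. -/
theorem IsNetwork.sum_weighted_localEnergy_le {V : Type*} [Fintype V] [DecidableEq V]
    {G : SimpleGraph V} (hG : G.Connected) {γ s : ℝ} {N : Finset V} {it : V → Cluster V}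
    (h : IsNetwork G γ s N N it) (hs : 128 * Real.exp (-s) ≤ 1 / 2) (σ : V → ℝ) :
    ∑ i ∈ N, Real.exp (-(s * ((it i).birth + 100))) * (scale (it i).birth *
      localEnergy G σ (it i).center (2 * scale (it i).birth)) ≤
      4 * Real.exp (-(100 * s)) * dirForm G σ σ := by
  classical
  set f : ℕ → ℝ := fun b => Real.exp (-(s * (b + 100))) * scale b with hf
  have hf0 : ∀ b, 0 ≤ f b := fun b => by positivity
  have hfle : ∀ b, f b ≤ Real.exp (-(100 * s)) * (1 / 2) ^ b := by
    intro b
    have e1 : f b = Real.exp (-(100 * s)) * (128 * Real.exp (-s)) ^ b := by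
      rw [hf, mul_pow, ← Real.exp_nat_mul, mul_comm ((128 : ℝ) ^ b), ← mul_assoc, ← Real.exp_add]
      simp only [scale]
      push_cast
      ring_nf
    rw [e1]
    exact mul_le_mul_of_nonneg_left (pow_le_pow_left₀ (by positivity) hs b) (Real.exp_pos _).le
  have hdir := dirForm_self_nonneg G σ
  have hmaps : ∀ i ∈ N, (it i).birth ∈ N.image fun i => (it i).birth := fun i hi =>
    Finset.mem_image_of_mem _ hi
  rw [← Finset.sum_fiberwise_of_maps_to hmaps]
  have hstep : ∀ b ∈ N.image fun i => (it i).birth, ∑ i ∈ N with (it i).birth = b,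
      Real.exp (-(s * ((it i).birth + 100))) * (scale (it i).birth *
        localEnergy G σ (it i).center (2 * scale (it i).birth)) ≤ f b * (2 * dirForm G σ σ) := by
    intro b _
    have e1 : ∑ i ∈ N with (it i).birth = b,
        Real.exp (-(s * ((it i).birth + 100))) * (scale (it i).birth *
          localEnergy G σ (it i).center (2 * scale (it i).birth)) =
        f b * ∑ i ∈ N with (it i).birth = b, localEnergy G σ (it i).center (2 * scale b) := by
      rw [Finset.mul_sum]
      refine Finset.sum_congr rfl fun i hi => ?_
      rw [(Finset.mem_filter.1 hi).2]
      simp only [hf]; ring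
    rw [e1]
    refine mul_le_mul_of_nonneg_left (sum_localEnergy_le hG σ _ _ _ ?_) (hf0 b)
    intro i hi i' hi' hii
    rw [Finset.mem_filter] at hi hi'
    have h1 := h.frozen_sep i hi.1 i' hi'.1 hii (hi.2.trans hi'.2.symm)
    rw [hi.2] at h1
    have h2 := scale_freezeTime_le b
    have h3 := scale_pos b
    have h4 : 2 ^ 10 ≤ 2 ^ (b + 10) := Nat.pow_le_pow_right (by norm_num) (by omega)
    nlinarith
  refine (Finset.sum_le_sum hstep).trans ?_
  rw [← Finset.sum_mul]
  have hgeom : ∑ b ∈ N.image fun i => (it i).birth, f b ≤ Real.exp (-(100 * s)) * 2 := by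
    refine (Finset.sum_le_sum fun b _ => hfle b).trans ?_
    rw [← Finset.mul_sum]
    refine mul_le_mul_of_nonneg_left ?_ (Real.exp_pos _).le
    exact (summable_geometric_two.sum_le_tsum _ fun _ _ => by positivity).trans_eq
      tsum_geometric_two
  have := mul_le_mul_of_nonneg_right hgeom (by linarith : 0 ≤ 2 * dirForm G σ σ)
  linarith

theorem sq_le_two_mul_exp {n : ℝ} (hn : 0 ≤ n) : n ^ 2 ≤ 2 * Real.exp n := by
  have := Real.quadratic_le_exp_of_nonneg hn
  nlinarith

/-- The ℓ¹ norm `n` of a density enters the shift as n² ≤ 2exp n, which the exponential of the norm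
built into the weight absorbs. The activity is needed only after its reduction by exp(-γ) for each
bump. -/
theorem IsNetwork.sum_shift_le {V : Type*} [Fintype V] [DecidableEq V]
    {G : SimpleGraph V} (hG : G.Connected) {γ s : ℝ} {N : Finset V} {it : V → Cluster V}
    (h : IsNetwork G γ s N N it) (hs : 128 * Real.exp (-s) ≤ 1 / 2) (σ : V → ℝ) (z : V → ℝ)
    (hz : ∀ i ∈ N, |z i| ≤ |(it i).activity| * Real.exp (-(γ * (it i).bumps.card))) :
    4 * ∑ i ∈ N, |z i| * (2 * Real.pi * pairing (fun y => ((it i).density y : ℝ)) σ) ^ 2 ≤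
      2560 * Real.exp (-(100 * s)) * dirForm G σ σ := by
  have h1 := h.sum_weighted_localEnergy_le hG hs σ
  have hterm : ∀ i ∈ N, |z i| * (2 * Real.pi * pairing (fun y => ((it i).density y : ℝ)) σ) ^ 2 ≤
      160 * (Real.exp (-(s * ((it i).birth + 100))) * (scale (it i).birth *
      localEnergy G σ (it i).center (2 * scale (it i).birth))) := by
    intro i hi
    have hf := h.frozen i hi
    have h2 := hf.pairing_sq_le hG σ
    set n := ∑ y, |((it i).density y : ℝ)| with hn
    have hn0 : 0 ≤ n := Finset.sum_nonneg fun _ _ => abs_nonneg _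
    have hw := hf.weight_le
    rw [Cluster.weight, ← hn] at hw
    set D := (scale (it i).birth : ℝ) * localEnergy G σ (it i).center (2 * scale (it i).birth)
      with hD
    have hD0 : 0 ≤ D := mul_nonneg (by positivity) (localEnergy_nonneg _ _ _ _)
    have hpi : (2 * Real.pi) ^ 2 ≤ 40 := by
      have := Real.pi_lt_d2
      have := Real.pi_pos
      nlinarith
    have h3 : |z i| * n ^ 2 ≤ 2 * Real.exp (-(s * ((it i).birth + 100))) := by
      have e1 : |(it i).activity| * Real.exp (n - γ * (it i).bumps.card) =
          |(it i).activity| * Real.exp (-(γ * (it i).bumps.card)) * Real.exp n := by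
        rw [mul_assoc, ← Real.exp_add]; ring_nf
      rw [e1] at hw
      calc |z i| * n ^ 2 ≤ (|(it i).activity| * Real.exp (-(γ * (it i).bumps.card))) *
            (2 * Real.exp n) := mul_le_mul (hz i hi) (sq_le_two_mul_exp hn0) (sq_nonneg _)
              (by positivity)
        _ ≤ _ := by linarith
    calc |z i| * (2 * Real.pi * pairing (fun y => ((it i).density y : ℝ)) σ) ^ 2
        = (2 * Real.pi) ^ 2 * (|z i| * pairing (fun y => ((it i).density y : ℝ)) σ ^ 2) := by ring
      _ ≤ 40 * (|z i| * (n ^ 2 * (2 * D))) := by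
          refine mul_le_mul hpi (mul_le_mul_of_nonneg_left ?_ (abs_nonneg _)) (by positivity)
            (by norm_num)
          rw [hD]; linarith
      _ = 80 * ((|z i| * n ^ 2) * D) := by ring
      _ ≤ 80 * ((2 * Real.exp (-(s * ((it i).birth + 100)))) * D) := by gcongr
      _ = _ := by ring
  have h4 := Finset.sum_le_sum hterm
  rw [← Finset.mul_sum] at h4
  linarith

/-! ### Lower bounds for networks -/

theorem pairing_comm {V : Type*} [Fintype V] (f g : V → ℝ) : pairing f g = pairing g f :=
  Finset.sum_congr rfl fun _ _ => mul_comm _ _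

theorem pairing_add_left {V : Type*} [Fintype V] (f f' g : V → ℝ) :
    pairing (f + f') g = pairing f g + pairing f' g := by
  simp [pairing, add_mul, Finset.sum_add_distrib]

theorem pairing_smul_left {V : Type*} [Fintype V] (c : ℝ) (f g : V → ℝ) :
    pairing (c • f) g = c * pairing f g := by
  simp [pairing, Finset.mul_sum, mul_assoc]

theorem pairing_add_right {V : Type*} [Fintype V] (f g g' : V → ℝ) :
    pairing f (g + g') = pairing f g + pairing f g' := by
  rw [pairing_comm, pairing_add_left, pairing_comm g, pairing_comm g']

theorem pairing_smul_right {V : Type*} [Fintype V] (c : ℝ) (f g : V → ℝ) :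
    pairing f (c • g) = c * pairing f g := by
  rw [pairing_comm, pairing_smul_left, pairing_comm]

theorem pairing_sum_left {V ι : Type*} [Fintype V] (s : Finset ι) (c : ι → ℝ) (f : ι → V → ℝ)
    (g : V → ℝ) : pairing (∑ i ∈ s, c i • f i) g = ∑ i ∈ s, c i * pairing (f i) g := by
  simp only [pairing, Finset.sum_apply, Pi.smul_apply, smul_eq_mul, Finset.sum_mul, Finset.mul_sum]
  rw [Finset.sum_comm]
  exact Finset.sum_congr rfl fun _ _ => Finset.sum_congr rfl fun _ _ => by ring

theorem dirForm_comm {V : Type*} [Fintype V] (G : SimpleGraph V) (a b : V → ℝ) :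
    dirForm G a b = dirForm G b a := by
  unfold dirForm
  congr 1
  exact Finset.sum_congr rfl fun _ _ => mul_comm _ _

/-- The renormalized energy form. -/
noncomputable def energyForm {V ι : Type*} [Fintype V] (G : SimpleGraph V) (hG : G.Connected)
    (α κ γ : ℝ) (E : Finset ι) (a : ι → V → ℝ) : (V → ℝ) →ₗ[ℝ] (V → ℝ) →ₗ[ℝ] ℝ :=
  LinearMap.mk₂ ℝ (fun q q' => α * pairing q (-(laplacianPseudoinverse G hG q')) -
      κ * pairing q q' - γ * ∑ e ∈ E, pairing q (a e) * pairing q' (a e))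
    (fun q₁ q₂ q' => by
      simp only [pairing_add_left, add_mul, Finset.sum_add_distrib]; ring)
    (fun c q q' => by
      simp only [pairing_smul_left, smul_eq_mul, mul_assoc, ← Finset.mul_sum]; ring)
    (fun q q₁ q₂ => by
      simp only [map_add, neg_add, pairing_add_right, pairing_add_left, mul_add,
        Finset.sum_add_distrib]; ring)
    (fun c q q' => by
      simp only [map_smul, ← smul_neg, pairing_smul_right, pairing_smul_left, smul_eq_mul,
        mul_left_comm _ c, ← Finset.mul_sum]; ring)

theorem energyForm_self {V ι : Type*} [Fintype V] (G : SimpleGraph V) (hG : G.Connected)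
    (α κ γ : ℝ) (E : Finset ι) (a : ι → V → ℝ) (q : V → ℝ) :
    energyForm G hG α κ γ E a q q = α * greenEnergy G hG q - κ * pairing q q -
      γ * ∑ e ∈ E, pairing q (a e) ^ 2 := by
  simp [energyForm, greenEnergy, sq]

theorem energyForm_symm {V ι : Type*} [Fintype V] (G : SimpleGraph V) (hG : G.Connected)
    (α κ γ : ℝ) (E : Finset ι) (a : ι → V → ℝ) {q q' : V → ℝ} (hq : ∑ x, q x = 0)
    (hq' : ∑ x, q' x = 0) :
    energyForm G hG α κ γ E a q q' = energyForm G hG α κ γ E a q' q := by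
  have h1 : pairing q (-(laplacianPseudoinverse G hG q')) =
      pairing q' (-(laplacianPseudoinverse G hG q)) := by
    rw [pairing_eq_dirForm G hG hq, pairing_eq_dirForm G hG hq', dirForm_comm]
  simp only [energyForm, LinearMap.mk₂_apply]
  rw [h1, pairing_comm q q']
  congr 2
  exact Finset.sum_congr rfl fun _ _ => mul_comm _ _

theorem dotProduct_gram {ι E : Type*} [Fintype ι] [AddCommGroup E] [Module ℝ E]
    (B : E →ₗ[ℝ] E →ₗ[ℝ] ℝ) (ρ : ι → E) (x : ι → ℝ) :
    x ⬝ᵥ (Matrix.of fun i j => 2 * B (ρ i) (ρ j)).mulVec x =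
      2 * B (∑ i, x i • ρ i) (∑ i, x i • ρ i) := by
  simp only [dotProduct, Matrix.mulVec, Matrix.of_apply, map_sum, LinearMap.sum_apply, map_smul,
    LinearMap.smul_apply, smul_eq_mul, Finset.mul_sum]
  rw [Finset.sum_comm]
  exact Finset.sum_congr rfl fun i _ => Finset.sum_congr rfl fun j _ => by ring

/-- The linear functional on the group algebra given by a weight function. -/
noncomputable def chargeSum {Γ : Type*} (g : Γ → ℝ) : AddMonoidAlgebra ℝ Γ →ₗ[ℝ] ℝ :=
  (Finsupp.linearCombination ℝ g) ∘ₗ (AddMonoidAlgebra.coeffLinearEquiv ℝ).toLinearMap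

theorem chargeSum_single {Γ : Type*} (g : Γ → ℝ) (q : Γ) (r : ℝ) :
    chargeSum g (AddMonoidAlgebra.single q r) = r * g q := by
  change Finsupp.linearCombination ℝ g (Finsupp.single q r) = r * g q
  rw [Finsupp.linearCombination_single, smul_eq_mul]

/-- The weight of a charge configuration for the shift `σ`. -/
noncomputable def chargeWeight {V : Type*} [Fintype V] (G : SimpleGraph V) (hG : G.Connected)
    (α κ : ℝ) (σ : V → ℝ) (q : V → ℤ) : ℝ :=
  if ∑ x, q x = 0 then
    Real.exp (-(α * greenEnergy G hG fun x => (q x : ℝ)) +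
      κ * pairing (fun x => (q x : ℝ)) fun x => (q x : ℝ)) *
      Real.cos (2 * Real.pi * pairing (fun x => (q x : ℝ)) σ)
  else 0

theorem cosFactor_eq_sum {Γ : Type*} [AddCommGroup Γ] (K : ℝ) (ρ : Γ) :
    cosFactor K ρ =
      ∑ ε : SignType, AddMonoidAlgebra.single ((ε : ℤ) • ρ) (cosCoeff K ε) := by
  rw [SignType.sum_univ]
  simp only [cosFactor, cosCoeff]
  simp [AddMonoidAlgebra.one_def]
  abel

theorem prod_cosFactor_eq_sum {ι Γ : Type*} [Fintype ι] [DecidableEq ι] [AddCommGroup Γ]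
    (K : ι → ℝ) (ρ : ι → Γ) :
    ∏ i, cosFactor (K i) (ρ i) = ∑ ε : ι → SignType,
      AddMonoidAlgebra.single (∑ i, (ε i : ℤ) • ρ i) (∏ i, cosCoeff (K i) (ε i)) := by
  simp only [cosFactor_eq_sum]
  rw [Finset.prod_univ_sum, Fintype.piFinset_univ]
  exact Finset.sum_congr rfl fun ε _ => AddMonoidAlgebra.prod_single _ _ _

/-- The first factors generate neutral configurations only. Adding a charged density to one of them
breaks neutrality, and the weight vanishes there, so the last factor acts as 1. -/
theorem chargeSum_prod_cosFactor {V ι : Type*} [Fintype V] [Fintype ι] [DecidableEq ι]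
    (G : SimpleGraph V) (hG : G.Connected) (α κ : ℝ) (σ : V → ℝ) (K : ι → ℝ) (ρ : ι → V → ℤ)
    (hρ : ∀ i, ∑ x, ρ i x = 0) (K' : ℝ) (ρ' : V → ℤ) (h' : K' = 0 ∨ ∑ x, ρ' x ≠ 0) :
    chargeSum (chargeWeight G hG α κ σ) ((∏ i, cosFactor (K i) (ρ i)) * cosFactor K' ρ') =
      ∑ ε : ι → SignType, (∏ i, cosCoeff (K i) (ε i)) *
        chargeWeight G hG α κ σ (∑ i, (ε i : ℤ) • ρ i) := by
  rw [prod_cosFactor_eq_sum, Finset.sum_mul, map_sum]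
  refine Finset.sum_congr rfl fun ε _ => ?_
  set q := ∑ i, (ε i : ℤ) • ρ i with hq
  have hq0 : ∑ x, q x = 0 := by
    simp only [hq, Finset.sum_apply, Pi.smul_apply, smul_eq_mul]
    rw [Finset.sum_comm]
    exact Finset.sum_eq_zero fun i _ => by rw [← Finset.mul_sum, hρ, mul_zero]
  simp only [cosFactor, mul_add, mul_one, AddMonoidAlgebra.single_mul_single, map_add,
    chargeSum_single]
  have h1 : ∀ s : V → ℤ, s = ρ' ∨ s = -ρ' → (∏ i, cosCoeff (K i) (ε i)) * (K' / 2) *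
      chargeWeight G hG α κ σ (q + s) = 0 := by
    intro s hs
    rcases h' with h' | h'
    · simp [h']
    · have : ∑ x, (q + s) x ≠ 0 := by
        simp only [Pi.add_apply, Finset.sum_add_distrib, hq0, zero_add]
        rcases hs with rfl | rfl
        · exact h'
        · simpa [Finset.sum_neg_distrib] using h'
      rw [chargeWeight, if_neg this, mul_zero]
  rw [h1 _ (Or.inl rfl), h1 _ (Or.inr rfl), add_zero, add_zero]

/-- The bound on the cost of a shift, for a network. -/
theorem IsNetwork.chargeSum_ge {V : Type*} [Fintype V] [DecidableEq V]
    {G : SimpleGraph V} (hG : G.Connected) {M : ℝ} (hM : HasVolumeGrowth G M)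
    (hdeg : ∀ q : V → ℝ, dirForm G q q ≤ 8 * pairing q q) {α κ γ s : ℝ}
    (hγ0 : 0 ≤ γ) (hκ0 : 0 ≤ κ) (hκ : 16 * κ ≤ α) (hγ : 2 * (γ * M) ≤ α)
    (hs : 128 * Real.exp (-s) ≤ 1 / 2) {N : Finset V} {it : V → Cluster V}
    (h : IsNetwork G γ s N N it) (K' : ℝ) (ρ' : V → ℤ) (h' : K' = 0 ∨ ∑ x, ρ' x ≠ 0)
    (σ : V → ℝ) :
    Real.exp (-(2560 * Real.exp (-(100 * s)) * dirForm G σ σ)) *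
      chargeSum (chargeWeight G hG α κ 0)
        ((∏ i ∈ N, cosFactor (it i).activity (it i).density) * cosFactor K' ρ') ≤
    chargeSum (chargeWeight G hG α κ σ)
        ((∏ i ∈ N, cosFactor (it i).activity (it i).density) * cosFactor K' ρ') := by
  classical
  obtain ⟨a, ha1, ha0, haE⟩ := h.exists_cutoffs hG hM
  let E : Finset (Σ _ : V, V × ℕ) := N.sigma fun i => (it i).bumps
  let a' : (Σ _ : V, V × ℕ) → V → ℝ := fun e => a e.2
  let r : V → V → ℝ := fun i y => ((it i).density y : ℝ)
  let B := energyForm G hG α κ γ E a'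
  let S : Matrix N N ℝ := Matrix.of fun i j => 2 * B (r i) (r j)
  let g : V → ℝ := fun i => ∑ e ∈ (it i).bumps, pairing (r i) (a e) ^ 2
  -- The renormalized activity. The squared pairings with the cluster's own bumps are each at least
  -- 1, so it gains at least exp(-γ) per bump.
  let z : V → ℝ := fun i => (it i).activity * Real.exp (-(γ * g i))
  have hr0 : ∀ i ∈ N, ∑ x, r i x = 0 := fun i hi => by
    have := (h.frozen i hi).neutral
    change ∑ x, ((it i).density x : ℝ) = 0
    exact_mod_cast this
  have hcomb0 : ∀ x : N → ℝ, ∑ y, (∑ i, x i • r i : V → ℝ) y = 0 := by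
    intro x
    simp only [Finset.sum_apply, Pi.smul_apply, smul_eq_mul]
    rw [Finset.sum_comm]
    exact Finset.sum_eq_zero fun i _ => by rw [← Finset.mul_sum, hr0 i i.2, mul_zero]
  -- Half of α pays for the bumps, through γM ≤ α/2, and half for the self-energies, through 8κ ≤
  -- α/2.
  have hBnn : ∀ q : V → ℝ, ∑ x, q x = 0 → 0 ≤ B q q := by
    intro q hq
    simp only [B, energyForm_self]
    have h1 : ∑ e ∈ E, pairing q (a' e) ^ 2 ≤ M * greenEnergy G hG q := by
      simp only [E, a', Finset.sum_sigma]
      exact haE q hq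
    have h2 := pairing_self_le_greenEnergy hG hdeg hq
    have h3 := greenEnergy_nonneg G hG hq
    have h4 := mul_le_mul_of_nonneg_left h1 hγ0
    have h5 := mul_le_mul_of_nonneg_left h2 hκ0
    have h6 := mul_le_mul_of_nonneg_right hκ h3
    have h7 := mul_le_mul_of_nonneg_right hγ h3
    nlinarith
  have hS : S.PosSemidef := by
    rw [Matrix.posSemidef_iff_dotProduct_mulVec]
    refine ⟨?_, fun x => ?_⟩
    · ext i j
      simp only [S, Matrix.conjTranspose_apply, Matrix.of_apply, star_trivial]
      rw [energyForm_symm G hG α κ γ E a' (hr0 j j.2) (hr0 i i.2)]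
    · rw [star_trivial]
      change 0 ≤ x ⬝ᵥ (Matrix.of fun i j : N => 2 * B (r i) (r j)).mulVec x
      rw [dotProduct_gram B (fun i : N => r i) x]
      exact mul_nonneg (by norm_num) (hBnn _ (hcomb0 x))
  have hg : ∀ i ∈ N, ((it i).bumps.card : ℝ) ≤ g i := by
    intro i hi
    rw [Finset.card_eq_sum_ones]
    push_cast
    exact Finset.sum_le_sum fun e he => ha1 i hi e he
  have hz : ∀ i ∈ N, |z i| ≤ |(it i).activity| * Real.exp (-(γ * (it i).bumps.card)) := by
    intro i hi
    simp only [z, abs_mul, Real.abs_exp]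
    refine mul_le_mul_of_nonneg_left (Real.exp_le_exp.2 ?_) (abs_nonneg _)
    exact neg_le_neg (mul_le_mul_of_nonneg_left (hg i hi) hγ0)
  have hs0 : Real.exp (-s) ≤ 1 / 4 := by linarith
  have hspos : 0 ≤ s := by
    by_contra hcon
    have := Real.one_le_exp (by linarith : 0 ≤ -s)
    linarith
  have hz4 : ∀ i ∈ N, |z i| ≤ 1 / 4 := by
    intro i hi
    refine (hz i hi).trans ?_
    have hw := (h.frozen i hi).weight_le
    have h1 : Real.exp (-(γ * (it i).bumps.card)) ≤
        Real.exp (∑ y, |((it i).density y : ℝ)| - γ * (it i).bumps.card) := by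
      refine Real.exp_le_exp.2 ?_
      have : 0 ≤ ∑ y, |((it i).density y : ℝ)| := Finset.sum_nonneg fun _ _ => abs_nonneg _
      linarith
    refine (mul_le_mul_of_nonneg_left h1 (abs_nonneg _)).trans (hw.trans (le_trans ?_ hs0))
    refine Real.exp_le_exp.2 ?_
    have : (0 : ℝ) ≤ (it i).birth := Nat.cast_nonneg _
    nlinarith [mul_nonneg hspos this]
  -- For q = ∑ ε_i ρ_i the exponent splits into the form `B` and the squares of the pairings with
  -- the cutoffs. Each cutoff sees only the cluster owning it, so these squares are ε_i² g_i without
  -- cross terms and enter the coefficients of the single factors. The rest is a Gaussian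
  -- characteristic function; the 2 in `S` undoes its 1/2.
  have hkey : ∀ τ : V → ℝ, chargeSum (chargeWeight G hG α κ τ)
        ((∏ i ∈ N, cosFactor (it i).activity (it i).density) * cosFactor K' ρ') =
      gaussianCosSum (fun i : N => z i) S (fun i : N => 2 * Real.pi * pairing (r i) τ) := by
    intro τ
    rw [← Finset.prod_coe_sort N fun i => cosFactor (it i).activity (it i).density,
      chargeSum_prod_cosFactor G hG α κ τ (fun i : N => (it i).activity)
        (fun i : N => (it i).density) (fun i : N => (h.frozen i i.2).neutral) K' ρ' h']
    refine Finset.sum_congr rfl fun ε _ => ?_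
    have hq0 : ∑ x, (∑ i : N, (ε i : ℤ) • (it i).density) x = 0 := by
      simp only [Finset.sum_apply, Pi.smul_apply, smul_eq_mul]
      rw [Finset.sum_comm]
      exact Finset.sum_eq_zero fun i _ => by
        rw [← Finset.mul_sum, (h.frozen i i.2).neutral, mul_zero]
    have hcast : (fun x => ((∑ i : N, (ε i : ℤ) • (it i).density) x : ℝ)) =
        ∑ i : N, (ε i : ℝ) • r i := by
      funext x
      simp only [Finset.sum_apply, Pi.smul_apply, smul_eq_mul, r, Int.cast_sum, Int.cast_mul,
        SignType.intCast_cast]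
    rw [chargeWeight, if_pos hq0, hcast]
    set q : V → ℝ := ∑ i : N, (ε i : ℝ) • r i with hq
    have hquad : -((fun i : N => (ε i : ℝ)) ⬝ᵥ S.mulVec fun i => (ε i : ℝ)) / 2 = -(B q q) := by
      have := dotProduct_gram B (fun i : N => r i) (fun i => (ε i : ℝ))
      change (fun i : N => (ε i : ℝ)) ⬝ᵥ S.mulVec _ = _ at this
      rw [this]; ring
    have hBq : -(α * greenEnergy G hG q) + κ * pairing q q =
        -(B q q) + -(γ * ∑ e ∈ E, pairing q (a' e) ^ 2) := by
      simp only [B, energyForm_self]; ring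
    have hsum : ∑ e ∈ E, pairing q (a' e) ^ 2 = ∑ i : N, (ε i : ℝ) ^ 2 * g i := by
      simp only [E, a', Finset.sum_sigma, g, Finset.mul_sum]
      rw [← Finset.sum_coe_sort N]
      refine Finset.sum_congr rfl fun i _ => Finset.sum_congr rfl fun e he => ?_
      rw [hq, pairing_sum_left, Finset.sum_eq_single i, mul_pow]
      · intro j _ hji
        rw [ha0 i i.2 e he j j.2 fun hh => hji (Subtype.ext hh), mul_zero]
      · simp
    have hcoef : (∏ i : N, cosCoeff (it i).activity (ε i)) *
        Real.exp (-(γ * ∑ i : N, (ε i : ℝ) ^ 2 * g i)) = ∏ i : N, cosCoeff (z i) (ε i) := by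
      rw [Finset.mul_sum, ← Finset.sum_neg_distrib, Real.exp_sum, ← Finset.prod_mul_distrib]
      refine Finset.prod_congr rfl fun i _ => ?_
      have : ε i = 0 ∨ ε i = -1 ∨ ε i = 1 := by cases ε i <;> decide
      rcases this with h1 | h1 | h1 <;> rw [h1] <;> simp [cosCoeff, z] <;> ring
    have hcos : 2 * Real.pi * pairing q τ = ∑ i : N, (ε i : ℝ) * (2 * Real.pi * pairing (r i) τ) := by
      rw [hq, pairing_sum_left, Finset.mul_sum]
      exact Finset.sum_congr rfl fun i _ => by ring
    rw [hquad, hBq, Real.exp_add, hsum, ← hcoef, hcos]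
    ring
  rw [hkey, hkey]
  have hzero : (fun i : N => 2 * Real.pi * pairing (r i) 0) = 0 := by
    funext i; simp [pairing]
  rw [hzero]
  refine le_trans ?_ (gaussianCosSum_ge (fun i : N => hz4 i i.2) hS _)
  refine mul_le_mul_of_nonneg_right (Real.exp_le_exp.2 (neg_le_neg ?_))
    (gaussianCosSum_zero_nonneg (fun i : N => hz4 i i.2) hS)
  have := h.sum_shift_le hG hs σ z hz
  rw [← Finset.sum_coe_sort N] at this
  exact this

/-! ### The Coulomb gas -/

theorem Int.sum_Icc_symm {R : Type*} [AddCommMonoid R] (m : ℕ) (f : ℤ → R) :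
    ∑ n ∈ Finset.Icc (-(m : ℤ)) m, f n = f 0 + ∑ n ∈ Finset.Icc 1 m, (f n + f (-n)) := by
  induction m with
  | zero => simp
  | succ m ih =>
    have h1 : Finset.Icc (-((m + 1 : ℕ) : ℤ)) (m + 1 : ℕ) =
        insert (((m + 1 : ℕ) : ℤ)) (insert (-((m + 1 : ℕ) : ℤ)) (Finset.Icc (-(m : ℤ)) m)) := by
      ext n; simp only [Finset.mem_Icc, Finset.mem_insert]; omega
    rw [h1, Finset.sum_insert, Finset.sum_insert, ih, Finset.sum_Icc_succ_top (by omega)]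
    · abel
    · simp
    · simp only [Finset.mem_insert, Finset.mem_Icc]; omega

theorem prod_truncatedSite_eq {V : Type*} [Fintype V] [DecidableEq V] (κ : ℝ) (m : ℕ) :
    ∏ x : V, truncatedSite κ m x = ∑ q ∈ Fintype.piFinset fun _ : V => Finset.Icc (-(m : ℤ)) m,
      AddMonoidAlgebra.single q
        (Real.exp (-(κ * pairing (fun x => (q x : ℝ)) fun x => (q x : ℝ)))) := by
  have h1 : ∀ x : V, truncatedSite κ m x = ∑ n ∈ Finset.Icc (-(m : ℤ)) m,
      AddMonoidAlgebra.single (Pi.single x n : V → ℤ) (Real.exp (-(κ * (n : ℝ) ^ 2))) := by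
    intro x
    rw [Int.sum_Icc_symm, truncatedSite]
    congr 1
    · simp [AddMonoidAlgebra.one_def]
    · refine Finset.sum_congr rfl fun n _ => ?_
      simp [Pi.single_neg]
  simp only [h1]
  rw [Finset.prod_univ_sum]
  refine Finset.sum_congr rfl fun q _ => ?_
  rw [AddMonoidAlgebra.prod_single, Finset.univ_sum_single, ← Real.exp_sum]
  congr 2
  simp only [pairing, Finset.mul_sum, ← Finset.sum_neg_distrib, sq]

/-- The Boltzmann weight of a neutral integer charge configuration. -/
noncomputable def coulombWeight {V : Type*} [Fintype V] (G : SimpleGraph V) (hG : G.Connected)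
    (α : ℝ) (q : V → ℤ) : ℝ :=
  if ∑ x, q x = 0 then Real.exp (-(α * greenEnergy G hG fun x => (q x : ℝ))) else 0

/-- The self-energy put into the site factors is exactly what the weight had been relieved of, so
the original Coulomb weight reappears. -/
theorem chargeSum_prod_truncatedSite {V : Type*} [Fintype V] [DecidableEq V] (G : SimpleGraph V)
    (hG : G.Connected) (α κ : ℝ) (m : ℕ) (σ : V → ℝ) :
    chargeSum (chargeWeight G hG α κ σ) (∏ x : V, truncatedSite κ m x) =
      ∑ q ∈ Fintype.piFinset fun _ : V => Finset.Icc (-(m : ℤ)) m, coulombWeight G hG α q *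
        Real.cos (2 * Real.pi * pairing (fun x => (q x : ℝ)) σ) := by
  rw [prod_truncatedSite_eq, map_sum]
  refine Finset.sum_congr rfl fun q _ => ?_
  rw [chargeSum_single, chargeWeight, coulombWeight]
  split_ifs
  · rw [← mul_assoc, ← Real.exp_add]
    congr 2
    ring
  · simp

/-- The shifted Coulomb gas, with truncated charges. -/
theorem truncated_coulomb_ge {V : Type*} [Fintype V] [DecidableEq V] {G : SimpleGraph V}
    (hG : G.Connected) {M₁ : ℕ} (hM₁ : HasPacking G M₁) {M₂ : ℝ} (hM₂ : HasVolumeGrowth G M₂)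
    (hdeg : ∀ q : V → ℝ, dirForm G q q ≤ 8 * pairing q q) {α κ γ s C : ℝ}
    (hC : C = (1 + M₁) * Real.log 4) (hsC : 4 * C ≤ s) (hγs : s + C ≤ γ)
    (hκ0 : 0 ≤ κ) (hκ : 16 * κ ≤ α) (hγ : 2 * (γ * M₂) ≤ α)
    (hs : 128 * Real.exp (-s) ≤ 1 / 2)
    (hκs : ∀ n : ℕ, 1 ≤ n → 2 ^ (n + 1) * Real.exp (-(κ * n ^ 2)) * Real.exp n ≤
      Real.exp (-(s * 100))) (m : ℕ) (σ : V → ℝ) :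
    Real.exp (-(2560 * Real.exp (-(100 * s)) * dirForm G σ σ)) *
      ∑ q ∈ Fintype.piFinset fun _ : V => Finset.Icc (-(m : ℤ)) m, coulombWeight G hG α q ≤
    ∑ q ∈ Fintype.piFinset fun _ : V => Finset.Icc (-(m : ℤ)) m, coulombWeight G hG α q *
        Real.cos (2 * Real.pi * pairing (fun x => (q x : ℝ)) σ) := by
  have hC0 : 0 ≤ C := by rw [hC]; have := Real.log_nonneg (by norm_num : (1 : ℝ) ≤ 4); positivity
  set A := Real.exp (-(2560 * Real.exp (-(100 * s)) * dirForm G σ σ)) with hA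
  have hmem : ∏ x : V, truncatedSite κ m x ∈ convexHull ℝ (networkProducts G γ s) :=
    convexHull_min (stateProducts_zero_subset hG hM₁ hC hsC hγs) (convex_convexHull ℝ _)
      (prod_truncatedSite_mem G hG γ s C κ m hκs)
  -- The desired inequality says that one linear functional is nonnegative, so it passes from the
  -- networks to their convex hull. The shift cost `A` is the same for all networks.
  let Λ : AddMonoidAlgebra ℝ (V → ℤ) →ₗ[ℝ] ℝ :=
    chargeSum (chargeWeight G hG α κ σ) - A • chargeSum (chargeWeight G hG α κ 0)
  have hsub : networkProducts G γ s ⊆ Λ ⁻¹' Set.Ici 0 := by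
    rintro F ⟨N, it, K, ρ, hN, hK, rfl⟩
    have := hN.chargeSum_ge hG hM₂ hdeg (by linarith) hκ0 hκ hγ hs K ρ hK σ
    simp only [Set.mem_preimage, Set.mem_Ici, Λ, LinearMap.sub_apply, LinearMap.smul_apply,
      smul_eq_mul]
    linarith
  have h1 := convexHull_min hsub ((convex_Ici 0).linear_preimage Λ) hmem
  simp only [Set.mem_preimage, Set.mem_Ici, Λ, LinearMap.sub_apply, LinearMap.smul_apply,
    smul_eq_mul, chargeSum_prod_truncatedSite] at h1
  have h2 : ∀ q : V → ℤ, Real.cos (2 * Real.pi * pairing (fun x => (q x : ℝ)) 0) = 1 := by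
    intro q; simp [pairing]
  simp only [h2, mul_one] at h1
  linarith

theorem summable_prod_of_summable {ι κ : Type*} [Fintype ι] {g : κ → ℝ} (hg : Summable g)
    (hg0 : ∀ n, 0 ≤ g n) : Summable fun q : ι → κ => ∏ i, g (q i) := by
  classical
  refine summable_of_sum_le (c := ∏ _i : ι, ∑' n, g n)
    (fun q => Finset.prod_nonneg fun i _ => hg0 _) fun s => ?_
  have h1 : s ⊆ Fintype.piFinset fun i => s.image fun q => q i := by
    intro q hq
    exact Fintype.mem_piFinset.2 fun i => Finset.mem_image_of_mem _ hq
  refine (Finset.sum_le_sum_of_subset_of_nonneg h1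
    fun q _ _ => Finset.prod_nonneg fun i _ => hg0 _).trans ?_
  rw [← Finset.prod_univ_sum (f := fun _ n => g n)]
  exact Finset.prod_le_prod (fun i _ => Finset.sum_nonneg fun _ _ => hg0 _)
    fun i _ => hg.sum_le_tsum _ fun _ _ => hg0 _

theorem summable_exp_neg_sq_add {a : ℝ} (ha : 0 < a) (b : ℝ) :
    Summable fun n : ℤ => Real.exp (-(a * (n : ℝ) ^ 2) + b * |(n : ℝ)|) := by
  have h1 : Summable fun n : ℕ => Real.exp (-(a * (n : ℝ) ^ 2) + b * |(n : ℝ)|) := by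
    have hgeo : Summable fun n : ℕ => Real.exp ((b + 1) ^ 2 / (4 * a)) * Real.exp (-1) ^ n :=
      (summable_geometric_of_lt_one (Real.exp_pos _).le (by simp)).mul_left _
    refine Summable.of_nonneg_of_le (fun n => (Real.exp_pos _).le) (fun n => ?_) hgeo
    rw [← Real.exp_nat_mul, ← Real.exp_add]
    refine Real.exp_le_exp.2 ?_
    rw [abs_of_nonneg (Nat.cast_nonneg n)]
    have h2 : 0 ≤ (2 * a * n - (b + 1)) ^ 2 / (4 * a) := by positivity
    have h3 : (2 * a * n - (b + 1)) ^ 2 / (4 * a) =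
        a * (n : ℝ) ^ 2 - (b + 1) * n + (b + 1) ^ 2 / (4 * a) := by field_simp; ring
    linarith
  refine Summable.of_nat_of_neg (by simpa using h1) (by simpa using h1)

theorem coulombWeight_nonneg {V : Type*} [Fintype V] (G : SimpleGraph V) (hG : G.Connected)
    (α : ℝ) (q : V → ℤ) : 0 ≤ coulombWeight G hG α q := by
  unfold coulombWeight; split_ifs <;> positivity

theorem summable_coulombWeight {V : Type*} [Fintype V] {G : SimpleGraph V} (hG : G.Connected)
    (hdeg : ∀ q : V → ℝ, dirForm G q q ≤ 8 * pairing q q) {α : ℝ} (hα : 0 < α) :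
    Summable (coulombWeight G hG α) := by
  have h1 := summable_prod_of_summable (ι := V) (summable_exp_neg_sq_add (a := α / 8)
    (by positivity) 0) fun _ => (Real.exp_pos _).le
  refine Summable.of_nonneg_of_le (coulombWeight_nonneg G hG α) (fun q => ?_) h1
  rw [← Real.exp_sum]
  unfold coulombWeight
  split_ifs with hq
  · refine Real.exp_le_exp.2 ?_
    have h2 := pairing_self_le_greenEnergy hG hdeg (q := fun x => (q x : ℝ))
      (by exact_mod_cast hq)
    have h3 : ∑ x, (-(α / 8 * (q x : ℝ) ^ 2) + 0 * |(q x : ℝ)|) =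
        -(α / 8 * pairing (fun x => (q x : ℝ)) fun x => (q x : ℝ)) := by
      simp [pairing, Finset.mul_sum, sq]
    rw [h3]
    nlinarith
  · positivity

/-- The shifted Coulomb gas. -/
theorem coulomb_ge {V : Type*} [Fintype V] [DecidableEq V] {G : SimpleGraph V}
    (hG : G.Connected) {M₁ : ℕ} (hM₁ : HasPacking G M₁) {M₂ : ℝ} (hM₂ : HasVolumeGrowth G M₂)
    (hdeg : ∀ q : V → ℝ, dirForm G q q ≤ 8 * pairing q q) {α κ γ s C : ℝ} (hα : 0 < α)
    (hC : C = (1 + M₁) * Real.log 4) (hsC : 4 * C ≤ s) (hγs : s + C ≤ γ)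
    (hκ0 : 0 ≤ κ) (hκ : 16 * κ ≤ α) (hγ : 2 * (γ * M₂) ≤ α)
    (hs : 128 * Real.exp (-s) ≤ 1 / 2)
    (hκs : ∀ n : ℕ, 1 ≤ n → 2 ^ (n + 1) * Real.exp (-(κ * n ^ 2)) * Real.exp n ≤
      Real.exp (-(s * 100))) (σ : V → ℝ) :
    Real.exp (-(2560 * Real.exp (-(100 * s)) * dirForm G σ σ)) * ∑' q, coulombWeight G hG α q ≤
    ∑' q, coulombWeight G hG α q * Real.cos (2 * Real.pi * pairing (fun x => (q x : ℝ)) σ) := by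
  have hsum := summable_coulombWeight hG hdeg hα
  have hsum' : Summable fun q => coulombWeight G hG α q *
      Real.cos (2 * Real.pi * pairing (fun x => (q x : ℝ)) σ) := by
    refine Summable.of_norm_bounded hsum fun q => ?_
    rw [norm_mul, Real.norm_of_nonneg (coulombWeight_nonneg G hG α q)]
    exact mul_le_of_le_one_right (coulombWeight_nonneg G hG α q) (Real.abs_cos_le_one _)
  have htend : Filter.Tendsto (fun m : ℕ => Fintype.piFinset fun _ : V => Finset.Icc (-(m : ℤ)) m)
      Filter.atTop Filter.atTop := by
    refine Filter.tendsto_atTop_finset_of_monotone (fun m m' h => ?_) fun q => ?_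
    · refine Fintype.piFinset_subset _ _ fun _ => Finset.Icc_subset_Icc ?_ ?_ <;> omega
    · refine ⟨∑ x, (q x).natAbs, Fintype.mem_piFinset.2 fun x => ?_⟩
      have := Finset.single_le_sum (f := fun x => (q x).natAbs) (fun _ _ => Nat.zero_le _)
        (Finset.mem_univ x)
      rw [Finset.mem_Icc]
      omega
  refine le_of_tendsto_of_tendsto' ((hsum.hasSum.comp htend).const_mul _)
    (hsum'.hasSum.comp htend) fun m => ?_
  exact truncated_coulomb_ge hG hM₁ hM₂ hdeg hC hsC hγs hκ0 hκ hγ hs hκs m σ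

/-! ### Poisson summation for Gaussians on a lattice -/

-- The source `g` is complex and the constant does not depend on it. Both are needed for the
-- induction on dimension, where summing out one coordinate leaves a complex source for the others.
open Complex in
theorem tsum_gaussian_one {a : ℝ} (ha : 0 < a) : ∃ c : ℝ, 0 < c ∧ ∀ g : ℂ,
    ∑' m : ℤ, cexp (-(a / 2) * (m : ℂ) ^ 2 + g * m) =
      c * ∑' q : ℤ, cexp ((g + 2 * Real.pi * I * q) ^ 2 / (2 * a)) := by
  have hpi := Real.pi_pos
  have ha' : (a : ℂ) ≠ 0 := by exact_mod_cast ha.ne'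
  have hpi' : (Real.pi : ℂ) ≠ 0 := by exact_mod_cast hpi.ne'
  have hre : 0 < ((a / (2 * Real.pi) : ℝ) : ℂ).re := by rw [ofReal_re]; positivity
  refine ⟨1 / (a / (2 * Real.pi)) ^ (1 / 2 : ℝ), by positivity, fun g => ?_⟩
  have h := Complex.tsum_exp_neg_quadratic hre (g / (2 * Real.pi))
  have e1 : ∀ n : ℤ, -(Real.pi : ℂ) * ((a / (2 * Real.pi) : ℝ) : ℂ) * (n : ℂ) ^ 2 +
      2 * Real.pi * (g / (2 * Real.pi)) * n = -(a / 2) * (n : ℂ) ^ 2 + g * n := by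
    intro n; push_cast; field_simp
  have e2 : ∀ n : ℤ, -(Real.pi : ℂ) / ((a / (2 * Real.pi) : ℝ) : ℂ) *
      ((n : ℂ) + I * (g / (2 * Real.pi))) ^ 2 =
      (g + 2 * Real.pi * I * ((-n : ℤ) : ℂ)) ^ 2 / (2 * a) := by
    intro n; push_cast; field_simp; ring_nf
    simp only [I_sq]; ring
  simp only [e1, e2] at h
  rw [h]
  congr 1
  · rw [show ((1 / 2 : ℂ)) = ((1 / 2 : ℝ) : ℂ) by push_cast; rfl, ← Complex.ofReal_cpow
      (by positivity)]
    push_cast; rfl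
  · exact (Equiv.neg ℤ).tsum_eq fun q : ℤ => cexp ((g + 2 * Real.pi * I * q) ^ 2 / (2 * a))

/-! ### Quadratic forms, Schur complements and completion of squares. -/

/-- The quadratic form of a matrix. -/
def quadForm {ι K : Type*} [Fintype ι] [CommRing K] (P : Matrix ι ι K) (x : ι → K) : K :=
  ∑ i, ∑ j, P i j * x i * x j

theorem quadForm_add_smul {ι K : Type*} [Fintype ι] [CommRing K] {P : Matrix ι ι K}
    (hP : ∀ i j, P i j = P j i) (x u : ι → K) (t : K) :
    quadForm P (fun i => x i + t * u i) =
      quadForm P x + 2 * t * ∑ i, x i * ∑ j, P i j * u j + t ^ 2 * quadForm P u := by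
  have h1 : ∑ i, ∑ j, P i j * u i * x j = ∑ i, ∑ j, P i j * x i * u j := by
    rw [Finset.sum_comm]
    exact Finset.sum_congr rfl fun i _ => Finset.sum_congr rfl fun j _ => by rw [hP]; ring
  have h2 : 2 * t * ∑ i, x i * ∑ j, P i j * u j =
      t * ∑ i, ∑ j, P i j * x i * u j + t * ∑ i, ∑ j, P i j * u i * x j := by
    rw [h1, ← two_mul, ← mul_assoc]
    congr 1
    simp only [Finset.mul_sum]
    exact Finset.sum_congr rfl fun i _ => Finset.sum_congr rfl fun j _ => by ring
  rw [h2]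
  simp only [quadForm, Finset.mul_sum, ← Finset.sum_add_distrib]
  exact Finset.sum_congr rfl fun i _ => Finset.sum_congr rfl fun j _ => by ring

theorem quadForm_cons {n : ℕ} {K : Type*} [CommRing K] {P : Matrix (Fin (n + 1)) (Fin (n + 1)) K}
    (hP : ∀ i j, P i j = P j i) (x₀ : K) (x : Fin n → K) :
    quadForm P (Fin.cons x₀ x : Fin (n + 1) → K) = P 0 0 * x₀ ^ 2 +
      2 * x₀ * ∑ j, P 0 j.succ * x j + quadForm (P.submatrix Fin.succ Fin.succ) x := by
  simp only [quadForm, Fin.sum_univ_succ, Fin.cons_zero, Fin.cons_succ, Matrix.submatrix_apply,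
    Finset.sum_add_distrib]
  have h1 : ∑ i : Fin n, P i.succ 0 * x i * x₀ = x₀ * ∑ j, P 0 j.succ * x j := by
    rw [Finset.mul_sum]
    exact Finset.sum_congr rfl fun i _ => by rw [hP]; ring
  have h2 : ∑ i : Fin n, P 0 i.succ * x₀ * x i = x₀ * ∑ j, P 0 j.succ * x j := by
    rw [Finset.mul_sum]
    exact Finset.sum_congr rfl fun i _ => by ring
  rw [h1, h2]
  ring

/-- The Schur complement of the first diagonal entry. -/
noncomputable def schurMatrix {n : ℕ} {K : Type*} [Field K]
    (P : Matrix (Fin (n + 1)) (Fin (n + 1)) K) : Matrix (Fin n) (Fin n) K :=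
  Matrix.of fun i j => P i.succ j.succ - P 0 i.succ * P 0 j.succ / P 0 0

theorem quadForm_schurMatrix {n : ℕ} {K : Type*} [Field K]
    (P : Matrix (Fin (n + 1)) (Fin (n + 1)) K) (x : Fin n → K) :
    quadForm (schurMatrix P) x = quadForm (P.submatrix Fin.succ Fin.succ) x -
      (∑ j, P 0 j.succ * x j) ^ 2 / P 0 0 := by
  rw [sq, Finset.sum_mul_sum, Finset.sum_div]
  simp only [quadForm, schurMatrix, Matrix.of_apply, Matrix.submatrix_apply, Finset.sum_div,
    ← Finset.sum_sub_distrib]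
  exact Finset.sum_congr rfl fun i _ => Finset.sum_congr rfl fun j _ => by ring

/-- The lower block of the inverse is the inverse of the Schur complement: eliminate the first row
of `P * C = 1`. -/
theorem schurMatrix_mul {n : ℕ} {K : Type*} [Field K]
    {P C : Matrix (Fin (n + 1)) (Fin (n + 1)) K} (hP : ∀ i j, P i j = P j i) (h : P * C = 1)
    (h0 : P 0 0 ≠ 0) : schurMatrix P * C.submatrix Fin.succ Fin.succ = 1 := by
  ext i j
  have h1 := congrFun (congrFun h i.succ) j.succ
  have h2 := congrFun (congrFun h 0) j.succ
  simp only [Matrix.mul_apply, Fin.sum_univ_succ, Matrix.one_apply, Fin.succ_inj] at h1 h2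
  rw [if_neg (Fin.succ_ne_zero j).symm] at h2
  simp only [Matrix.mul_apply, schurMatrix, Matrix.of_apply, Matrix.submatrix_apply, sub_mul,
    Finset.sum_sub_distrib, Matrix.one_apply]
  rw [← h1, hP i.succ 0]
  have h3 : ∑ k : Fin n, P 0 i.succ * P 0 k.succ / P 0 0 * C k.succ j.succ =
      P 0 i.succ / P 0 0 * ∑ k : Fin n, P 0 k.succ * C k.succ j.succ := by
    rw [Finset.mul_sum]
    exact Finset.sum_congr rfl fun k _ => by ring
  rw [h3, eq_neg_of_add_eq_zero_right h2]
  field_simp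
  ring

/-- The completed square on the dual side: the first variable decouples from the inverse form after
a shift of the others by the same multiples of `P 0 i.succ` that occur when it is eliminated from
`P`. -/
theorem quadForm_inverse {n : ℕ} {K : Type*} [Field K]
    {P C : Matrix (Fin (n + 1)) (Fin (n + 1)) K}
    (hC : ∀ i j, C i j = C j i) (h : P * C = 1) (h0 : P 0 0 ≠ 0) (x₀ : K) (x : Fin n → K) :
    quadForm C (Fin.cons x₀ x : Fin (n + 1) → K) = x₀ ^ 2 / P 0 0 +
      quadForm (C.submatrix Fin.succ Fin.succ) fun i => x i + x₀ * (-(P 0 i.succ / P 0 0)) := by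
  have h1 : ∀ i : Fin n, ∑ j : Fin n, C i.succ j.succ * (-(P 0 j.succ / P 0 0)) = C 0 i.succ := by
    intro i
    have h2 := congrFun (congrFun h 0) i.succ
    simp only [Matrix.mul_apply, Fin.sum_univ_succ, Matrix.one_apply] at h2
    rw [if_neg (Fin.succ_ne_zero i).symm] at h2
    have h3 : ∑ j : Fin n, C i.succ j.succ * (-(P 0 j.succ / P 0 0)) =
        -(∑ k : Fin n, P 0 k.succ * C k.succ i.succ) / P 0 0 := by
      rw [neg_div, Finset.sum_div, ← Finset.sum_neg_distrib]
      exact Finset.sum_congr rfl fun k _ => by rw [hC]; ring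
    rw [h3, eq_neg_of_add_eq_zero_right h2]
    field_simp
  have h4 : quadForm (C.submatrix Fin.succ Fin.succ) (fun i => -(P 0 i.succ / P 0 0)) =
      C 0 0 - 1 / P 0 0 := by
    have e1 : quadForm (C.submatrix Fin.succ Fin.succ) (fun i => -(P 0 i.succ / P 0 0)) =
        ∑ i : Fin n, -(P 0 i.succ / P 0 0) *
          ∑ j : Fin n, C i.succ j.succ * (-(P 0 j.succ / P 0 0)) := by
      simp only [quadForm, Matrix.submatrix_apply, Finset.mul_sum]
      exact Finset.sum_congr rfl fun i _ => Finset.sum_congr rfl fun j _ => by ring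
    simp only [e1, h1]
    have h2 := congrFun (congrFun h 0) 0
    simp only [Matrix.mul_apply, Fin.sum_univ_succ, Matrix.one_apply_eq] at h2
    have h3 : ∑ i : Fin n, -(P 0 i.succ / P 0 0) * C 0 i.succ =
        -(∑ k : Fin n, P 0 k.succ * C k.succ 0) / P 0 0 := by
      rw [neg_div, Finset.sum_div, ← Finset.sum_neg_distrib]
      exact Finset.sum_congr rfl fun k _ => by rw [hC 0]; ring
    rw [h3, eq_sub_of_add_eq' h2]
    field_simp
    ring
  rw [quadForm_add_smul (P := C.submatrix Fin.succ Fin.succ) (fun i j => hC _ _), h4,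
    quadForm_cons hC]
  simp only [Matrix.submatrix_apply, h1]
  have h5 : ∑ i, x i * C 0 i.succ = ∑ j, C 0 j.succ * x j :=
    Finset.sum_congr rfl fun _ _ => mul_comm _ _
  rw [h5]
  ring

theorem quadForm_ofReal {ι : Type*} [Fintype ι] (P : Matrix ι ι ℝ) (x : ι → ℝ) :
    quadForm (P.map Complex.ofReal) (fun i => (x i : ℂ)) = ((quadForm P x : ℝ) : ℂ) := by
  simp [quadForm]

/-! ### Coercive matrices and summability of lattice Gaussians. -/

/-- A matrix whose quadratic form is bounded below by a multiple of the square norm. -/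
def CoerciveMatrix {ι : Type*} [Fintype ι] (P : Matrix ι ι ℝ) : Prop :=
  ∃ l : ℝ, 0 < l ∧ ∀ x : ι → ℝ, l * ∑ i, x i ^ 2 ≤ quadForm P x

theorem CoerciveMatrix.submatrix {n : ℕ} {C : Matrix (Fin (n + 1)) (Fin (n + 1)) ℝ}
    (hC : ∀ i j, C i j = C j i) (h : CoerciveMatrix C) :
    CoerciveMatrix (C.submatrix Fin.succ Fin.succ) := by
  obtain ⟨l, hl, h⟩ := h
  refine ⟨l, hl, fun x => ?_⟩
  have := h (Fin.cons 0 x : Fin (n + 1) → ℝ)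
  rw [quadForm_cons hC, Fin.sum_univ_succ] at this
  simpa using this

theorem CoerciveMatrix.apply_zero_pos {n : ℕ} {P : Matrix (Fin (n + 1)) (Fin (n + 1)) ℝ}
    (hP : ∀ i j, P i j = P j i) (h : CoerciveMatrix P) : 0 < P 0 0 := by
  obtain ⟨l, hl, h⟩ := h
  have := h (Fin.cons 1 0 : Fin (n + 1) → ℝ)
  rw [quadForm_cons hP, Fin.sum_univ_succ] at this
  simp [quadForm] at this
  linarith

/-- The Schur complement is the original form at the value of the first variable that minimizes it,
so the coercivity constant is inherited. -/
theorem CoerciveMatrix.schurMatrix {n : ℕ} {P : Matrix (Fin (n + 1)) (Fin (n + 1)) ℝ}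
    (hP : ∀ i j, P i j = P j i) (h : CoerciveMatrix P) : CoerciveMatrix (schurMatrix P) := by
  have h0 := h.apply_zero_pos hP
  obtain ⟨l, hl, h⟩ := h
  refine ⟨l, hl, fun x => ?_⟩
  have h1 := h (Fin.cons (-(∑ j, P 0 j.succ * x j) / P 0 0) x : Fin (n + 1) → ℝ)
  rw [quadForm_cons hP, Fin.sum_univ_succ] at h1
  simp only [Fin.cons_zero, Fin.cons_succ] at h1
  rw [quadForm_schurMatrix]
  set B := ∑ j, P 0 j.succ * x j with hB
  have h2 : P 0 0 * (-B / P 0 0) ^ 2 + 2 * (-B / P 0 0) * B = -(B ^ 2 / P 0 0) := by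
    field_simp; ring
  have h3 : 0 ≤ l * (-B / P 0 0) ^ 2 := by positivity
  rw [mul_add] at h1
  linarith

theorem CoerciveMatrix.summable {ι : Type*} [Fintype ι] {P : Matrix ι ι ℝ} (h : CoerciveMatrix P)
    (f : ι → ℂ) : Summable fun m : ι → ℤ =>
      ‖Complex.exp (-quadForm (P.map Complex.ofReal) (fun i => (m i : ℂ)) / 2 + ∑ i, f i * m i)‖ := by
  obtain ⟨l, hl, h⟩ := h
  have h1 := summable_prod_of_summable (ι := ι) (summable_exp_neg_sq_add (a := l / 2)
    (by positivity) (∑ i, |(f i).re|)) fun _ => (Real.exp_pos _).le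
  refine Summable.of_nonneg_of_le (fun _ => norm_nonneg _) (fun m => ?_) h1
  rw [Complex.norm_exp, ← Real.exp_sum]
  refine Real.exp_le_exp.2 ?_
  have e1 : (-quadForm (P.map Complex.ofReal) (fun i => (m i : ℂ)) / 2 + ∑ i, f i * m i).re =
      -quadForm P (fun i => (m i : ℝ)) / 2 + ∑ i, (f i).re * m i := by
    have := quadForm_ofReal P (fun i => (m i : ℝ))
    simp only [Complex.ofReal_intCast] at this
    rw [this, Complex.add_re, Complex.re_sum]
    congr 1
    · rw [← Complex.ofReal_neg, show (2 : ℂ) = ((2 : ℝ) : ℂ) by norm_num, ← Complex.ofReal_div,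
        Complex.ofReal_re]
    · exact Finset.sum_congr rfl fun i _ => by
        rw [← Complex.ofReal_intCast, Complex.re_mul_ofReal]
  rw [e1, Finset.sum_add_distrib, Finset.sum_neg_distrib, ← Finset.mul_sum]
  have h2 := h fun i => (m i : ℝ)
  have h3 : ∑ i, (f i).re * m i ≤ ∑ i, (∑ i, |(f i).re|) * |(m i : ℝ)| := by
    refine Finset.sum_le_sum fun i _ => ?_
    refine (le_abs_self _).trans ?_
    rw [abs_mul]
    exact mul_le_mul_of_nonneg_right (Finset.single_le_sum (f := fun i => |(f i).re|)
      (fun _ _ => abs_nonneg _) (Finset.mem_univ i)) (abs_nonneg _)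
  linarith

open Complex in
theorem CoerciveMatrix.summable_dual {ι : Type*} [Fintype ι] {C : Matrix ι ι ℝ}
    (hC : ∀ i j, C i j = C j i) (h : CoerciveMatrix C) (f : ι → ℂ) : Summable fun q : ι → ℤ =>
      ‖cexp (quadForm (C.map ofReal) (fun i => f i + 2 * Real.pi * I * (q i : ℂ)) / 2)‖ := by
  have h' : CoerciveMatrix ((4 * Real.pi ^ 2) • C) := by
    obtain ⟨l, hl, h⟩ := h
    refine ⟨4 * Real.pi ^ 2 * l, by positivity, fun x => ?_⟩
    have e1 : quadForm ((4 * Real.pi ^ 2) • C) x = 4 * Real.pi ^ 2 * quadForm C x := by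
      simp only [quadForm, Matrix.smul_apply, smul_eq_mul, Finset.mul_sum, mul_assoc]
    rw [e1, mul_assoc]
    exact mul_le_mul_of_nonneg_left (h x) (by positivity)
  have h1 := (h'.summable fun j => 2 * Real.pi * I * ∑ i, f i * (C i j : ℂ)).mul_left
    ‖cexp (quadForm (C.map ofReal) f / 2)‖
  refine h1.congr fun q => ?_
  rw [← norm_mul, ← Complex.exp_add]
  congr 2
  rw [quadForm_add_smul (fun i j => by simp only [Matrix.map_apply, hC i j])]
  have e2 : quadForm (((4 * Real.pi ^ 2) • C).map ofReal) (fun i => (q i : ℂ)) =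
      4 * Real.pi ^ 2 * quadForm (C.map ofReal) (fun i => (q i : ℂ)) := by
    simp only [quadForm, Matrix.map_apply, Matrix.smul_apply, smul_eq_mul, Finset.mul_sum]
    refine Finset.sum_congr rfl fun i _ => Finset.sum_congr rfl fun j _ => ?_
    push_cast; ring
  have e3 : ∑ j, (2 * Real.pi * I * ∑ i, f i * (C i j : ℂ)) * (q j : ℂ) =
      2 * Real.pi * I * ∑ i, f i * ∑ j, (C.map ofReal) i j * (q j : ℂ) := by
    simp only [Finset.mul_sum, Finset.sum_mul, Matrix.map_apply]
    rw [Finset.sum_comm]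
    exact Finset.sum_congr rfl fun i _ => Finset.sum_congr rfl fun j _ => by ring
  rw [e2, e3]
  ring_nf
  rw [I_sq]
  ring

open Complex in
/-- Poisson summation for a Gaussian on `ℤ ^ n`. -/
theorem tsum_gaussian (n : ℕ) : ∀ P C : Matrix (Fin n) (Fin n) ℝ, (∀ i j, P i j = P j i) →
    (∀ i j, C i j = C j i) → P * C = 1 → CoerciveMatrix P → CoerciveMatrix C →
    ∃ c : ℝ, 0 < c ∧ ∀ f : Fin n → ℂ,
      ∑' m : Fin n → ℤ, cexp (-quadForm (P.map ofReal) (fun i => (m i : ℂ)) / 2 + ∑ i, f i * m i) =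
      c * ∑' q : Fin n → ℤ,
        cexp (quadForm (C.map ofReal) (fun i => f i + 2 * Real.pi * I * (q i : ℂ)) / 2) := by
  induction n with
  | zero =>
    intro P C _ _ _ _ _
    refine ⟨1, one_pos, fun f => ?_⟩
    rw [tsum_eq_single default fun m hm => absurd (Subsingleton.elim _ _) hm,
      tsum_eq_single default fun m hm => absurd (Subsingleton.elim _ _) hm]
    simp [quadForm]
  | succ n ih =>
    intro P C hP hC hPC hPc hCc
    have ha := hPc.apply_zero_pos hP
    set a := P 0 0 with haP
    have ha' : (a : ℂ) ≠ 0 := by exact_mod_cast ha.ne'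
    obtain ⟨c₁, hc₁, h₁⟩ := tsum_gaussian_one ha
    obtain ⟨c₂, hc₂, h₂⟩ := ih (schurMatrix P) (C.submatrix Fin.succ Fin.succ)
      (fun i j => by
        simp only [schurMatrix, Matrix.of_apply, hP i.succ j.succ, mul_comm])
      (fun i j => hC _ _) (schurMatrix_mul hP hPC ha.ne') (hPc.schurMatrix hP) (hCc.submatrix hC)
    refine ⟨c₁ * c₂, mul_pos hc₁ hc₂, fun f => ?_⟩
    have hPm : ∀ i j, (P.map ofReal) i j = (P.map ofReal) j i := fun i j => by
      simp only [Matrix.map_apply, hP i j]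
    have hCm : ∀ i j, (C.map ofReal) i j = (C.map ofReal) j i := fun i j => by
      simp only [Matrix.map_apply, hC i j]
    have hPCm : P.map ofReal * C.map ofReal = 1 := by
      have := congrArg (fun A : Matrix (Fin (n + 1)) (Fin (n + 1)) ℝ => A.map ofRealHom) hPC
      rw [Matrix.map_mul, Matrix.map_one _ (map_zero _) (map_one _)] at this
      exact this
    let b : Fin n → ℝ := fun j => P 0 j.succ
    let D : (Fin n → ℤ) → ℂ := fun m => quadForm ((P.submatrix Fin.succ Fin.succ).map ofReal)
      fun i => (m i : ℂ)
    let bm : (Fin n → ℤ) → ℂ := fun m => ∑ j, (b j : ℂ) * m j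
    let F₀ : ℤ → ℂ := fun q => f 0 + 2 * Real.pi * I * q
    have hexpP : ∀ (m₀ : ℤ) (m : Fin n → ℤ),
        -quadForm (P.map ofReal) (fun i => ((Fin.cons m₀ m : Fin (n + 1) → ℤ) i : ℂ)) / 2 +
          ∑ i, f i * ((Fin.cons m₀ m : Fin (n + 1) → ℤ) i : ℂ) =
        (-(a / 2) * (m₀ : ℂ) ^ 2 + (f 0 - bm m) * m₀) +
          (-D m / 2 + ∑ i : Fin n, f i.succ * m i) := by
      intro m₀ m
      have e1 : (fun i => ((Fin.cons m₀ m : Fin (n + 1) → ℤ) i : ℂ)) =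
          (Fin.cons (m₀ : ℂ) (fun i => (m i : ℂ)) : Fin (n + 1) → ℂ) := by
        funext i; refine Fin.cases ?_ (fun i => ?_) i <;> simp
      rw [e1, quadForm_cons hPm, Fin.sum_univ_succ]
      simp only [Fin.cons_zero, Fin.cons_succ, D, bm, b, Matrix.map_apply, ← haP]
      rw [show (P.map ofReal).submatrix Fin.succ Fin.succ =
        (P.submatrix Fin.succ Fin.succ).map ofReal from rfl]
      ring
    -- After Poisson summation in the first coordinate, the square in `bm m` turns the remaining
    -- form into the Schur complement and the cross term shifts the source by a multiple of the
    -- complex number `F₀ q₀`.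
    have hexpH : ∀ (q₀ : ℤ) (m : Fin n → ℤ),
        (f 0 - bm m + 2 * Real.pi * I * q₀) ^ 2 / (2 * a) +
          (-D m / 2 + ∑ i : Fin n, f i.succ * m i) =
        F₀ q₀ ^ 2 / (2 * a) + (-quadForm ((schurMatrix P).map ofReal) (fun i => (m i : ℂ)) / 2 +
          ∑ i : Fin n, (f i.succ + F₀ q₀ * (-(b i / a))) * m i) := by
      intro q₀ m
      have e1 : quadForm ((schurMatrix P).map ofReal) (fun i => (m i : ℂ)) =
          D m - bm m ^ 2 / a := by
        have := quadForm_schurMatrix (P.map ofReal) (fun i => (m i : ℂ))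
        rw [show (schurMatrix P).map ofReal = schurMatrix (P.map ofReal) by
          ext i j; simp [schurMatrix], this]
        rfl
      have e2 : ∑ i : Fin n, (f i.succ + F₀ q₀ * (-(b i / a))) * m i =
          ∑ i : Fin n, f i.succ * m i - F₀ q₀ * bm m / a := by
        simp only [bm, add_mul, Finset.sum_add_distrib, Finset.mul_sum, Finset.sum_div,
          sub_eq_add_neg, ← Finset.sum_neg_distrib]
        congr 1
        exact Finset.sum_congr rfl fun i _ => by ring
      rw [e1, e2, show f 0 - bm m + 2 * Real.pi * I * q₀ = F₀ q₀ - bm m by simp only [F₀]; ring]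
      field_simp
      ring
    have hexpC : ∀ (q₀ : ℤ) (q : Fin n → ℤ),
        quadForm (C.map ofReal) (fun i => f i + 2 * Real.pi * I *
          ((Fin.cons q₀ q : Fin (n + 1) → ℤ) i : ℂ)) / 2 =
        F₀ q₀ ^ 2 / (2 * a) + quadForm ((C.submatrix Fin.succ Fin.succ).map ofReal)
          (fun i => (f i.succ + F₀ q₀ * (-(b i / a))) + 2 * Real.pi * I * (q i : ℂ)) / 2 := by
      intro q₀ q
      have e1 : (fun i => f i + 2 * Real.pi * I * ((Fin.cons q₀ q : Fin (n + 1) → ℤ) i : ℂ)) =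
          (Fin.cons (F₀ q₀) (fun i => f i.succ + 2 * Real.pi * I * (q i : ℂ)) :
            Fin (n + 1) → ℂ) := by
        funext i; refine Fin.cases ?_ (fun i => ?_) i <;> simp [F₀]
      rw [e1, quadForm_inverse hCm hPCm (by simpa using ha')]
      simp only [Matrix.map_apply, ← haP, b]
      rw [show (C.map ofReal).submatrix Fin.succ Fin.succ =
        (C.submatrix Fin.succ Fin.succ).map ofReal from rfl]
      have e2 : (fun i : Fin n => f i.succ + 2 * Real.pi * I * (q i : ℂ) +
          F₀ q₀ * (-((P 0 i.succ : ℂ) / a))) = fun i : Fin n =>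
          (f i.succ + F₀ q₀ * (-((P 0 i.succ : ℂ) / a))) + 2 * Real.pi * I * (q i : ℂ) := by
        funext i; ring
      rw [e2]
      field_simp
    have hsumL := (hPc.summable f).of_norm
    have hsumR := (hCc.summable_dual hC f).of_norm
    have hL : ∑' m : Fin (n + 1) → ℤ,
        cexp (-quadForm (P.map ofReal) (fun i => (m i : ℂ)) / 2 + ∑ i, f i * m i) =
        ∑' m : Fin n → ℤ, ∑' m₀ : ℤ, cexp (-(a / 2) * (m₀ : ℂ) ^ 2 + (f 0 - bm m) * m₀) *
          cexp (-D m / 2 + ∑ i : Fin n, f i.succ * m i) := by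
      rw [← (Fin.consEquiv fun _ => ℤ).tsum_eq]
      have h3 := (Fin.consEquiv fun _ : Fin (n + 1) => ℤ).summable_iff.2 hsumL
      rw [← (Equiv.prodComm (Fin n → ℤ) ℤ).tsum_eq]
      have h4 := (Equiv.prodComm (Fin n → ℤ) ℤ).summable_iff.2 h3
      refine (Summable.tsum_prod h4).trans (tsum_congr fun m => tsum_congr fun m₀ => ?_)
      rw [← Complex.exp_add, ← hexpP]
      rfl
    have hR : ∑' q : Fin (n + 1) → ℤ,
        cexp (quadForm (C.map ofReal) (fun i => f i + 2 * Real.pi * I * (q i : ℂ)) / 2) =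
        ∑' q₀ : ℤ, ∑' q : Fin n → ℤ, cexp (F₀ q₀ ^ 2 / (2 * a)) *
          cexp (quadForm ((C.submatrix Fin.succ Fin.succ).map ofReal)
          (fun i => (f i.succ + F₀ q₀ * (-(b i / a))) + 2 * Real.pi * I * (q i : ℂ)) / 2) := by
      rw [← (Fin.consEquiv fun _ => ℤ).tsum_eq]
      have h3 := (Fin.consEquiv fun _ : Fin (n + 1) => ℤ).summable_iff.2 hsumR
      refine (Summable.tsum_prod h3).trans (tsum_congr fun q₀ => tsum_congr fun q => ?_)
      rw [← Complex.exp_add, ← hexpC]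
      rfl
    let H : (Fin n → ℤ) → ℤ → ℂ := fun m q₀ => cexp (F₀ q₀ ^ 2 / (2 * a)) *
      cexp (-quadForm ((schurMatrix P).map ofReal) (fun i => (m i : ℂ)) / 2 +
        ∑ i : Fin n, (f i.succ + F₀ q₀ * (-(b i / a))) * m i)
    -- The dual variable `q₀` changes the source of the field coordinates only by an imaginary
    -- amount. In absolute value the double sum therefore factorizes, with source taken at `q₀ = 0`,
    -- and the sums may be exchanged.
    have hsumH : Summable (Function.uncurry H) := by
      have h3 := (hPc.schurMatrix hP).summable fun i => f i.succ + F₀ 0 * (-(b i / a))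
      have h4 : Summable fun q : ℤ => ‖cexp (F₀ q ^ 2 / (2 * a))‖ := by
        have h5 : CoerciveMatrix (Matrix.of fun _ _ : Fin 1 => 1 / a) :=
          ⟨1 / a, by positivity, fun x => by simp [quadForm, sq, mul_assoc]⟩
        have h6 := h5.summable_dual (fun _ _ => rfl) fun _ => f 0
        rw [← (Equiv.funUnique (Fin 1) ℤ).symm.summable_iff] at h6
        refine h6.congr fun q => ?_
        simp only [Function.comp, quadForm, F₀]
        congr 2
        simp
        field_simp
      refine Summable.of_norm ((h3.mul_of_nonneg h4 (fun _ => norm_nonneg _)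
        fun _ => norm_nonneg _).congr fun p => ?_)
      simp only [Function.uncurry, H]
      rw [norm_mul, mul_comm]
      congr 1
      rw [Complex.norm_exp, Complex.norm_exp]
      congr 1
      simp only [Complex.add_re, Complex.re_sum]
      congr 1
      refine Finset.sum_congr rfl fun i _ => ?_
      rw [← Complex.ofReal_intCast, Complex.re_mul_ofReal, Complex.re_mul_ofReal]
      congr 1
      have e3 : (-((b i : ℂ) / a)) = ((-(b i / a) : ℝ) : ℂ) := by push_cast; ring
      rw [e3, Complex.add_re, Complex.add_re, Complex.re_mul_ofReal, Complex.re_mul_ofReal]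
      congr 2
      simp [F₀]
    rw [hL, hR]
    have hinner : ∀ m : Fin n → ℤ, ∑' m₀ : ℤ,
        cexp (-(a / 2) * (m₀ : ℂ) ^ 2 + (f 0 - bm m) * m₀) *
          cexp (-D m / 2 + ∑ i : Fin n, f i.succ * m i) =
        c₁ * ∑' q₀ : ℤ, H m q₀ := by
      intro m
      rw [tsum_mul_right, h₁, mul_assoc, ← tsum_mul_right]
      congr 1
      refine tsum_congr fun q₀ => ?_
      rw [← Complex.exp_add, hexpH, Complex.exp_add]
    rw [tsum_congr hinner, tsum_mul_left, ← Summable.tsum_comm hsumH, Complex.ofReal_mul, mul_assoc]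
    congr 1
    rw [← tsum_mul_left]
    refine tsum_congr fun q₀ => ?_
    have e1 : ∑' m, H m q₀ = cexp (F₀ q₀ ^ 2 / (2 * a)) * ∑' m : Fin n → ℤ,
        cexp (-quadForm ((schurMatrix P).map ofReal) (fun i => (m i : ℂ)) / 2 +
          ∑ i : Fin n, (f i.succ + F₀ q₀ * (-(b i / a))) * m i) := tsum_mul_left
    rw [e1, h₂, tsum_mul_left]
    ring

/-! ### Duality between the integer-valued field and the Coulomb gas -/

theorem quadForm_submatrix {ι κ K : Type*} [Fintype ι] [Fintype κ] [CommRing K] (P : Matrix κ κ K)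
    (e : ι ≃ κ) (x : κ → K) : quadForm (P.submatrix e e) (fun i => x (e i)) = quadForm P x := by
  unfold quadForm
  rw [← e.sum_comp]
  refine Finset.sum_congr rfl fun i _ => ?_
  rw [← e.sum_comp]
  rfl

theorem CoerciveMatrix.reindex {ι κ : Type*} [Fintype ι] [Fintype κ] {P : Matrix κ κ ℝ}
    (h : CoerciveMatrix P) (e : ι ≃ κ) : CoerciveMatrix (P.submatrix e e) := by
  obtain ⟨l, hl, h⟩ := h
  refine ⟨l, hl, fun x => ?_⟩
  have h1 := h fun k => x (e.symm k)
  rw [← quadForm_submatrix P e, ← e.sum_comp] at h1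
  simpa using h1

open Complex in
/-- Poisson summation for a Gaussian on the lattice `κ → ℤ`. -/
theorem tsum_gaussian_fintype {κ : Type*} [Fintype κ] [DecidableEq κ] {P C : Matrix κ κ ℝ}
    (hP : ∀ i j, P i j = P j i) (hC : ∀ i j, C i j = C j i) (hPC : P * C = 1)
    (hPc : CoerciveMatrix P) (hCc : CoerciveMatrix C) :
    ∃ c : ℝ, 0 < c ∧ ∀ f : κ → ℂ,
      ∑' m : κ → ℤ, cexp (-quadForm (P.map ofReal) (fun i => (m i : ℂ)) / 2 + ∑ i, f i * m i) =
      c * ∑' q : κ → ℤ,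
        cexp (quadForm (C.map ofReal) (fun i => f i + 2 * Real.pi * I * (q i : ℂ)) / 2) := by
  let e : Fin (Fintype.card κ) ≃ κ := (Fintype.equivFin κ).symm
  obtain ⟨c, hc, h⟩ := tsum_gaussian _ (P.submatrix e e) (C.submatrix e e) (fun i j => hP _ _)
    (fun i j => hC _ _) (by rw [Matrix.submatrix_mul_equiv, hPC, Matrix.submatrix_one_equiv])
    (hPc.reindex e) (hCc.reindex e)
  refine ⟨c, hc, fun f => ?_⟩
  have h1 := h fun i => f (e i)
  let E : (κ → ℤ) ≃ (Fin (Fintype.card κ) → ℤ) := e.symm.arrowCongr (Equiv.refl ℤ)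
  have hE : ∀ m i, E m i = m (e i) := fun m i => rfl
  rw [← E.tsum_eq, ← E.tsum_eq (f := fun q : Fin (Fintype.card κ) → ℤ => cexp _)] at h1
  have e1 : ∀ m : κ → ℤ, quadForm ((P.submatrix e e).map ofReal) (fun i => (E m i : ℂ)) =
      quadForm (P.map ofReal) (fun i => (m i : ℂ)) := fun m =>
    quadForm_submatrix (P.map ofReal) e fun i => (m i : ℂ)
  have e2 : ∀ m : κ → ℤ, ∑ i, f (e i) * (E m i : ℂ) = ∑ i, f i * (m i : ℂ) := fun m =>
    e.sum_comp fun i => f i * (m i : ℂ)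
  have e3 : ∀ q : κ → ℤ, quadForm ((C.submatrix e e).map ofReal)
      (fun i => f (e i) + 2 * Real.pi * I * (E q i : ℂ)) =
      quadForm (C.map ofReal) (fun i => f i + 2 * Real.pi * I * (q i : ℂ)) := fun q =>
    quadForm_submatrix (C.map ofReal) e fun i => f i + 2 * Real.pi * I * (q i : ℂ)
  simpa only [e1, e2, e3] using h1

/-- The Dirichlet form as a bilinear map. -/
noncomputable def dirBilin {V : Type*} [Fintype V] (G : SimpleGraph V) :
    (V → ℝ) →ₗ[ℝ] (V → ℝ) →ₗ[ℝ] ℝ :=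
  LinearMap.mk₂ ℝ (dirForm G)
    (fun a a' b => by
      simp only [← pairing_neg_laplacian, map_add, neg_add, pairing_add_left])
    (fun c a b => by
      simp only [← pairing_neg_laplacian, map_smul, ← smul_neg, pairing_smul_left, smul_eq_mul])
    (fun a b b' => by simp only [← pairing_neg_laplacian, pairing_add_right])
    (fun c a b => by simp only [← pairing_neg_laplacian, pairing_smul_right, smul_eq_mul])

theorem dirBilin_apply {V : Type*} [Fintype V] (G : SimpleGraph V) (a b : V → ℝ) :
    dirBilin G a b = dirForm G a b := rfl

/-- The Green form as a bilinear map. -/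
noncomputable def greenBilin {V : Type*} [Fintype V] (G : SimpleGraph V) (hG : G.Connected) :
    (V → ℝ) →ₗ[ℝ] (V → ℝ) →ₗ[ℝ] ℝ :=
  LinearMap.mk₂ ℝ (fun q q' => pairing q (-(laplacianPseudoinverse G hG q')))
    (fun q₁ q₂ q' => by simp only [pairing_add_left])
    (fun c q q' => by simp only [pairing_smul_left, smul_eq_mul])
    (fun q q₁ q₂ => by simp only [map_add, neg_add, pairing_add_right])
    (fun c q q' => by simp only [map_smul, ← smul_neg, pairing_smul_right, smul_eq_mul])

theorem greenBilin_apply {V : Type*} [Fintype V] (G : SimpleGraph V) (hG : G.Connected)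
    (q q' : V → ℝ) : greenBilin G hG q q' = pairing q (-(laplacianPseudoinverse G hG q')) := rfl

theorem greenBilin_symm {V : Type*} [Fintype V] (G : SimpleGraph V) (hG : G.Connected)
    {q q' : V → ℝ} (hq : ∑ x, q x = 0) (hq' : ∑ x, q' x = 0) :
    greenBilin G hG q q' = greenBilin G hG q' q := by
  rw [greenBilin_apply, greenBilin_apply, pairing_eq_dirForm G hG hq, pairing_eq_dirForm G hG hq',
    dirForm_comm]

theorem sum_gram {ι E : Type*} [Fintype ι] [AddCommGroup E] [Module ℝ E]
    (B : E →ₗ[ℝ] E →ₗ[ℝ] ℝ) (u : ι → E) (t : ℝ) (x y : ι → ℝ) :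
    ∑ i, x i * ∑ j, t * B (u i) (u j) * y j = t * B (∑ i, x i • u i) (∑ i, y i • u i) := by
  simp only [map_sum, LinearMap.sum_apply, map_smul, LinearMap.smul_apply, smul_eq_mul,
    Finset.mul_sum]
  rw [Finset.sum_comm]
  exact Finset.sum_congr rfl fun i _ => Finset.sum_congr rfl fun j _ => by ring

theorem quadForm_eq_sum {ι K : Type*} [Fintype ι] [CommRing K] (P : Matrix ι ι K) (x : ι → K) :
    quadForm P x = ∑ i, x i * ∑ j, P i j * x j := by
  simp only [quadForm, Finset.mul_sum]
  exact Finset.sum_congr rfl fun i _ => Finset.sum_congr rfl fun j _ => by ring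

/-! ### The pinned field and its dual: functions vanishing at a vertex, and neutral charges. -/

section

variable {V : Type*} [DecidableEq V]

/-- The extension of a function by zero at `v`. -/
def extendZero {R : Type*} [Zero R] (v : V) (x : {j // j ≠ v} → R) (j : V) : R :=
  if h : j ≠ v then x ⟨j, h⟩ else 0

theorem extendZero_restrict {R : Type*} [Zero R] (v : V) {m : V → R}
    (hm : m v = 0) : extendZero v (fun i : {j // j ≠ v} => m i) = m := by
  funext j
  unfold extendZero
  split_ifs with h
  · rfl
  · rw [not_not] at h
    rw [h, hm]

theorem injective_extendZero {R : Type*} [Zero R] (v : V) :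
    Function.Injective (extendZero (R := R) v) := by
  intro x y h
  funext i
  have := congrFun h i
  simpa [extendZero, i.2] using this

variable [Fintype V]

/-- The unit charge at `j`, compensated at `v`. -/
def dipole (v j : V) : V → ℝ := Pi.single j 1 - Pi.single v 1

theorem sum_dipole (v j : V) : ∑ x, dipole v j x = 0 := by
  simp [dipole, Finset.sum_sub_distrib]

theorem pairing_dipole (v j : V) (a : V → ℝ) : pairing (dipole v j) a = a j - a v := by
  simp [pairing, dipole, sub_mul, Finset.sum_sub_distrib, Pi.single_apply]

/-- The neutral extension of a charge density. -/
def extendNeutral {R : Type*} [AddCommGroup R] (v : V) (x : {j // j ≠ v} → R) (j : V) : R :=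
  if h : j ≠ v then x ⟨j, h⟩ else -∑ i, x i

theorem Fintype.sum_eq_add_sum_ne {R : Type*} [AddCommMonoid R] (v : V) (g : V → R) :
    ∑ j, g j = g v + ∑ i : {j // j ≠ v}, g i := by
  rw [← Finset.add_sum_erase _ _ (Finset.mem_univ v)]
  congr 1
  rw [Finset.sum_subtype (Finset.univ.erase v) (p := fun j => j ≠ v) (by simp)]

theorem sum_extendNeutral {R : Type*} [AddCommGroup R] (v : V) (x : {j // j ≠ v} → R) :
    ∑ j, extendNeutral v x j = 0 := by
  rw [Fintype.sum_eq_add_sum_ne v]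
  have : ∀ i : {j // j ≠ v}, extendNeutral v x i = x i := fun i => by simp [extendNeutral, i.2]
  simp only [this]
  simp [extendNeutral]

theorem extendNeutral_restrict {R : Type*} [AddCommGroup R] (v : V) {q : V → R}
    (hq : ∑ j, q j = 0) : extendNeutral v (fun i : {j // j ≠ v} => q i) = q := by
  funext j
  unfold extendNeutral
  split_ifs with h
  · rfl
  · rw [not_not] at h
    rw [Fintype.sum_eq_add_sum_ne v] at hq
    rw [h, eq_neg_of_add_eq_zero_left hq]

theorem sum_smul_single (v : V) (x : {j // j ≠ v} → ℝ) :
    ∑ i, x i • (Pi.single (i : V) (1 : ℝ) : V → ℝ) = extendZero v x := by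
  funext j
  simp only [Finset.sum_apply, Pi.smul_apply, smul_eq_mul, extendZero, Pi.single_apply, mul_ite,
    mul_one, mul_zero]
  split_ifs with h
  · rw [Finset.sum_eq_single ⟨j, h⟩]
    · simp
    · intro i _ hi
      rw [if_neg]
      exact fun hj => hi (Subtype.ext hj.symm)
    · simp
  · rw [not_not] at h
    refine Finset.sum_eq_zero fun i _ => if_neg ?_
    rw [h]
    exact fun hj => i.2 hj.symm

theorem sum_smul_dipole (v : V) (x : {j // j ≠ v} → ℝ) :
    ∑ i, x i • dipole v (i : V) = extendNeutral v x := by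
  simp only [dipole, smul_sub, Finset.sum_sub_distrib, sum_smul_single, ← Finset.sum_smul]
  funext j
  simp only [Pi.sub_apply, Pi.smul_apply, smul_eq_mul, extendZero, extendNeutral, Pi.single_apply]
  by_cases h : j = v <;> simp [h]

/-- The precision matrix of the field pinned at `v`. -/
noncomputable def precisionMatrix (G : SimpleGraph V) (β : ℝ) (v : V) :
    Matrix {j // j ≠ v} {j // j ≠ v} ℝ :=
  Matrix.of fun i j => β * dirBilin G (Pi.single (i : V) 1) (Pi.single (j : V) 1)

/-- The covariance matrix of the field pinned at `v`. -/
noncomputable def covarianceMatrix (G : SimpleGraph V) (hG : G.Connected) (β : ℝ) (v : V) :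
    Matrix {j // j ≠ v} {j // j ≠ v} ℝ :=
  Matrix.of fun i j => β⁻¹ * greenBilin G hG (dipole v i) (dipole v j)

theorem quadForm_precisionMatrix (G : SimpleGraph V) (β : ℝ) (v : V) (x : {j // j ≠ v} → ℝ) :
    quadForm (precisionMatrix G β v) x = β * dirForm G (extendZero v x) (extendZero v x) := by
  rw [quadForm_eq_sum]
  refine (sum_gram (dirBilin G) (fun i : {j // j ≠ v} => Pi.single (i : V) 1) β x x).trans ?_
  rw [sum_smul_single]
  rfl

theorem sum_covarianceMatrix (G : SimpleGraph V) (hG : G.Connected) (β : ℝ) (v : V)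
    (x y : {j // j ≠ v} → ℝ) :
    ∑ i, x i * ∑ j, covarianceMatrix G hG β v i j * y j =
      β⁻¹ * greenBilin G hG (extendNeutral v x) (extendNeutral v y) := by
  refine (sum_gram (greenBilin G hG) (fun i : {j // j ≠ v} => dipole v (i : V)) β⁻¹ x y).trans ?_
  rw [sum_smul_dipole, sum_smul_dipole]

/-- A column of the covariance is, up to β⁻¹, the potential of a dipole minus its value at `v`.
Extended by zero it differs from the potential by a constant, which the Dirichlet form ignores, and
the Laplacian of the potential returns the dipole. -/
theorem precisionMatrix_mul_covarianceMatrix (G : SimpleGraph V) (hG : G.Connected) {β : ℝ}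
    (hβ : β ≠ 0) (v : V) : precisionMatrix G β v * covarianceMatrix G hG β v = 1 := by
  ext i k
  set g : V → ℝ := -(laplacianPseudoinverse G hG (dipole v k)) with hg
  have h1 : ∀ j : {j // j ≠ v}, covarianceMatrix G hG β v j k = β⁻¹ * (g j - g v) := fun j => by
    rw [← pairing_dipole]; rfl
  have h2 : extendZero v (fun j : {j // j ≠ v} => g j - g v) = g - fun _ => g v := by
    exact extendZero_restrict v (m := g - fun _ => g v) (by simp)
  have h3 : dirForm G (Pi.single (i : V) 1) (fun _ => g v) = 0 := by simp [dirForm]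
  calc (precisionMatrix G β v * covarianceMatrix G hG β v) i k
      = ∑ j : {j // j ≠ v}, (β * dirBilin G (Pi.single (i : V) 1) (Pi.single (j : V) 1)) *
          (β⁻¹ * (g j - g v)) := by
        rw [Matrix.mul_apply]
        exact Finset.sum_congr rfl fun j _ => by rw [h1]; rfl
    _ = dirBilin G (Pi.single (i : V) 1)
          (∑ j : {j // j ≠ v}, (g j - g v) • (Pi.single (j : V) (1 : ℝ) : V → ℝ)) := by
        rw [map_sum]
        refine Finset.sum_congr rfl fun j _ => ?_
        rw [map_smul, smul_eq_mul]
        field_simp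
    _ = dirForm G (Pi.single (i : V) 1) g := by
        rw [sum_smul_single v (fun j : {j // j ≠ v} => g j - g v), h2, map_sub]
        rw [dirBilin_apply, dirBilin_apply, h3, sub_zero]
    _ = pairing (dipole v k) (Pi.single (i : V) 1) := by
        rw [pairing_eq_dirForm G hG (sum_dipole v _), dirForm_comm]
    _ = (1 : Matrix _ _ ℝ) i k := by
        rw [pairing_dipole, Matrix.one_apply]
        simp [Pi.single_apply, i.2.symm, eq_comm, Subtype.ext_iff]

/-- A function vanishing at `v` is controlled at each point by its Dirichlet energy, with the
resistance between that point and `v` as constant. -/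
theorem coercive_precisionMatrix (G : SimpleGraph V) (hG : G.Connected) {β : ℝ} (hβ : 0 < β)
    (v : V) : CoerciveMatrix (precisionMatrix G β v) := by
  set K := ∑ i : {j // j ≠ v}, greenEnergy G hG (dipole v i) with hK
  have hK0 : 0 ≤ K := Finset.sum_nonneg fun i _ => greenEnergy_nonneg G hG (sum_dipole v i)
  refine ⟨β / (K + 1), by positivity, fun x => ?_⟩
  rw [quadForm_precisionMatrix]
  have h1 : ∑ i, x i ^ 2 ≤ K * dirForm G (extendZero v x) (extendZero v x) := by
    rw [hK, Finset.sum_mul]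
    refine Finset.sum_le_sum fun i _ => ?_
    have h2 := pairing_sq_le G hG (sum_dipole v (i : V)) (extendZero v x)
    rw [pairing_dipole] at h2
    simpa [extendZero, i.2] using h2
  have h3 := dirForm_self_nonneg G (extendZero v x)
  rw [div_mul_eq_mul_div, div_le_iff₀ (by positivity)]
  nlinarith

/-- The degree bound makes the energy of a neutral charge at least 1/8 of its square norm; dropping
the charge at `v` only decreases the norm. -/
theorem coercive_covarianceMatrix {G : SimpleGraph V} (hG : G.Connected)
    (hdeg : ∀ q : V → ℝ, dirForm G q q ≤ 8 * pairing q q) {β : ℝ} (hβ : 0 < β)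
    (v : V) : CoerciveMatrix (covarianceMatrix G hG β v) := by
  refine ⟨β⁻¹ / 8, by positivity, fun x => ?_⟩
  rw [quadForm_eq_sum, sum_covarianceMatrix, div_mul_eq_mul_div, mul_div_assoc]
  refine mul_le_mul_of_nonneg_left ?_ (by positivity)
  have h1 := pairing_self_le_greenEnergy hG hdeg (sum_extendNeutral v x)
  have h2 : ∑ i, x i ^ 2 ≤ pairing (extendNeutral v x) (extendNeutral v x) := by
    rw [pairing, Fintype.sum_eq_add_sum_ne v]
    refine le_add_of_nonneg_of_le (mul_self_nonneg _) (Finset.sum_le_sum fun i _ => ?_)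
    simp [extendNeutral, i.2, sq]
  rw [greenBilin_apply, ← greenEnergy]
  linarith

/-- The Boltzmann weight of the field pinned at `v`, in the external field `f`. -/
noncomputable def fieldWeight (G : SimpleGraph V) (β : ℝ) (v : V) (f : V → ℝ) (m : V → ℤ) : ℝ :=
  if m v = 0 then Real.exp (-(β / 2) * dirForm G (fun j => (m j : ℝ)) (fun j => (m j : ℝ)) +
    pairing (fun j => (m j : ℝ)) f) else 0

theorem injective_extendNeutral {R : Type*} [AddCommGroup R] (v : V) :
    Function.Injective (extendNeutral (R := R) v) := by
  intro x y h
  funext i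
  have := congrFun h i
  simpa [extendNeutral, i.2] using this

theorem fieldWeight_extendZero (G : SimpleGraph V) (β : ℝ) (v : V) (f : V → ℝ)
    (m : {j // j ≠ v} → ℤ) : fieldWeight G β v f (extendZero v m) =
      Real.exp (-quadForm (precisionMatrix G β v) (fun i => (m i : ℝ)) / 2 +
        ∑ i : {j // j ≠ v}, f i * m i) := by
  have h1 : (fun j => ((extendZero v m j : ℤ) : ℝ)) = extendZero v fun i => (m i : ℝ) := by
    funext j; unfold extendZero; split_ifs <;> simp
  have h2 : extendZero v m v = 0 := by simp [extendZero]
  rw [fieldWeight, if_pos h2, h1, quadForm_precisionMatrix]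
  congr 1
  have h3 : pairing (extendZero v fun i => (m i : ℝ)) f = ∑ i : {j // j ≠ v}, f i * m i := by
    rw [pairing, Fintype.sum_eq_add_sum_ne v]
    simp only [extendZero, ne_eq, not_true_eq_false, dite_false, zero_mul, zero_add]
    exact Finset.sum_congr rfl fun i _ => by rw [dif_pos i.2, mul_comm]
  rw [h3]
  ring

theorem support_fieldWeight (G : SimpleGraph V) (β : ℝ) (v : V) (f : V → ℝ) :
    Function.support (fieldWeight G β v f) ⊆ Set.range (extendZero (R := ℤ) v) := by
  intro m hm
  refine ⟨fun i => m i, extendZero_restrict v ?_⟩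
  by_contra h
  exact hm (if_neg h)

theorem summable_fieldWeight (G : SimpleGraph V) (hG : G.Connected) {β : ℝ} (hβ : 0 < β) (v : V)
    (f : V → ℝ) : Summable (fieldWeight G β v f) := by
  rw [← (injective_extendZero (R := ℤ) v).summable_iff fun m hm => by
    by_contra h; exact hm (support_fieldWeight G β v f h)]
  refine ((coercive_precisionMatrix G hG hβ v).summable fun i => (f i : ℂ)).congr fun m => ?_
  rw [Function.comp, fieldWeight_extendZero, Complex.norm_exp]
  have := quadForm_ofReal (precisionMatrix G β v) (fun i => (m i : ℝ))
  simp only [Complex.ofReal_intCast] at this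
  rw [this]
  congr 1
  have h2 : (-((quadForm (precisionMatrix G β v) fun i => (m i : ℝ) : ℝ) : ℂ) / 2 +
      ∑ i : {j // j ≠ v}, (f i : ℂ) * m i) =
      ((-(quadForm (precisionMatrix G β v) fun i => (m i : ℝ)) / 2 +
        ∑ i : {j // j ≠ v}, f i * m i : ℝ) : ℂ) := by push_cast; rfl
  rw [h2, Complex.ofReal_re]

open Complex in
/-- The Laplace transform of the integer-valued field in terms of the Coulomb gas. -/
theorem exists_tsum_fieldWeight {G : SimpleGraph V} (hG : G.Connected)
    (hdeg : ∀ q : V → ℝ, dirForm G q q ≤ 8 * pairing q q) {β : ℝ} (hβ : 0 < β) (v : V) :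
    ∃ c : ℝ, 0 < c ∧ ∀ f : V → ℝ, ∑ j, f j = 0 →
      ∑' m, fieldWeight G β v f m = c * (Real.exp (greenEnergy G hG f / (2 * β)) *
        ∑' q, coulombWeight G hG (2 * Real.pi ^ 2 / β) q *
          Real.cos (2 * Real.pi * pairing (fun x => (q x : ℝ))
            (β⁻¹ • -(laplacianPseudoinverse G hG f)))) := by
  have hP : ∀ i j, precisionMatrix G β v i j = precisionMatrix G β v j i := fun i j => by
    simp only [precisionMatrix, Matrix.of_apply, dirBilin_apply]; rw [dirForm_comm]
  have hC : ∀ i j, covarianceMatrix G hG β v i j = covarianceMatrix G hG β v j i := fun i j => by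
    simp only [covarianceMatrix, Matrix.of_apply]
    rw [greenBilin_symm G hG (sum_dipole v _) (sum_dipole v _)]
  obtain ⟨c, hc, h⟩ := tsum_gaussian_fintype hP hC
    (precisionMatrix_mul_covarianceMatrix G hG hβ.ne' v) (coercive_precisionMatrix G hG hβ v)
    (coercive_covarianceMatrix hG hdeg hβ v)
  refine ⟨c, hc, fun f hf => ?_⟩
  have hsumC := ((coercive_covarianceMatrix hG hdeg hβ v).summable_dual hC
    fun i => (f i : ℂ)).of_norm
  have h1 := congrArg Complex.re (h fun i => (f i : ℂ))
  have hL : ∀ m : {j // j ≠ v} → ℤ,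
      cexp (-quadForm ((precisionMatrix G β v).map ofReal) (fun i => (m i : ℂ)) / 2 +
        ∑ i : {j // j ≠ v}, (f i : ℂ) * m i) =
      ((fieldWeight G β v f (extendZero v m) : ℝ) : ℂ) := by
    intro m
    have h2 := quadForm_ofReal (precisionMatrix G β v) (fun i => (m i : ℝ))
    simp only [Complex.ofReal_intCast] at h2
    rw [h2, fieldWeight_extendZero]
    push_cast
    rfl
  -- A charge on the complement of `v` is completed to a neutral one by the charge at `v`. Expanding
  -- the form at f + 2πiq, the square of `f` gives the Gaussian prefactor, the square of `q` the
  -- Coulomb weight, and the cross term a phase whose real part is the cosine.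
  have hQ : ∀ q : {j // j ≠ v} → ℤ,
      (cexp (quadForm ((covarianceMatrix G hG β v).map ofReal)
        (fun i => (f i : ℂ) + 2 * Real.pi * I * (q i : ℂ)) / 2)).re =
      Real.exp (greenEnergy G hG f / (2 * β)) *
        (coulombWeight G hG (2 * Real.pi ^ 2 / β) (extendNeutral v q) *
          Real.cos (2 * Real.pi * pairing (fun x => ((extendNeutral v q x : ℤ) : ℝ))
            (β⁻¹ • -(laplacianPseudoinverse G hG f)))) := by
    intro q
    have hq : (fun x => ((extendNeutral v q x : ℤ) : ℝ)) = extendNeutral v fun i => (q i : ℝ) := by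
      funext j; unfold extendNeutral; split_ifs <;> simp
    have e1 := quadForm_add_smul (P := (covarianceMatrix G hG β v).map ofReal)
      (fun i j => by simp only [Matrix.map_apply, hC i j])
      (fun i => (f i : ℂ)) (fun i => (q i : ℂ)) (2 * Real.pi * I)
    have e2 : quadForm ((covarianceMatrix G hG β v).map ofReal) (fun i => (f i : ℂ)) =
        ((β⁻¹ * greenEnergy G hG f : ℝ) : ℂ) := by
      rw [quadForm_ofReal _ fun i : {j // j ≠ v} => f i, quadForm_eq_sum, sum_covarianceMatrix,
        extendNeutral_restrict v hf]
      rfl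
    have e3 : quadForm ((covarianceMatrix G hG β v).map ofReal) (fun i => (q i : ℂ)) =
        ((β⁻¹ * greenEnergy G hG (extendNeutral v fun i => (q i : ℝ)) : ℝ) : ℂ) := by
      have h2 := quadForm_ofReal (covarianceMatrix G hG β v) (fun i => (q i : ℝ))
      simp only [Complex.ofReal_intCast] at h2
      rw [h2, quadForm_eq_sum, sum_covarianceMatrix]
      rfl
    have e4 : ∑ i : {j // j ≠ v}, (f i : ℂ) *
        ∑ j, (covarianceMatrix G hG β v).map ofReal i j * (q j : ℂ) =
        ((pairing (extendNeutral v fun i => (q i : ℝ))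
          (β⁻¹ • -(laplacianPseudoinverse G hG f)) : ℝ) : ℂ) := by
      have h2 := sum_covarianceMatrix G hG β v (fun i => f i) (fun i => (q i : ℝ))
      rw [extendNeutral_restrict v hf, greenBilin_symm G hG hf (sum_extendNeutral v _),
        greenBilin_apply, ← pairing_smul_right] at h2
      rw [← h2]
      simp
    rw [e1, e2, e3, e4, Complex.exp_re, coulombWeight, if_pos (sum_extendNeutral v q), hq]
    have e5 : (((β⁻¹ * greenEnergy G hG f : ℝ) : ℂ) + 2 * (2 * Real.pi * I) *
        ((pairing (extendNeutral v fun i => (q i : ℝ))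
          (β⁻¹ • -(laplacianPseudoinverse G hG f)) : ℝ) : ℂ) + (2 * Real.pi * I) ^ 2 *
        ((β⁻¹ * greenEnergy G hG (extendNeutral v fun i => (q i : ℝ)) : ℝ) : ℂ)) / 2 =
        ((greenEnergy G hG f / (2 * β) + -(2 * Real.pi ^ 2 / β *
          greenEnergy G hG (extendNeutral v fun i => (q i : ℝ))) : ℝ) : ℂ) +
        ((2 * Real.pi * pairing (extendNeutral v fun i => (q i : ℝ))
          (β⁻¹ • -(laplacianPseudoinverse G hG f)) : ℝ) : ℂ) * I := by
      rw [mul_pow, I_sq]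
      push_cast
      field_simp
      ring
    rw [e5, ← mul_assoc (Real.exp _), ← Real.exp_add]
    simp only [Complex.add_re, Complex.add_im, Complex.ofReal_re, Complex.ofReal_im,
      Complex.re_ofReal_mul, Complex.im_ofReal_mul, Complex.I_re, Complex.I_im, mul_zero, mul_one,
      add_zero, zero_add]
  have hre := Complex.hasSum_re hsumC.hasSum
  rw [tsum_congr hL, ← Complex.ofReal_tsum, Complex.ofReal_re, Complex.re_ofReal_mul,
    ← hre.tsum_eq, tsum_congr hQ, tsum_mul_left] at h1
  rw [← (injective_extendZero (R := ℤ) v).tsum_eq (support_fieldWeight G β v f), h1]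
  congr 2
  refine (injective_extendNeutral (R := ℤ) v).tsum_eq
    (f := fun q => coulombWeight G hG (2 * Real.pi ^ 2 / β) q *
          Real.cos (2 * Real.pi * pairing (fun x => (q x : ℝ))
            (β⁻¹ • -(laplacianPseudoinverse G hG f)))) fun q hq => ?_
  refine ⟨fun i => q i, extendNeutral_restrict v ?_⟩
  by_contra hne
  refine hq ?_
  simp only [coulombWeight, if_neg hne, zero_mul]

end

/-! ### Geometry of square domains -/

theorem squareDomain_free_le_periodic (L : ℕ) : squareDomain L .free ≤ squareDomain L .periodic := by
  intro x y h
  simp only [squareDomain, SimpleGraph.boxProd_adj] at h ⊢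
  exact h.imp (fun h => ⟨SimpleGraph.pathGraph_le_cycleGraph h.1, h.2⟩)
    fun h => ⟨SimpleGraph.pathGraph_le_cycleGraph h.1, h.2⟩

theorem squareDomain_free_le (L : ℕ) (bc : BoundaryCondition) :
    squareDomain L .free ≤ squareDomain L bc := by
  cases bc
  · exact le_rfl
  · exact squareDomain_free_le_periodic L

theorem squareDomain_le_periodic (L : ℕ) (bc : BoundaryCondition) :
    squareDomain L bc ≤ squareDomain L .periodic := by
  cases bc
  · exact squareDomain_free_le_periodic L
  · exact le_rfl

theorem squareDomain_dist_le {L : ℕ} (hL : 1 < L) (bc : BoundaryCondition)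
    (x y : Fin L × Fin L) : (squareDomain L bc).dist x y ≤
      ((x.1 : ℤ) - y.1).natAbs + ((x.2 : ℤ) - y.2).natAbs := by
  have hG := squareDomain_connected hL bc
  have h1 : ∀ (n : ℕ) (x y : Fin L × Fin L), x.2 = y.2 → (x.1 : ℕ) + n = y.1 →
      (squareDomain L bc).dist x y ≤ n := by
    intro n
    induction n with
    | zero =>
      intro x y h2 h3
      have : x = y := Prod.ext (Fin.ext (by simpa using h3)) h2
      simp [this]
    | succ n ih =>
      intro x y h2 h3
      have hlt : (x.1 : ℕ) + 1 < L := by have := y.1.2; omega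
      let z : Fin L × Fin L := (⟨x.1 + 1, hlt⟩, x.2)
      have hxz : (squareDomain L bc).Adj x z := squareDomain_free_le L bc
        ((squareDomain_free_adj L x z).2 (Or.inl ⟨Or.inl rfl, rfl⟩))
      have h4 := ih z y h2 (by simp only [z]; omega)
      have h5 := hG.dist_triangle (u := x) (v := z) (w := y)
      rw [SimpleGraph.dist_eq_one_iff_adj.2 hxz] at h5
      omega
  have h2 : ∀ (n : ℕ) (x y : Fin L × Fin L), x.1 = y.1 → (x.2 : ℕ) + n = y.2 →
      (squareDomain L bc).dist x y ≤ n := by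
    intro n
    induction n with
    | zero =>
      intro x y h2 h3
      have : x = y := Prod.ext h2 (Fin.ext (by simpa using h3))
      simp [this]
    | succ n ih =>
      intro x y h2 h3
      have hlt : (x.2 : ℕ) + 1 < L := by have := y.2.2; omega
      let z : Fin L × Fin L := (x.1, ⟨x.2 + 1, hlt⟩)
      have hxz : (squareDomain L bc).Adj x z := squareDomain_free_le L bc
        ((squareDomain_free_adj L x z).2 (Or.inr ⟨Or.inl rfl, rfl⟩))
      have h4 := ih z y h2 (by simp only [z]; omega)
      have h5 := hG.dist_triangle (u := x) (v := z) (w := y)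
      rw [SimpleGraph.dist_eq_one_iff_adj.2 hxz] at h5
      omega
  let z : Fin L × Fin L := (y.1, x.2)
  have h3 : (squareDomain L bc).dist x z ≤ ((x.1 : ℤ) - y.1).natAbs := by
    rcases le_total (x.1 : ℕ) y.1 with h | h
    · exact h1 _ x z rfl (by simp only [z]; omega)
    · rw [SimpleGraph.dist_comm]
      exact h1 _ z x rfl (by simp only [z]; omega)
  have h4 : (squareDomain L bc).dist z y ≤ ((x.2 : ℤ) - y.2).natAbs := by
    rcases le_total (x.2 : ℕ) y.2 with h | h
    · exact h2 _ z y rfl (by simp only [z]; omega)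
    · rw [SimpleGraph.dist_comm]
      exact h2 _ y z rfl (by simp only [z]; omega)
  exact hG.dist_triangle.trans (add_le_add h3 h4)

theorem Fin.exists_sub_eq_of_val_sub_eq_one {L : ℕ} {i j : Fin L} (h : (i - j).val = 1) :
    ∃ t : ℤ, (i : ℤ) - j = 1 + t * L := by
  rw [Fin.val_sub] at h
  have h1 := Nat.mod_add_div (L - j + i) L
  rw [h] at h1
  refine ⟨((L - j + i) / L : ℕ) - 1, ?_⟩
  have h2 := j.2
  have h3 : ((L - j + i : ℕ) : ℤ) = L - j + i := by omega
  have h4 : (1 : ℤ) + L * ((L - j + i) / L : ℕ) = L - j + i := by rw [← h3]; exact_mod_cast h1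
  linarith

theorem squareDomain_coord_of_adj {L : ℕ} {bc : BoundaryCondition} {x y : Fin L × Fin L}
    (h : (squareDomain L bc).Adj x y) :
    (∃ t : ℤ, |(x.1 : ℤ) - y.1 - t * L| ≤ 1) ∧ ∃ t : ℤ, |(x.2 : ℤ) - y.2 - t * L| ≤ 1 := by
  have h1 := (squareDomain_periodic_adj L x y).1 (squareDomain_le_periodic L bc h)
  have key : ∀ i j : Fin L, ((i - j).val = 1 ∨ (j - i).val = 1) →
      ∃ t : ℤ, |(i : ℤ) - j - t * L| ≤ 1 := by
    rintro i j (h | h) <;> obtain ⟨t, ht⟩ := Fin.exists_sub_eq_of_val_sub_eq_one h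
    · exact ⟨t, by rw [ht]; simp⟩
    · refine ⟨-t, ?_⟩
      rw [show (i : ℤ) - j - -t * L = -1 by linarith]; simp
  have triv : ∀ i j : Fin L, i = j → ∃ t : ℤ, |(i : ℤ) - j - t * L| ≤ 1 := by
    rintro i j rfl
    exact ⟨0, by simp⟩
  rcases h1 with ⟨h1, h2⟩ | ⟨h1, h2⟩
  · exact ⟨key _ _ h1, triv _ _ h2⟩
  · exact ⟨triv _ _ h2, key _ _ h1⟩

/-- `t` counts the winding in one coordinate. If `R` is at least `L` no winding is needed; otherwise
|tL| is less than 2L. Free boundary conditions are treated as a subgraph of the periodic ones. -/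
theorem squareDomain_coord_of_dist_le {L : ℕ} (hL : 1 < L) {bc : BoundaryCondition}
    {x y : Fin L × Fin L} {R : ℕ} (h : (squareDomain L bc).dist x y ≤ R) :
    (∃ t : ℤ, |t| ≤ 1 ∧ |(y.1 : ℤ) - x.1 - t * L| ≤ R) ∧
      ∃ t : ℤ, |t| ≤ 1 ∧ |(y.2 : ℤ) - x.2 - t * L| ≤ R := by
  have hwalk : ∀ (x y : Fin L × Fin L) (p : (squareDomain L bc).Walk x y),
      (∃ t : ℤ, |(y.1 : ℤ) - x.1 - t * L| ≤ p.length) ∧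
        ∃ t : ℤ, |(y.2 : ℤ) - x.2 - t * L| ≤ p.length := by
    intro x y p
    induction p with
    | nil => exact ⟨⟨0, by simp⟩, ⟨0, by simp⟩⟩
    | @cons u v w hadj p ih =>
      obtain ⟨⟨t₁, h₁⟩, ⟨t₂, h₂⟩⟩ := ih
      obtain ⟨⟨s₁, g₁⟩, ⟨s₂, g₂⟩⟩ := squareDomain_coord_of_adj hadj.symm
      rw [SimpleGraph.Walk.length_cons]
      push_cast
      refine ⟨⟨t₁ + s₁, ?_⟩, ⟨t₂ + s₂, ?_⟩⟩
      · rw [show (w.1 : ℤ) - u.1 - (t₁ + s₁) * L =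
          ((w.1 : ℤ) - v.1 - t₁ * L) + ((v.1 : ℤ) - u.1 - s₁ * L) by ring]
        exact (abs_add_le _ _).trans (add_le_add h₁ g₁)
      · rw [show (w.2 : ℤ) - u.2 - (t₂ + s₂) * L =
          ((w.2 : ℤ) - v.2 - t₂ * L) + ((v.2 : ℤ) - u.2 - s₂ * L) by ring]
        exact (abs_add_le _ _).trans (add_le_add h₂ g₂)
  obtain ⟨p, hp⟩ := (squareDomain_connected hL bc).exists_walk_length_eq_dist x y
  have key : ∀ i j : Fin L, (∃ t : ℤ, |(i : ℤ) - j - t * L| ≤ R) →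
      ∃ t : ℤ, |t| ≤ 1 ∧ |(i : ℤ) - j - t * L| ≤ R := by
    rintro i j ⟨t, ht⟩
    have hi := i.2
    have hj := j.2
    rcases le_or_gt L R with hR | hR
    · refine ⟨0, by simp, ?_⟩
      rw [abs_le]
      constructor <;> omega
    · refine ⟨t, ?_, ht⟩
      rw [abs_le] at ht ⊢
      have hL' : (0 : ℤ) < L := by omega
      constructor
      · by_contra hcon
        have : t * L ≤ -2 * L := mul_le_mul_of_nonneg_right (by omega) hL'.le
        omega
      · by_contra hcon
        have : 2 * (L : ℤ) ≤ t * L := mul_le_mul_of_nonneg_right (by omega) hL'.le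
        omega
  obtain ⟨⟨t₁, h₁⟩, ⟨t₂, h₂⟩⟩ := hwalk x y p
  have hpR : (p.length : ℤ) ≤ R := by exact_mod_cast hp.le.trans h
  exact ⟨key _ _ ⟨t₁, h₁.trans hpR⟩, key _ _ ⟨t₂, h₂.trans hpR⟩⟩

/-- A set of points of a ball that are pairwise separated in some coordinate is small. -/
theorem squareDomain_card_le {L : ℕ} (hL : 1 < L) {bc : BoundaryCondition} {R h : ℕ} (hh : 0 < h)
    (p : Fin L × Fin L) (A : Finset (Fin L × Fin L))
    (hA : ∀ x ∈ A, (squareDomain L bc).dist p x ≤ R)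
    (hsep : ∀ x ∈ A, ∀ y ∈ A, x ≠ y →
      (h : ℤ) ≤ |(x.1 : ℤ) - y.1| ∨ (h : ℤ) ≤ |(x.2 : ℤ) - y.2|) :
    A.card ≤ (3 * (2 * R / h + 1)) ^ 2 := by
  classical
  have hc₁ : ∀ x : Fin L × Fin L, ∃ t : ℤ, x ∈ A → |t| ≤ 1 ∧ |(x.1 : ℤ) - p.1 - t * L| ≤ R := by
    intro x
    by_cases hx : x ∈ A
    · obtain ⟨t, ht⟩ := (squareDomain_coord_of_dist_le hL (hA x hx)).1
      exact ⟨t, fun _ => ht⟩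
    · exact ⟨0, fun h => absurd h hx⟩
  have hc₂ : ∀ x : Fin L × Fin L, ∃ t : ℤ, x ∈ A → |t| ≤ 1 ∧ |(x.2 : ℤ) - p.2 - t * L| ≤ R := by
    intro x
    by_cases hx : x ∈ A
    · obtain ⟨t, ht⟩ := (squareDomain_coord_of_dist_le hL (hA x hx)).2
      exact ⟨t, fun _ => ht⟩
    · exact ⟨0, fun h => absurd h hx⟩
  choose t₁ ht₁ using hc₁
  choose t₂ ht₂ using hc₂
  have hh' : (0 : ℤ) < h := by exact_mod_cast hh
  let S : Finset (ℤ × ℤ) := Finset.Icc (-1) 1 ×ˢ Finset.Icc 0 ((2 * R / h : ℕ) : ℤ)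
  have hS : S.card = 3 * (2 * R / h + 1) := by
    simp only [S, Finset.card_product, Int.card_Icc]
    congr 1
  have hmem : ∀ t a : ℤ, |t| ≤ 1 → |a| ≤ R → (t, (a + R) / h) ∈ S := by
    intro t a ht ha
    simp only [S, Finset.mem_product, Finset.mem_Icc]
    rw [abs_le] at ht ha
    refine ⟨ht, Int.ediv_nonneg (by omega) hh'.le, ?_⟩
    push_cast
    exact Int.ediv_le_ediv hh' (by omega)
  have hclose : ∀ a b : ℤ, a / h = b / h → |a - b| < h := by
    intro a b hab
    have h1 := Int.emod_add_mul_ediv a h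
    have h2 := Int.emod_add_mul_ediv b h
    have h3 := Int.emod_nonneg a hh'.ne'
    have h4 := Int.emod_nonneg b hh'.ne'
    have h5 := Int.emod_lt_of_pos a hh'
    have h6 := Int.emod_lt_of_pos b hh'
    rw [hab] at h1
    rw [abs_lt]
    omega
  -- A point is encoded by its windings and by the cells of width `h` containing its unwound
  -- coordinates. Equal codes force both coordinates to be closer than `h`, against the separation.
  let F : Fin L × Fin L → (ℤ × ℤ) × (ℤ × ℤ) := fun x =>
    ((t₁ x, ((x.1 : ℤ) - p.1 - t₁ x * L + R) / h), (t₂ x, ((x.2 : ℤ) - p.2 - t₂ x * L + R) / h))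
  have h1 : A.card ≤ (S ×ˢ S).card := by
    refine Finset.card_le_card_of_injOn F (fun x hx => ?_) ?_
    · exact Finset.mem_product.2 ⟨hmem _ _ (ht₁ x hx).1 (ht₁ x hx).2,
        hmem _ _ (ht₂ x hx).1 (ht₂ x hx).2⟩
    · intro x hx y hy hxy
      by_contra hne
      simp only [F, Prod.mk.injEq] at hxy
      obtain ⟨⟨e1, e2⟩, ⟨e3, e4⟩⟩ := hxy
      have g1 := hclose _ _ e2
      have g2 := hclose _ _ e4
      rw [e1] at g1
      rw [e3] at g2
      ring_nf at g1 g2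
      have g1' : |(x.1 : ℤ) - y.1| < h := by convert g1 using 2
      have g2' : |(x.2 : ℤ) - y.2| < h := by convert g2 using 2
      rcases hsep x hx y hy hne with h3 | h3 <;> omega
  rw [Finset.card_product, hS, ← sq] at h1
  exact h1

/-- Points at distance `scale k` differ by at least half of it, rounded up, in some coordinate. A
ball of radius 256 scales then has at most 1024 + 1 cells per direction and winding. -/
theorem squareDomain_hasPacking {L : ℕ} (hL : 1 < L) (bc : BoundaryCondition) :
    HasPacking (squareDomain L bc) ((3 * 1025) ^ 2) := by
  intro k p A hA hsep
  have hℓ := scale_pos k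
  have h1 := squareDomain_card_le hL (h := (scale k + 1) / 2) (by omega) p A hA fun x hx y hy hne => by
    have h2 := (hsep x hx y hy hne).trans (squareDomain_dist_le hL bc x y)
    rw [Int.abs_eq_natAbs, Int.abs_eq_natAbs]
    omega
  refine h1.trans (Nat.pow_le_pow_left (Nat.mul_le_mul_left _ (Nat.succ_le_succ ?_)) _)
  rw [scale_succ]
  refine Nat.div_le_of_le_mul ?_
  omega

open Classical in
theorem squareDomain_degree_le {L : ℕ} (hL : 1 < L) (bc : BoundaryCondition)
    (x : Fin L × Fin L) : (Finset.univ.filter fun y => (squareDomain L bc).Adj x y).card ≤ 4 := by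
  have : NeZero L := ⟨by omega⟩
  have key : ∀ i j : Fin L, ((i - j).val = 1 ∨ (j - i).val = 1) → j = i + 1 ∨ j = i - 1 := by
    have h1 : ∀ i : Fin L, i.val = 1 → i = 1 := fun i hi => by
      refine Fin.ext ?_
      rw [hi, Fin.val_one', Nat.mod_eq_of_lt hL]
    rintro i j (h | h)
    · right; rw [← h1 _ h]; abel
    · left; rw [← h1 _ h]; abel
  refine (Finset.card_le_card (t := {(x.1 + 1, x.2), (x.1 - 1, x.2), (x.1, x.2 + 1),
    (x.1, x.2 - 1)}) fun y hy => ?_).trans Finset.card_le_four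
  have h1 := (squareDomain_periodic_adj L x y).1
    (squareDomain_le_periodic L bc (Finset.mem_filter.1 hy).2)
  simp only [Finset.mem_insert, Finset.mem_singleton, Prod.ext_iff]
  rcases h1 with ⟨h1, h2⟩ | ⟨h1, h2⟩
  · rcases key _ _ h1 with h3 | h3 <;> simp [h3, h2]
  · rcases key _ _ h1 with h3 | h3 <;> simp [h3, h2]

theorem squareDomain_hasVolumeGrowth {L : ℕ} (hL : 1 < L) (bc : BoundaryCondition) :
    HasVolumeGrowth (squareDomain L bc) 152100 := by
  classical
  intro k p
  have hℓ := scale_pos k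
  let A := Finset.univ.filter fun x => (squareDomain L bc).dist p x ≤ 32 * scale k
  have hA : A.card ≤ (195 * scale k) ^ 2 := by
    have h1 := squareDomain_card_le hL (bc := bc) one_pos p A (fun x hx => (Finset.mem_filter.1 hx).2)
      fun x _ y _ hne => by
        by_contra hcon
        push Not at hcon
        refine hne (Prod.ext (Fin.ext ?_) (Fin.ext ?_))
        · have := Int.abs_lt_one_iff.1 hcon.1; omega
        · have := Int.abs_lt_one_iff.1 hcon.2; omega
    -- With cells of width 1, 3(64ℓ + 1) ≤ 195ℓ. Degree at most 4 then gives the growth constant 4 ·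
    -- 195² = 152100.
    refine h1.trans (Nat.pow_le_pow_left ?_ _)
    rw [Nat.div_one]
    omega
  have h2 : (Finset.univ.filter fun z : (Fin L × Fin L) × (Fin L × Fin L) =>
      (squareDomain L bc).Adj z.1 z.2 ∧ (squareDomain L bc).dist p z.1 ≤ 32 * scale k).card ≤
      A.card * 4 := by
    have h3 : (Finset.univ.filter fun z : (Fin L × Fin L) × (Fin L × Fin L) =>
        (squareDomain L bc).Adj z.1 z.2 ∧ (squareDomain L bc).dist p z.1 ≤ 32 * scale k) ⊆
        (A.sigma fun x => Finset.univ.filter fun y => (squareDomain L bc).Adj x y).image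
          fun z => (z.1, z.2) := by
      intro z hz
      obtain ⟨-, h4, h5⟩ := Finset.mem_filter.1 hz
      refine Finset.mem_image.2 ⟨⟨z.1, z.2⟩, ?_, rfl⟩
      simp [A, h4, h5]
    refine (Finset.card_le_card h3).trans (Finset.card_image_le.trans ?_)
    rw [Finset.card_sigma, ← smul_eq_mul]
    exact Finset.sum_le_card_nsmul _ _ _ fun x _ => squareDomain_degree_le hL bc x
  have h5 := h2.trans (Nat.mul_le_mul_right 4 hA)
  have h6 : ((Finset.univ.filter fun z : (Fin L × Fin L) × (Fin L × Fin L) =>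
      (squareDomain L bc).Adj z.1 z.2 ∧
        (squareDomain L bc).dist p z.1 ≤ 32 * scale k).card : ℝ) ≤
      (195 * scale k) ^ 2 * 4 := by exact_mod_cast h5
  convert h6.trans (le_of_eq _) using 1
  ring

theorem squareDomain_dirForm_le {L : ℕ} (hL : 1 < L) (bc : BoundaryCondition)
    (q : Fin L × Fin L → ℝ) : dirForm (squareDomain L bc) q q ≤ 8 * pairing q q := by
  classical
  set G := squareDomain L bc
  have h1 : ∀ g : Fin L × Fin L → Fin L × Fin L → ℝ, ∑ z : (Fin L × Fin L) × (Fin L × Fin L) with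
      G.Adj z.1 z.2, g z.1 z.2 = ∑ x, ∑ y, if G.Adj x y then g x y else 0 := fun g => by
    rw [Finset.sum_filter, Fintype.sum_prod_type]
  have h2 : ∑ x, ∑ y, (if G.Adj x y then q x ^ 2 else 0) ≤ 4 * pairing q q := by
    rw [pairing, Finset.mul_sum]
    refine Finset.sum_le_sum fun x _ => ?_
    rw [← Finset.sum_filter, Finset.sum_const, nsmul_eq_mul, ← sq]
    refine mul_le_mul_of_nonneg_right ?_ (sq_nonneg _)
    exact_mod_cast squareDomain_degree_le hL bc x
  have h3 : ∑ x, ∑ y, (if G.Adj x y then q y ^ 2 else 0) =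
      ∑ x, ∑ y, (if G.Adj x y then q x ^ 2 else 0) := by
    rw [Finset.sum_comm]
    simp only [G.adj_comm]
  have h4 : ∑ x, ∑ y, (if G.Adj x y then (q x - q y) * (q x - q y) else 0) ≤
      ∑ x, ∑ y, (2 * (if G.Adj x y then q x ^ 2 else 0) +
        2 * (if G.Adj x y then q y ^ 2 else 0)) := by
    refine Finset.sum_le_sum fun x _ => Finset.sum_le_sum fun y _ => ?_
    split_ifs
    · nlinarith [sq_nonneg (q x + q y)]
    · simp
  simp only [Finset.sum_add_distrib, ← Finset.mul_sum] at h4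
  have h5 : dirForm G q q =
      (∑ x, ∑ y, if G.Adj x y then (q x - q y) * (q x - q y) else 0) / 2 := by
    rw [dirForm]
    congr 1
    convert h1 fun x y => (q x - q y) * (q x - q y) using 1
  rw [h5]
  linarith

/-! ### Expectations of the integer-valued field -/

theorem sum_adj_eq_two_mul_sum_edgeFinset {V : Type*} [Fintype V] (G : SimpleGraph V)
    [DecidableEq V] [DecidableRel G.Adj] (F : Sym2 V → ℝ) :
    ∑ z : V × V with G.Adj z.1 z.2, F s(z.1, z.2) = 2 * ∑ e ∈ G.edgeFinset, F e := by
  rw [← Finset.sum_fiberwise_of_maps_to (t := G.edgeFinset) (g := fun z : V × V => s(z.1, z.2))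
    (fun z hz => by simpa using hz), Finset.mul_sum]
  refine Finset.sum_congr rfl fun e he => ?_
  induction e using Sym2.ind with
  | _ a b =>
    have hab : G.Adj a b := by simpa using he
    have h1 : ((Finset.univ.filter fun z : V × V => G.Adj z.1 z.2).filter
        fun z => s(z.1, z.2) = s(a, b)) = {(a, b), (b, a)} := by
      ext ⟨x, y⟩
      simp only [Finset.mem_filter, Finset.mem_univ, true_and, Sym2.eq_iff, Finset.mem_insert,
        Finset.mem_singleton, Prod.mk.injEq]
      refine ⟨fun h => h.2, fun h => ⟨?_, h⟩⟩
      rcases h with ⟨rfl, rfl⟩ | ⟨rfl, rfl⟩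
      · exact hab
      · exact hab.symm
    rw [h1, Finset.sum_pair (fun h => hab.ne (Prod.ext_iff.1 h).1), Sym2.eq_swap (a := b)]
    ring

theorem dirichletEnergy_eq_dirForm {V : Type*} [Fintype V] (G : SimpleGraph V) (m : V → ℤ) :
    dirichletEnergy G m = dirForm G (fun j => (m j : ℝ)) fun j => (m j : ℝ) := by
  classical
  have h1 := sum_adj_eq_two_mul_sum_edgeFinset G
    (Sym2.lift ⟨fun j l => ((m j : ℝ) - (m l : ℝ)) ^ 2, fun _ _ => by ring⟩)
  rw [dirForm, dirichletEnergy, eq_div_iff two_ne_zero, mul_comm]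
  simp only [Sym2.lift_mk, sq] at h1
  convert h1.symm using 3
  simp only [sq]

theorem fieldWeight_nonneg {V : Type*} [Fintype V] (G : SimpleGraph V) (β : ℝ) (v : V) (f : V → ℝ) (m : V → ℤ) :
    0 ≤ fieldWeight G β v f m := by
  unfold fieldWeight; split_ifs <;> positivity

theorem exp_mul_fieldWeight {V : Type*} [Fintype V] (G : SimpleGraph V) (β : ℝ) (v : V) (f : V → ℝ) (m : V → ℤ) :
    Real.exp (pairing (fun j => (m j : ℝ)) f) * fieldWeight G β v 0 m = fieldWeight G β v f m := by
  unfold fieldWeight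
  split_ifs
  · rw [← Real.exp_add]
    congr 1
    simp [pairing]
    ring
  · simp

section

open MeasureTheory

variable {V : Type*} [Fintype V] [DecidableEq V]

theorem unnormalizedIVGFF_singleton (G : SimpleGraph V) (β : ℝ) (v : V) (m : V → ℤ) :
    unnormalizedIVGFF G β v {m} = ENNReal.ofReal (fieldWeight G β v 0 m) := by
  have hs : ∀ j : V, SigmaFinite (if j = v then Measure.dirac (0 : ℤ) else Measure.count) := by
    intro j
    split_ifs <;> infer_instance
  have h1 : (Measure.pi fun j : V => if j = v then Measure.dirac (0 : ℤ) else Measure.count) {m} =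
      if m v = 0 then 1 else 0 := by
    rw [Measure.pi_singleton, ← Finset.mul_prod_erase _ _ (Finset.mem_univ v),
      Finset.prod_eq_one fun j hj => ?_]
    · simp only [if_true, mul_one]
      rw [Measure.dirac_apply, Set.indicator_apply]
      simp [eq_comm]
    · rw [if_neg (Finset.ne_of_mem_erase hj), Measure.count_singleton]
  have h2 : unnormalizedIVGFF G β v = (Measure.pi fun j : V =>
      if j = v then Measure.dirac (0 : ℤ) else Measure.count).withDensity
        fun m => ENNReal.ofReal (Real.exp (-(β / 2) * dirichletEnergy G m)) := by
    unfold unnormalizedIVGFF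
    congr!
  rw [h2, withDensity_apply _ (measurableSet_singleton m), lintegral_singleton, h1, fieldWeight,
    dirichletEnergy_eq_dirForm]
  split_ifs <;> simp [pairing]

theorem integral_ivGFF (G : SimpleGraph V) (β : ℝ) (v : V) {g : (V → ℤ) → ℝ} (hg : ∀ m, 0 ≤ g m) :
    ∫ m, g m ∂(ivGFF G β v) =
      (∑' m, g m * fieldWeight G β v 0 m) / ∑' m, fieldWeight G β v 0 m := by
  have key : ∀ g : (V → ℤ) → ℝ, (∀ m, 0 ≤ g m) →
      (∫⁻ m, ENNReal.ofReal (g m) ∂(unnormalizedIVGFF G β v)).toReal =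
        ∑' m, g m * fieldWeight G β v 0 m := by
    intro g hg
    rw [lintegral_countable', ENNReal.tsum_toReal_eq]
    · refine tsum_congr fun m => ?_
      rw [unnormalizedIVGFF_singleton, ENNReal.toReal_mul, ENNReal.toReal_ofReal (hg m),
        ENNReal.toReal_ofReal (fieldWeight_nonneg G β v 0 m)]
    · intro m
      rw [unnormalizedIVGFF_singleton]
      exact ENNReal.mul_ne_top ENNReal.ofReal_ne_top ENNReal.ofReal_ne_top
  have h1 := key (fun _ => 1) fun _ => zero_le_one
  simp only [ENNReal.ofReal_one, lintegral_one, one_mul] at h1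
  rw [ivGFF, integral_smul_measure, ENNReal.toReal_inv, h1,
    integral_eq_lintegral_of_nonneg_ae (Filter.Eventually.of_forall hg)
      (measurable_of_countable g).aestronglyMeasurable, key g hg, smul_eq_mul, inv_mul_eq_div]

theorem tsum_fieldWeight_pos (G : SimpleGraph V) (hG : G.Connected) {β : ℝ} (hβ : 0 < β) (v : V)
    (f : V → ℝ) : 0 < ∑' m, fieldWeight G β v f m := by
  refine (summable_fieldWeight G hG hβ v f).tsum_pos (fieldWeight_nonneg G β v f) 0 ?_
  rw [fieldWeight, if_pos (Pi.zero_apply v)]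
  exact Real.exp_pos _

end

/-- The left side is (exp(x/2) - exp(-x/2))², and for x ≥ 0 the inequality 1 - exp(-x) ≤ x bounds
the difference by x exp(x/2). -/
theorem exp_add_exp_neg_le (x : ℝ) :
    Real.exp x + Real.exp (-x) - 2 ≤ x ^ 2 * Real.exp |x| := by
  wlog hx : 0 ≤ x generalizing x
  · have := this (-x) (by linarith)
    rw [neg_neg, abs_neg, neg_sq] at this
    linarith
  rw [abs_of_nonneg hx]
  have h1 : Real.exp x = Real.exp (x / 2) ^ 2 := by rw [← Real.exp_nat_mul]; ring_nf
  have h2 : Real.exp (-x) = Real.exp (-(x / 2)) ^ 2 := by rw [← Real.exp_nat_mul]; ring_nf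
  have h3 : Real.exp (x / 2) * Real.exp (-(x / 2)) = 1 := by rw [← Real.exp_add]; simp
  have h4 : Real.exp (x / 2) - Real.exp (-(x / 2)) ≤ x * Real.exp (x / 2) := by
    have h5 := Real.add_one_le_exp (-x)
    rw [h2] at h5
    have h6 := Real.exp_pos (x / 2)
    have h7 := mul_le_mul_of_nonneg_left h5 h6.le
    have h8 : Real.exp (x / 2) * Real.exp (-(x / 2)) ^ 2 = Real.exp (-(x / 2)) := by
      rw [sq, ← mul_assoc, h3, one_mul]
    rw [h8] at h7
    linarith
  have h9 : 0 ≤ Real.exp (x / 2) - Real.exp (-(x / 2)) :=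
    sub_nonneg.2 (Real.exp_le_exp.2 (by linarith))
  have h10 := pow_le_pow_left₀ h9 h4 2
  rw [h1, h2]
  nlinarith

/-- A lower bound on the Laplace transform gives a lower bound on the second moment. -/
theorem le_tsum_sq_of_laplace {ι : Type*} {w X : ι → ℝ} (hw : ∀ i, 0 ≤ w i)
    (hsum : ∀ t : ℝ, Summable fun i => Real.exp (t * X i) * w i) {a : ℝ}
    (h : ∀ t : ℝ, Real.exp (t ^ 2 * a / 2) * ∑' i, w i ≤ ∑' i, Real.exp (t * X i) * w i) :
    a * ∑' i, w i ≤ ∑' i, X i ^ 2 * w i := by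
  have hw0 : Summable w := by simpa using hsum 0
  have hZ : 0 ≤ ∑' i, w i := tsum_nonneg hw
  have hb : Summable fun i => 2 * (Real.exp (2 * X i) * w i + Real.exp (-2 * X i) * w i) :=
    ((hsum 2).add (hsum (-2))).mul_left 2
  have hbound : ∀ t : ℝ, 0 < t → t ≤ 1 → ∀ i, X i ^ 2 * Real.exp |t * X i| * w i ≤
      2 * (Real.exp (2 * X i) * w i + Real.exp (-2 * X i) * w i) := by
    intro t ht0 ht1 i
    have h1 := sq_le_two_mul_exp (abs_nonneg (X i))
    rw [sq_abs] at h1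
    have h2 : Real.exp |t * X i| ≤ Real.exp |X i| := by
      refine Real.exp_le_exp.2 ?_
      rw [abs_mul, abs_of_pos ht0]
      exact mul_le_of_le_one_left (abs_nonneg _) ht1
    have h3 : Real.exp |X i| * Real.exp |X i| ≤ Real.exp (2 * X i) + Real.exp (-2 * X i) := by
      rw [← Real.exp_add]
      rcases abs_cases (X i) with h | h
      · rw [h.1, ← two_mul]; linarith [Real.exp_pos (-2 * X i)]
      · rw [h.1, ← two_mul, show 2 * -X i = -2 * X i by ring]; linarith [Real.exp_pos (2 * X i)]
    have h4 : X i ^ 2 * Real.exp |t * X i| ≤ 2 * (Real.exp (2 * X i) + Real.exp (-2 * X i)) := by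
      calc X i ^ 2 * Real.exp |t * X i| ≤ (2 * Real.exp |X i|) * Real.exp |X i| := by gcongr
        _ ≤ _ := by linarith
    calc _ ≤ 2 * (Real.exp (2 * X i) + Real.exp (-2 * X i)) * w i :=
          mul_le_mul_of_nonneg_right h4 (hw i)
      _ = _ := by ring
  -- Adding the hypothesis at t and -t removes the first-order term and needs no information on the
  -- mean. Then divide by t²; the remaining exp|tX| disappears by dominated convergence.
  have hmain : ∀ t : ℝ, 0 < t → t ≤ 1 →
      a * ∑' i, w i ≤ ∑' i, X i ^ 2 * Real.exp |t * X i| * w i := by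
    intro t ht0 ht1
    have hs : Summable fun i => X i ^ 2 * Real.exp |t * X i| * w i :=
      Summable.of_nonneg_of_le (fun i => by have := hw i; positivity) (hbound t ht0 ht1) hb
    have h1 := h t
    have h2 := h (-t)
    have h3 : ∑' i, (Real.exp (t * X i) * w i + Real.exp (-t * X i) * w i - 2 * w i) ≤
        ∑' i, t ^ 2 * (X i ^ 2 * Real.exp |t * X i| * w i) := by
      refine Summable.tsum_le_tsum (fun i => ?_) (((hsum t).add (hsum (-t))).sub (hw0.mul_left 2))
        (hs.mul_left _)
      have h4 := mul_le_mul_of_nonneg_right (exp_add_exp_neg_le (t * X i)) (hw i)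
      rw [neg_mul]
      linarith
    rw [((hsum t).add (hsum (-t))).tsum_sub (hw0.mul_left 2), (hsum t).tsum_add (hsum (-t)),
      tsum_mul_left, tsum_mul_left] at h3
    have h5 := Real.add_one_le_exp (t ^ 2 * a / 2)
    have h6 := mul_le_mul_of_nonneg_right h5 hZ
    rw [neg_sq] at h2
    have h7 : t ^ 2 * (a * ∑' i, w i) ≤ t ^ 2 * ∑' i, X i ^ 2 * Real.exp |t * X i| * w i := by
      linarith
    exact le_of_mul_le_mul_left h7 (by positivity)
  have hlim : Filter.Tendsto (fun t : ℝ => ∑' i, X i ^ 2 * Real.exp |t * X i| * w i)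
      (nhdsWithin 0 (Set.Ioi 0)) (nhds (∑' i, X i ^ 2 * w i)) := by
    refine tendsto_tsum_of_dominated_convergence hb (fun i => ?_) ?_
    · have : Continuous fun t : ℝ => X i ^ 2 * Real.exp |t * X i| * w i := by fun_prop
      have := (this.tendsto 0).mono_left (nhdsWithin_le_nhds (s := Set.Ioi 0))
      simpa using this
    · filter_upwards [Ioc_mem_nhdsGT (zero_lt_one (α := ℝ))] with t ht i
      rw [Real.norm_of_nonneg (by have := hw i; positivity)]
      exact hbound t ht.1 ht.2 i
  refine ge_of_tendsto hlim ?_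
  filter_upwards [Ioc_mem_nhdsGT (zero_lt_one (α := ℝ))] with t ht
  exact hmain t ht.1 ht.2

/-! ### Lower bounds on the fluctuations of the integer-valued field -/

theorem greenEnergy_smul {V : Type*} [Fintype V] (G : SimpleGraph V) (hG : G.Connected) (t : ℝ)
    (f : V → ℝ) : greenEnergy G hG (t • f) = t ^ 2 * greenEnergy G hG f := by
  rw [greenEnergy, map_smul, ← smul_neg, pairing_smul_left, pairing_smul_right, greenEnergy]
  ring

/-- The lower bound on the Laplace transform of the field. -/
theorem fieldWeight_laplace_ge {V : Type*} [Fintype V] [DecidableEq V] {G : SimpleGraph V}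
    (hG : G.Connected) {M₁ : ℕ} (hM₁ : HasPacking G M₁) {M₂ : ℝ} (hM₂ : HasVolumeGrowth G M₂)
    (hM : 404 ≤ M₂) (hdeg : ∀ q : V → ℝ, dirForm G q q ≤ 8 * pairing q q) {ε β : ℝ} (hε : 0 < ε)
    (hβ : 0 < β) (hS : 4 * ((1 + M₁) * Real.log 4) + 3 + 5120 * M₂ * ((1 + ε) / ε) ≤
      Real.pi ^ 2 / (2 * M₂ * β)) (v : V) {f : V → ℝ} (hf : ∑ j, f j = 0) :
    Real.exp (1 / (2 * (1 + ε) * β) * greenEnergy G hG f) * ∑' m, fieldWeight G β v 0 m ≤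
      ∑' m, fieldWeight G β v f m := by
  set s := Real.pi ^ 2 / (2 * M₂ * β) with hs
  set C := (1 + M₁) * Real.log 4 with hC
  have hpi := Real.pi_pos
  have hM0 : 0 < M₂ := by linarith
  have hC0 : Real.log 4 ≤ C := by
    rw [hC]
    have : 0 ≤ (M₁ : ℝ) * Real.log 4 := mul_nonneg (by positivity) (Real.log_nonneg (by norm_num))
    linarith
  have hlog : 0 < Real.log 4 := Real.log_pos (by norm_num)
  have hE0 : 0 ≤ 5120 * M₂ * ((1 + ε) / ε) := by positivity
  have hs3 : 3 ≤ s := by linarith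
  -- The parameter `s` is tied to β by α = 4M₂s. The choices γ = 2s and κ = M₂s/4 then saturate the
  -- two budget conditions 2γM₂ ≤ α and 16κ ≤ α.
  have hα : 2 * Real.pi ^ 2 / β = 4 * M₂ * s := by rw [hs]; field_simp; ring
  have hsexp : 128 * Real.exp (-s) ≤ 1 / 2 := by
    have h1 : Real.exp (-s) ≤ Real.exp (-(4 * Real.log 4)) := Real.exp_le_exp.2 (by linarith)
    have h2 : Real.exp (-(4 * Real.log 4)) = 1 / 256 := by
      rw [show -(4 * Real.log 4) = Real.log (1 / 256) by
        rw [show (1 / 256 : ℝ) = (4 ^ 4)⁻¹ by norm_num, Real.log_inv, Real.log_pow]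
        push_cast; ring]
      exact Real.exp_log (by norm_num)
    rw [h2] at h1
    linarith
  -- M₂ ≥ 404 makes κ at least 101s: 100s for the initial weight, and one more s ≥ 3 for the factors
  -- 2^(n+1) and exp n.
  have hκs : ∀ n : ℕ, 1 ≤ n → 2 ^ (n + 1) * Real.exp (-(M₂ * s / 4 * n ^ 2)) * Real.exp n ≤
      Real.exp (-(s * 100)) := by
    intro n hn
    have hn' : (1 : ℝ) ≤ n := by exact_mod_cast hn
    have h1 : (2 : ℝ) ^ (n + 1) ≤ Real.exp ((n + 1 : ℕ) * 1) := by
      rw [Real.exp_nat_mul]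
      have := Real.add_one_le_exp (1 : ℝ)
      gcongr
      linarith
    calc 2 ^ (n + 1) * Real.exp (-(M₂ * s / 4 * n ^ 2)) * Real.exp n
        ≤ Real.exp ((n + 1 : ℕ) * 1) * Real.exp (-(M₂ * s / 4 * n ^ 2)) * Real.exp n := by gcongr
      _ ≤ Real.exp (-(s * 100)) := by
        rw [← Real.exp_add, ← Real.exp_add]
        refine Real.exp_le_exp.2 ?_
        push_cast
        have h2 : (n : ℝ) ≤ n ^ 2 := by nlinarith
        have h3 : 101 * s ≤ M₂ * s / 4 := by nlinarith
        have h4 : 101 * s * (n : ℝ) ^ 2 ≤ M₂ * s / 4 * n ^ 2 := by gcongr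
        nlinarith
  have hcoul := coulomb_ge hG hM₁ hM₂ hdeg (α := 2 * Real.pi ^ 2 / β) (κ := M₂ * s / 4)
    (γ := 2 * s) (s := s) (C := C) (by positivity) hC (by linarith) (by linarith) (by positivity)
    (by rw [hα]; linarith) (by rw [hα]; linarith) hsexp hκs
    (β⁻¹ • -(laplacianPseudoinverse G hG f))
  obtain ⟨c, hc, h⟩ := exists_tsum_fieldWeight hG hdeg hβ v
  have hf1 := h f hf
  have hf0 := h 0 (by simp)
  have hg0 : greenEnergy G hG 0 = 0 := by simp [greenEnergy, pairing]
  simp only [hg0, zero_div, Real.exp_zero, one_mul, map_zero, neg_zero, smul_zero] at hf0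
  have hp0 : ∀ q : V → ℝ, pairing q 0 = 0 := fun q => by simp [pairing]
  simp only [hp0, mul_zero, Real.cos_zero, mul_one] at hf0
  rw [hf1, hf0]
  have hE := greenEnergy_nonneg G hG hf
  have hdir : dirForm G (β⁻¹ • -(laplacianPseudoinverse G hG f))
      (β⁻¹ • -(laplacianPseudoinverse G hG f)) = β⁻¹ * (β⁻¹ * greenEnergy G hG f) := by
    rw [← dirBilin_apply, map_smul, map_smul, LinearMap.smul_apply, dirBilin_apply,
      greenEnergy_eq_dirForm G hG hf, smul_eq_mul, smul_eq_mul]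
  rw [hdir] at hcoul
  -- The Dirichlet energy of the shift is β⁻²G(f), and β⁻¹ ≤ M₂s. The relative loss is therefore at
  -- most 5120 M₂ s exp(-100s), and since s² exp(-100s) ≤ 1, it is below ε/(1 + ε) once s ≥ 5120
  -- M₂(1 + ε)/ε.
  have hexp : 1 / (2 * (1 + ε) * β) * greenEnergy G hG f ≤ greenEnergy G hG f / (2 * β) +
      -(2560 * Real.exp (-(100 * s)) * (β⁻¹ * (β⁻¹ * greenEnergy G hG f))) := by
    have h1 : β⁻¹ ≤ M₂ * s := by
      rw [hs, inv_eq_one_div]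
      have h2 : M₂ * (Real.pi ^ 2 / (2 * M₂ * β)) = Real.pi ^ 2 / 2 / β := by field_simp
      rw [h2]
      have := Real.pi_gt_three
      gcongr
      nlinarith
    have h3 : s * s * Real.exp (-(100 * s)) ≤ 1 := by
      have h4 : s * s ≤ Real.exp (100 * s) := by
        have h5 := Real.add_one_le_exp s
        have h6 : Real.exp s * Real.exp s ≤ Real.exp (100 * s) := by
          rw [← Real.exp_add]; exact Real.exp_le_exp.2 (by linarith)
        exact (mul_le_mul (by linarith) (by linarith) (by linarith) (Real.exp_pos _).le).trans h6
      rw [Real.exp_neg, ← div_eq_mul_inv, div_le_one (Real.exp_pos _)]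
      exact h4
    have h7 : 5120 * Real.exp (-(100 * s)) * β⁻¹ ≤ ε / (1 + ε) := by
      have h8 : 5120 * M₂ ≤ ε / (1 + ε) * s := by
        have h9 : 5120 * M₂ * ((1 + ε) / ε) ≤ s := by linarith
        calc 5120 * M₂ = ε / (1 + ε) * (5120 * M₂ * ((1 + ε) / ε)) := by field_simp
          _ ≤ _ := by gcongr
      have h10 : 5120 * Real.exp (-(100 * s)) * β⁻¹ ≤ 5120 * Real.exp (-(100 * s)) * (M₂ * s) := by
        gcongr
      have h11 : 0 ≤ s * Real.exp (-(100 * s)) := by positivity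
      have h12 := mul_le_mul_of_nonneg_right h8 h11
      have h13 : ε / (1 + ε) * (s * s * Real.exp (-(100 * s))) ≤ ε / (1 + ε) * 1 := by gcongr
      nlinarith
    have h14 : greenEnergy G hG f / (2 * β) - 1 / (2 * (1 + ε) * β) * greenEnergy G hG f =
        ε / (1 + ε) * (greenEnergy G hG f / (2 * β)) := by field_simp; ring
    have h15 : 2560 * Real.exp (-(100 * s)) * (β⁻¹ * (β⁻¹ * greenEnergy G hG f)) =
        5120 * Real.exp (-(100 * s)) * β⁻¹ * (greenEnergy G hG f / (2 * β)) := by field_simp; ring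
    have h16 := mul_le_mul_of_nonneg_right h7 (show 0 ≤ greenEnergy G hG f / (2 * β) by positivity)
    linarith
  have hZ : 0 ≤ ∑' q, coulombWeight G hG (2 * Real.pi ^ 2 / β) q :=
    tsum_nonneg (coulombWeight_nonneg G hG _)
  calc Real.exp (1 / (2 * (1 + ε) * β) * greenEnergy G hG f) *
        (c * ∑' q, coulombWeight G hG (2 * Real.pi ^ 2 / β) q)
      ≤ Real.exp (greenEnergy G hG f / (2 * β) +
          -(2560 * Real.exp (-(100 * s)) * (β⁻¹ * (β⁻¹ * greenEnergy G hG f)))) *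
        (c * ∑' q, coulombWeight G hG (2 * Real.pi ^ 2 / β) q) :=
        mul_le_mul_of_nonneg_right (Real.exp_le_exp.2 hexp) (mul_nonneg hc.le hZ)
    _ = c * (Real.exp (greenEnergy G hG f / (2 * β)) *
        (Real.exp (-(2560 * Real.exp (-(100 * s)) * (β⁻¹ * (β⁻¹ * greenEnergy G hG f)))) *
          ∑' q, coulombWeight G hG (2 * Real.pi ^ 2 / β) q)) := by rw [Real.exp_add]; ring
    _ ≤ _ := by
        refine mul_le_mul_of_nonneg_left (mul_le_mul_of_nonneg_left hcoul (Real.exp_pos _).le) hc.le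

/-- The lower bound on the Laplace transform of the field yields one on its variance. -/
theorem fieldWeight_sq_ge {V : Type*} [Fintype V] [DecidableEq V] {G : SimpleGraph V}
    (hG : G.Connected) {ε β : ℝ} (hε : 0 < ε) (hβ : 0 < β) (v : V)
    (h : ∀ f : V → ℝ, ∑ j, f j = 0 → Real.exp (1 / (2 * (1 + ε) * β) * greenEnergy G hG f) *
      ∑' m, fieldWeight G β v 0 m ≤ ∑' m, fieldWeight G β v f m)
    {f : V → ℝ} (hf : ∑ j, f j = 0) :
    1 / ((1 + ε) * β) * greenEnergy G hG f * ∑' m, fieldWeight G β v 0 m ≤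
      ∑' m, pairing (fun j => (m j : ℝ)) f ^ 2 * fieldWeight G β v 0 m := by
  have h1 : ∀ (t : ℝ) (m : V → ℤ), Real.exp (t * pairing (fun j => (m j : ℝ)) f) *
      fieldWeight G β v 0 m = fieldWeight G β v (t • f) m := fun t m => by
    rw [← pairing_smul_right, exp_mul_fieldWeight]
  refine le_tsum_sq_of_laplace (fieldWeight_nonneg G β v 0) (fun t => ?_) fun t => ?_
  · simp only [h1]
    exact summable_fieldWeight G hG hβ v _
  · simp only [h1]
    have h2 := h (t • f) (by simp [← Finset.mul_sum, hf])
    rw [greenEnergy_smul] at h2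
    convert h2 using 3
    field_simp

/-! ### Logarithmic growth of the resistance -/

/-- The effective resistance between two points grows logarithmically. -/
theorem log_dist_le_greenEnergy {V : Type*} [Fintype V] [DecidableEq V] {G : SimpleGraph V}
    (hG : G.Connected) {M : ℝ} (hM0 : 0 ≤ M) (hM : HasVolumeGrowth G M)
    (hdeg : ∀ q : V → ℝ, dirForm G q q ≤ 8 * pairing q q) (j k : V) :
    Real.log (G.dist j k + 1) ≤ (4 + M) * Real.log 128 * greenEnergy G hG (dipole k j) := by
  classical
  have hE := greenEnergy_nonneg G hG (sum_dipole k j)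
  have hlog : 0 < Real.log 128 := Real.log_pos (by norm_num)
  rcases eq_or_ne j k with rfl | hjk
  · simp only [SimpleGraph.dist_self, Nat.cast_zero, zero_add, Real.log_one]
    positivity
  have hd : 1 ≤ G.dist j k := (hG.pos_dist_of_ne hjk)
  -- A dipole has energy at least 1/4; this accounts for the incomplete last scale and for short
  -- distances.
  have h1 : 1 ≤ 4 * greenEnergy G hG (dipole k j) := by
    have h2 := pairing_self_le_greenEnergy hG hdeg (sum_dipole k j)
    have h3 : pairing (dipole k j) (dipole k j) = 2 := by
      rw [pairing_dipole]
      simp [dipole, hjk, hjk.symm]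
      norm_num
    linarith
  let N := Nat.log 128 (G.dist j k)
  have hN1 : scale N ≤ G.dist j k := Nat.pow_log_le_self 128 (by omega)
  have hN2 : G.dist j k < scale (N + 1) := Nat.lt_pow_succ_log_self (by norm_num) _
  -- A ramp from 0 to 1 across the annulus between radii ℓ and 2ℓ around `j`. For each of the `N`
  -- scales it separates `j` from `k`, and the annuli are disjoint, so each scale contributes 1 to
  -- the sum bounded by M times the energy.
  let u : ℕ → V → ℝ := fun i x => max 0 (min 1 (((G.dist j x : ℝ) - scale i) / scale i))
  have hℓ : ∀ i, (0 : ℝ) < scale i := fun i => by exact_mod_cast scale_pos i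
  have hu0 : ∀ i x, G.dist j x ≤ scale i → u i x = 0 := by
    intro i x hx
    refine max_eq_left ((min_le_right _ _).trans (div_nonpos_of_nonpos_of_nonneg ?_ (hℓ i).le))
    have : (G.dist j x : ℝ) ≤ scale i := by exact_mod_cast hx
    linarith
  have hu1 : ∀ i x, 2 * scale i ≤ G.dist j x → u i x = 1 := by
    intro i x hx
    have h2 : (1 : ℝ) ≤ ((G.dist j x : ℝ) - scale i) / scale i := by
      rw [le_div_iff₀ (hℓ i)]
      have : 2 * (scale i : ℝ) ≤ G.dist j x := by exact_mod_cast hx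
      linarith
    simp only [u, min_eq_left h2]
    norm_num
  have hlip : ∀ i x y, G.Adj x y → |u i x - u i y| ≤ 1 / scale i := by
    intro i x y hxy
    have hd1 : G.dist x y = 1 := SimpleGraph.dist_eq_one_iff_adj.2 hxy
    have t1 := hG.dist_triangle (u := j) (v := x) (w := y)
    have t2 := hG.dist_triangle (u := j) (v := y) (w := x)
    rw [G.dist_comm (u := y) (v := x)] at t2
    rw [hd1] at t1 t2
    have t1' : (G.dist j y : ℝ) ≤ G.dist j x + 1 := by exact_mod_cast t1
    have t2' : (G.dist j x : ℝ) ≤ G.dist j y + 1 := by exact_mod_cast t2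
    calc |u i x - u i y|
        ≤ |((G.dist j x : ℝ) - scale i) / scale i - ((G.dist j y : ℝ) - scale i) / scale i| :=
          by
          refine (abs_max_sub_max_le_max _ _ _ _).trans (max_le (by simp) ?_)
          exact (abs_min_sub_min_le_max _ _ _ _).trans (max_le (by simp) le_rfl)
      _ ≤ 1 / scale i := by
          rw [← sub_div, abs_div, abs_of_pos (hℓ i)]
          gcongr
          rw [abs_le]
          constructor <;> linarith
  have hnear : ∀ i x y, G.Adj x y → u i x ≠ u i y →
      scale i ≤ G.dist j x ∧ G.dist j x ≤ 2 * scale i := by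
    intro i x y hxy hne
    have hd1 : G.dist x y = 1 := SimpleGraph.dist_eq_one_iff_adj.2 hxy
    have t1 := hG.dist_triangle (u := j) (v := x) (w := y)
    have t2 := hG.dist_triangle (u := j) (v := y) (w := x)
    rw [G.dist_comm (u := y) (v := x)] at t2
    rw [hd1] at t1 t2
    by_contra hcon
    rw [not_and_or] at hcon
    rcases hcon with hcon | hcon
    · exact hne ((hu0 i x (by omega)).trans (hu0 i y (by omega)).symm)
    · exact hne ((hu1 i x (by omega)).trans (hu1 i y (by omega)).symm)
  have hdir : ∀ i, dirForm G (u i) (u i) ≤ M := by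
    intro i
    have h3 := hM i j
    have h2 : ∑ z : V × V with G.Adj z.1 z.2, (u i z.1 - u i z.2) * (u i z.1 - u i z.2) ≤
        ∑ z : V × V with G.Adj z.1 z.2 ∧ G.dist j z.1 ≤ 32 * scale i,
          (1 / (scale i : ℝ)) ^ 2 := by
      rw [Finset.sum_filter, Finset.sum_filter]
      refine Finset.sum_le_sum fun z _ => ?_
      by_cases hz : G.Adj z.1 z.2
      · by_cases hne : u i z.1 = u i z.2
        · rw [if_pos hz, hne, sub_self, zero_mul]; positivity
        · rw [if_pos hz, if_pos ⟨hz, by have := (hnear i _ _ hz hne).2; omega⟩, ← sq]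
          exact sq_le_sq' (by linarith [neg_abs_le (u i z.1 - u i z.2), hlip i _ _ hz])
            ((le_abs_self _).trans (hlip i _ _ hz))
      · rw [if_neg hz]; positivity
    rw [Finset.sum_const, nsmul_eq_mul] at h2
    have h4 : ((Finset.univ.filter fun z : V × V =>
        G.Adj z.1 z.2 ∧ G.dist j z.1 ≤ 32 * scale i).card : ℝ) * (1 / (scale i : ℝ)) ^ 2 ≤
        M * (scale i : ℝ) ^ 2 * (1 / (scale i : ℝ)) ^ 2 :=
      mul_le_mul_of_nonneg_right (by convert h3) (by positivity)
    have h5 : M * (scale i : ℝ) ^ 2 * (1 / (scale i : ℝ)) ^ 2 = M := by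
      have := hℓ i
      field_simp
    have h6 : ∑ z : V × V with G.Adj z.1 z.2, (u i z.1 - u i z.2) * (u i z.1 - u i z.2) ≤ 2 * M := by
      linarith
    unfold dirForm
    rw [div_le_iff₀ (by norm_num)]
    linarith
  have hdisj : ∀ i i', i < i' → ∀ x y, G.Adj x y → u i x = u i y ∨ u i' x = u i' y := by
    intro i i' hii x y hxy
    by_contra hcon
    push Not at hcon
    have h2 := hnear i x y hxy hcon.1
    have h3 := hnear i' x y hxy hcon.2
    have h4 := scale_mul_le hii
    have := scale_pos i
    omega
  have hsum := sum_pairing_sq_le G hG (Finset.range N) u hM0 (fun i _ => hdir i)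
    (fun i _ i' _ hne x y hxy => by
      rcases lt_or_gt_of_ne hne with h | h
      · exact hdisj i i' h x y hxy
      · exact (hdisj i' i h x y hxy).symm) (sum_dipole k j)
  have hone : ∀ i ∈ Finset.range N, pairing (dipole k j) (u i) ^ 2 = 1 := by
    intro i hi
    rw [pairing_dipole, hu0 i j (by simp), hu1 i k]
    · norm_num
    · have := scale_mul_le (Finset.mem_range.1 hi)
      omega
  rw [Finset.sum_congr rfl hone, Finset.sum_const, Finset.card_range, nsmul_eq_mul, mul_one] at hsum
  have hbound : Real.log (G.dist j k + 1) ≤ (N + 1) * Real.log 128 := by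
    have h2 : ((G.dist j k : ℝ) + 1) ≤ (128 : ℝ) ^ (N + 1) := by exact_mod_cast hN2
    have h3 := Real.log_le_log (by positivity) h2
    rw [Real.log_pow] at h3
    exact_mod_cast h3
  nlinarith

/-! ### The conclusion for square domains. -/

/-- The threshold for the inverse temperature. -/
noncomputable def inverseTemperatureBound (ε : ℝ) : ℝ :=
  Real.pi ^ 2 / (2 * 152100 * (4 * ((1 + ((3 * 1025) ^ 2 : ℕ)) * Real.log 4) + 3 +
    5120 * 152100 * ((1 + ε) / ε)))

theorem inverseTemperatureBound_pos {ε : ℝ} (hε : 0 < ε) : 0 < inverseTemperatureBound ε := by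
  have hlog : 0 < Real.log 4 := Real.log_pos (by norm_num)
  have := Real.pi_pos
  unfold inverseTemperatureBound
  positivity

theorem squareDomain_laplace_ge {L : ℕ} (hL : 1 < L) (bc : BoundaryCondition) {ε β : ℝ}
    (hε : 0 < ε) (hβ : 0 < β) (hβ' : β < inverseTemperatureBound ε) (v : Fin L × Fin L)
    (f : Fin L × Fin L → ℝ) (hf : ∑ j, f j = 0) :
    Real.exp (1 / (2 * (1 + ε) * β) *
      greenEnergy (squareDomain L bc) (squareDomain_connected hL bc) f) *
        ∑' m, fieldWeight (squareDomain L bc) β v 0 m ≤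
      ∑' m, fieldWeight (squareDomain L bc) β v f m := by
  refine fieldWeight_laplace_ge (squareDomain_connected hL bc) (squareDomain_hasPacking hL bc)
    (squareDomain_hasVolumeGrowth hL bc) (by norm_num) (squareDomain_dirForm_le hL bc) hε hβ ?_ v hf
  have hlog : 0 < Real.log 4 := Real.log_pos (by norm_num)
  rw [le_div_iff₀ (by positivity), mul_comm]
  unfold inverseTemperatureBound at hβ'
  rw [lt_div_iff₀ (by positivity)] at hβ'
  linarith

theorem theorem1p1 :
    ∃ c : ℝ, 0 < c ∧ ∀ ε : ℝ, 0 < ε → ∃ β₀ : ℝ, 0 < β₀ ∧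
      ∀ (bc : BoundaryCondition) (L : ℕ) (hL : 1 < L), (bc = .periodic → Even L) →
      ∀ β : ℝ, 0 < β → β < β₀ → ∀ v : Fin L × Fin L,
        (∀ f : Fin L × Fin L → ℝ, ∑ j, f j = 0 →
          ∫ m, Real.exp (pairing (fun j => (m j : ℝ)) f) ∂(ivGFF (squareDomain L bc) β v) ≥
            Real.exp (1 / (2 * (1 + ε) * β) *
              pairing f (-(laplacianPseudoinverse (squareDomain L bc)
                (squareDomain_connected hL bc) f)))) ∧
        (∀ f : Fin L × Fin L → ℝ, ∑ j, f j = 0 →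
          ∫ m, (pairing (fun j => (m j : ℝ)) f) ^ 2 ∂(ivGFF (squareDomain L bc) β v) ≥
            1 / ((1 + ε) * β) *
              pairing f (-(laplacianPseudoinverse (squareDomain L bc)
                (squareDomain_connected hL bc) f))) ∧
        (∀ j k : Fin L × Fin L,
          ∫ m, ((m j : ℝ) - (m k : ℝ)) ^ 2 ∂(ivGFF (squareDomain L bc) β v) ≥
            c / β * Real.log (((squareDomain L bc).dist j k : ℝ) + 1)) := by
  -- The third bound uses the second with ε = 1, which is why the constant does not depend on ε (its
  -- 2 is 1 + 1) and why the threshold for ε = 1 enters the minimum.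
  refine ⟨1 / (2 * ((4 + 152100) * Real.log 128)), ?_, fun ε hε =>
    ⟨min (inverseTemperatureBound ε) (inverseTemperatureBound 1),
      lt_min (inverseTemperatureBound_pos hε) (inverseTemperatureBound_pos one_pos), ?_⟩⟩
  · have : 0 < Real.log 128 := Real.log_pos (by norm_num)
    positivity
  intro bc L hL _ β hβ hβ' v
  set G := squareDomain L bc
  have hG : G.Connected := squareDomain_connected hL bc
  have hZ : 0 < ∑' m, fieldWeight G β v 0 m := tsum_fieldWeight_pos G hG hβ v 0
  have hsq : ∀ {ε : ℝ}, 0 < ε → β < inverseTemperatureBound ε → ∀ f : Fin L × Fin L → ℝ,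
      ∑ j, f j = 0 → 1 / ((1 + ε) * β) * greenEnergy G hG f ≤
        ∫ m, (pairing (fun j => (m j : ℝ)) f) ^ 2 ∂(ivGFF G β v) := by
    intro ε hε hβε f hf
    rw [integral_ivGFF G β v fun m => sq_nonneg _, le_div_iff₀ hZ]
    exact fieldWeight_sq_ge hG hε hβ v (squareDomain_laplace_ge hL bc hε hβ hβε v) hf
  refine ⟨fun f hf => ?_, fun f hf => ?_, fun j k => ?_⟩
  · rw [integral_ivGFF G β v fun m => (Real.exp_pos _).le, ge_iff_le, le_div_iff₀ hZ]
    simp only [exp_mul_fieldWeight]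
    exact squareDomain_laplace_ge hL bc hε hβ (hβ'.trans_le (min_le_left _ _)) v f hf
  · exact hsq hε (hβ'.trans_le (min_le_left _ _)) f hf
  · have h1 := hsq one_pos (hβ'.trans_le (min_le_right _ _)) (dipole k j) (sum_dipole k j)
    have h2 := log_dist_le_greenEnergy hG (by norm_num) (squareDomain_hasVolumeGrowth hL bc)
      (squareDomain_dirForm_le hL bc) j k
    simp only [pairing_comm _ (dipole k j), pairing_dipole] at h1
    refine le_trans ?_ h1
    have hlog : 0 < Real.log 128 := Real.log_pos (by norm_num)
    calc 1 / (2 * ((4 + 152100) * Real.log 128)) / β * Real.log ((G.dist j k : ℝ) + 1)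
        ≤ 1 / (2 * ((4 + 152100) * Real.log 128)) / β *
            ((4 + 152100) * Real.log 128 * greenEnergy G hG (dipole k j)) := by gcongr
      _ = 1 / ((1 + 1) * β) * greenEnergy G hG (dipole k j) := by field_simp; ring
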